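/- **Setting.** A Smale space $(X,\phi)$ is a compact metric space $(X,d)$ with a homeomorphism $\phi$, constants $\varepsilon_X>0$, $0<\lambda<1$ and a continuous bracket $[x,y]\in X$, defined for $d(x,y)\le\varepsilon_X$, such that $[x,x]=x$, $[x,[y,z]]=[x,z]=[[x,y],z]$, $\phi[x,y]=[\phi x,\phi y]$ whenever both sides are defined, $d(\phi x,\phi y)\le\lambda d(x,y)$ if $[x,y]=y$, and $d(\phi^{-1}x,\phi^{-1}y)\le\lambda d(x,y)$ if $[x,y]=x$. Let $X^s(x)$ (resp. $X^u(x)$) be the set of $y$ with $d(\phi^nx,\phi^ny)\to0$ as $n\to+\infty$ (resp. $n\to-\infty$); for $0<\delta\le\varepsilon_X$ put $X^s(x,\delta)=\{y: d(x,y)<\delta,\ [y,x]=x\}$ and $X^u(x,\delta)=\{y: d(x,y)<\delta,\ [x,y]=x\}$. The sets $X^s(x)$, $X^u(x)$ carry the topologies generated by their local stable (unstable) sets. A continuous equivariant map $f$ is $s$-bijective (resp. $u$-bijective) if it maps each $X^s(x)$ (resp. $X^u(x)$) bijectively onto the stable (resp. unstable) set of $f(x)$. Let $\pi=(Y,\psi,\pi_s,Z,\zeta,\pi_u)$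 be an $s/u$-bijective pair for a Smale space $(X,\phi)$: $Y,Z$ are Smale spaces, $\pi_s:Y\to X$ is an $s$-bijective and $\pi_u:Z\to X$ a $u$-bijective continuous equivariant surjection, and all unstable sets of $Y$ and all stable sets of $Z$ are totally disconnected. For $L,M\ge0$ let $$\Sigma_{L,M}=\{(y_0,\dots,y_L,z_0,\dots,z_M)\in Y^{L+1}\times Z^{M+1}: \pi_s(y_l)=\pi_u(z_m)\text{ for all }l,m\},$$ a Smale space with the coordinatewise structure; write $\delta_l$ (resp. $\delta_{,m}$) for the map deleting $y_l$ (resp. $z_m$), let $\alpha\in S_{L+1}$ act by permuting the $y_l$, and for $0\le l\le L-1$, $1\le j\le L-l$ let $\sigma_js_l:\Sigma_{L-1,M}\to\Sigma_{L,M}$ insert a copy of $y_l$ at position $l+j$. For one of the (totally disconnected) Smale spaces $\Sigma=\Sigma_{L,M}$ let $CO^s(\Sigma)$ be the family of compact open subsets of stable sets $\Sigma^s(e)$, $e\in\Sigma$. The dimension group $D^s(\Sigma)$ is the abelian group generated by the classes $[E]$ of $E\in CO^s(\Sigma)$ modulo $\sim$, with relations $[E\cup F]=[E]+[F]$ for $E,F,E\cup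 F\in CO^s(\Sigma)$, $E\cap F=\emptyset$. Here $\sim$ is the smallest equivalence relation such that $E\sim F$ if and only if $\sigma(E)\sim\sigma(F)$ ($\sigma$ being the homeomorphism of $\Sigma$), and $E\sim F$ whenever $E$ and $F$ are each contained in a local stable set of radius $\varepsilon_\Sigma/2$, all brackets between points of $E$ and of $F$ are defined, $[E,F]=E$ and $[F,E]=F$. **Statement.** The maps $\delta_l$, $\sigma_js_l$ and $\alpha\in S_{L+1}$ induce homomorphisms of dimension groups with $f^s[E]=[f(E)]$; we write $\alpha$ also for $\alpha^s$. The maps $\delta_{,m}$ induce homomorphisms in the opposite direction with $\delta_{,m}^{s*}[F]=\sum_i[E_i]$ for every finite partition of $\delta_{,m}^{-1}(F)$ into $E_i\in CO^s$, and such partitions exist. With $C_{L,M}=D^s(\Sigma_{L,M})$, $$\partial^s=\sum_{l=0}^{L}(-1)^l\delta_l^s:C_{L,M}\to C_{L-1,M},\qquad \partial^{s*}=\sum_{m=0}^{M+1}(-1)^{L+m}\delta_{,m}^{s*}:C_{L,M}\to C_{L,M+1}$$ (and $\partial^s=0$ on $C_{0,M}$), $(C_{\bullet,\bullet},\partial^s,\partial^{s*})$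 is a double complex: both differentials square to zero and they anticommute. Let $D^s_{\mathcal B}(\Sigma_{L,M})\subseteq C_{L,M}$ be the subgroup generated by all $a$ with $\alpha(a)=a$ for some non-trivial transposition $\alpha\in S_{L+1}$ and all $a-\mathrm{sgn}(\alpha)\alpha(a)$ with $a\in C_{L,M}$, $\alpha\in S_{L+1}$. Let $DC_{L,M}\subseteq C_{L,M}$ be the subgroup generated by the images of all $(\sigma_js_l)^s:C_{L-1,M}\to C_{L,M}$ (none if $L=0$) and all $\alpha(a)-\mathrm{sgn}(\alpha)a$ with $a\in C_{L,M}$, $\alpha\in S_{L+1}$. Then: 1. $D^s_{\mathcal B}(\Sigma_{L,M})=DC_{L,M}$ for all $L,M\ge0$. 2. Both families of subgroups are preserved by $\partial^s$ and $\partial^{s*}$, and there is an isomorphism of double complexes, compatible with the projections from $C$, between $C/DC$ and Putnam's complex $C^s_{\mathcal Q}(\pi)$, $(C_{\mathcal Q})_{L,M}=D^s(\Sigma_{L,M})/D^s_{\mathcal B}(\Sigma_{L,M})$, each with the induced differentials. 3. For each $M\ge0$ the projection $(C_{\bullet,M},\partial^s)\to((C_{\mathcal Q})_{\bullet,M},\partial^s)$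 is a quasi-isomorphism of chain complexes. -/

import Mathlib

open Set Filter Topology CategoryTheory

universe u v w

/-! ### Smale spaces -/

/-- A Smale space: a compact metric space with a homeomorphism `φ`, and a bracket `[x, y]` which
is defined (and jointly continuous) for `dist x y ≤ ε`; the values of `br` elsewhere are
irrelevant. The identities are required whenever both sides are defined. -/
class SmaleSpace (X : Type u) [MetricSpace X] [CompactSpace X] where
  φ : X ≃ₜ X
  ε : ℝ
  ε_pos : 0 < ε
  lam : ℝ
  lam_pos : 0 < lam
  lam_lt_one : lam < 1
  br : X → X → X
  br_cont : ContinuousOn (fun p : X × X => br p.1 p.2) {p | dist p.1 p.2 ≤ ε}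
  br_self : ∀ x, br x x = x
  br_br_right : ∀ x y z, dist y z ≤ ε → dist x (br y z) ≤ ε → dist x z ≤ ε →
    br x (br y z) = br x z
  br_br_left : ∀ x y z, dist x y ≤ ε → dist (br x y) z ≤ ε → dist x z ≤ ε →
    br (br x y) z = br x z
  map_br : ∀ x y, dist x y ≤ ε → dist (φ x) (φ y) ≤ ε → φ (br x y) = br (φ x) (φ y)
  contract : ∀ x y, dist x y ≤ ε → br x y = y → dist (φ x) (φ y) ≤ lam * dist x y
  expand : ∀ x y, dist x y ≤ ε → br x y = x → dist (φ.symm x) (φ.symm y) ≤ lam * dist x y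

namespace SmaleSpace

variable {X : Type u} [MetricSpace X] [CompactSpace X] [SmaleSpace X]
variable {Y : Type v} [MetricSpace Y] [CompactSpace Y] [SmaleSpace Y]

/-- The global stable set `X^s(x)`. -/
def stableSet (x : X) : Set X :=
  {y | Tendsto (fun n : ℕ => dist ((φ (X := X))^[n] x) ((φ (X := X))^[n] y)) atTop (𝓝 0)}

/-- The global unstable set `X^u(x)`. -/
def unstableSet (x : X) : Set X :=
  {y | Tendsto (fun n : ℕ => dist ((φ (X := X)).symm^[n] x) ((φ (X := X)).symm^[n] y))
    atTop (𝓝 0)}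

/-- The local stable set `X^s(x, δ)`, meaningful for `0 < δ ≤ ε`. -/
def localStable (x : X) (δ : ℝ) : Set X := {y | dist x y < δ ∧ br y x = x}

/-- The local unstable set `X^u(x, δ)`, meaningful for `0 < δ ≤ ε`. -/
def localUnstable (x : X) (δ : ℝ) : Set X := {y | dist x y < δ ∧ br x y = x}

variable (X) in
/-- The topology on the disjoint union of all global stable sets (as a set, this is `X`) in which
the local stable sets form a basis. Each `X^s(x)` is open in it and carries its usual (locally
compact) topology as a subspace. -/
abbrev stableTopology : TopologicalSpace X :=
  TopologicalSpace.generateFrom {s | ∃ (x : X) (δ : ℝ), 0 < δ ∧ δ ≤ ε X ∧ s = localStable x δ}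

variable (X) in
/-- The topology on the disjoint union of all global unstable sets generated by the local
unstable sets. -/
abbrev unstableTopology : TopologicalSpace X :=
  TopologicalSpace.generateFrom {s | ∃ (x : X) (δ : ℝ), 0 < δ ∧ δ ≤ ε X ∧ s = localUnstable x δ}

/-- `f` maps each `X^s(x)` bijectively onto `Y^s(f x)`. -/
def SBijective (f : X → Y) : Prop := ∀ x, BijOn f (stableSet x) (stableSet (f x))

/-- `f` maps each `X^u(x)` bijectively onto `Y^u(f x)`. -/
def UBijective (f : X → Y) : Prop := ∀ x, BijOn f (unstableSet x) (unstableSet (f x))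

/-! ### The stable dimension group -/

variable (X) in
/-- `CO^s(X)`: compact open subsets of some global stable set `X^s(e)`. -/
@[ext]
structure CO where
  carrier : Set X
  exists_subset : ∃ e, carrier ⊆ stableSet e
  isOpen : IsOpen[stableTopology X] carrier
  isCompact : @IsCompact X (stableTopology X) carrier

/-- The smallest equivalence relation on `CO^s(X)` with `E ∼ F` if `[E, F] = E` and `[F, E] = F`
(for `E`, `F` contained in local stable sets, and `[E, F]`, `[F, E]` defined) and with
`E ∼ F` if and only if `φ(E) ∼ φ(F)`. -/
inductive CO.Rel : CO X → CO X → Prop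
  | refl (E) : CO.Rel E E
  | symm {E F} : CO.Rel E F → CO.Rel F E
  | trans {E F G} : CO.Rel E F → CO.Rel F G → CO.Rel E G
  | bracket {E F : CO X} (e f : X)
      (hE : E.carrier ⊆ localStable e (ε X / 2)) (hF : F.carrier ⊆ localStable f (ε X / 2))
      (hd : ∀ a ∈ E.carrier, ∀ b ∈ F.carrier, dist a b ≤ ε X)
      (hEF : image2 br E.carrier F.carrier = E.carrier)
      (hFE : image2 br F.carrier E.carrier = F.carrier) : CO.Rel E F
  | map {E F E' F' : CO X} (hE : E'.carrier = φ (X := X) '' E.carrier)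
      (hF : F'.carrier = φ (X := X) '' F.carrier) : CO.Rel E F → CO.Rel E' F'
  | of_map {E F E' F' : CO X} (hE : E'.carrier = φ (X := X) '' E.carrier)
      (hF : F'.carrier = φ (X := X) '' F.carrier) : CO.Rel E' F' → CO.Rel E F

variable (X) in
/-- The relation `CO.Rel` as a setoid. -/
def CO.setoid : Setoid (CO X) := ⟨CO.Rel, ⟨CO.Rel.refl, CO.Rel.symm, CO.Rel.trans⟩⟩

variable (X) in
/-- The subgroup generated by the elements `[E ∪ F] - [E] - [F]` with `E`, `F`, `E ∪ F` in
`CO^s(X)` and `E ∩ F = ∅`. -/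
def DRelations : AddSubgroup (FreeAbelianGroup (Quotient (CO.setoid X))) :=
  AddSubgroup.closure {a | ∃ E F G : CO X, G.carrier = E.carrier ∪ F.carrier ∧
    Disjoint E.carrier F.carrier ∧
    a = FreeAbelianGroup.of (Quotient.mk (CO.setoid X) G)
      - FreeAbelianGroup.of (Quotient.mk (CO.setoid X) E)
      - FreeAbelianGroup.of (Quotient.mk (CO.setoid X) F)}

variable (X) in
/-- The stable dimension group `D^s(X)`. -/
abbrev D : Type u := FreeAbelianGroup (Quotient (CO.setoid X)) ⧸ DRelations X

/-- The class `[E]` in `D^s(X)`. -/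
def D.cls (E : CO X) : D X :=
  QuotientAddGroup.mk (FreeAbelianGroup.of (Quotient.mk (CO.setoid X) E))

theorem D.hom_ext {A : Type w} [AddCommGroup A] {p q : D X →+ A}
    (h : ∀ E, p (D.cls E) = q (D.cls E)) : p = q := by
  apply QuotientAddGroup.addMonoidHom_ext
  refine FreeAbelianGroup.lift_ext _ _ (fun x => ?_)
  induction x using Quotient.inductionOn with
  | h E => exact h E

/-- `p` is the covariant map induced by `f` on dimension groups: `p [E] = [f(E)]`. -/
def IsPushforward (f : X → Y) (p : D X →+ D Y) : Prop :=
  ∀ E : CO X, ∃ F : CO Y, F.carrier = f '' E.carrier ∧ p (D.cls E) = D.cls F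

/-- `s` is a finite partition of the set `A` into elements of `CO^s(X)`. -/
def IsCOPartition (s : Finset (CO X)) (A : Set X) : Prop :=
  ((s : Set (CO X)).PairwiseDisjoint CO.carrier) ∧ ⋃ E ∈ s, E.carrier = A

/-- `q` is the contravariant map induced by `f` on dimension groups: `q [F] = ∑ [E_i]` where the
`E_i` partition `f⁻¹(F)` (which meets several stable sets in general). -/
def IsPullback (f : X → Y) (q : D Y →+ D X) : Prop :=
  ∀ F : CO Y, (∃ s : Finset (CO X), IsCOPartition s (f ⁻¹' F.carrier)) ∧
    ∀ s : Finset (CO X), IsCOPartition s (f ⁻¹' F.carrier) → q (D.cls F) = ∑ E ∈ s, D.cls E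

theorem IsPushforward.unique {f : X → Y} {p p' : D X →+ D Y} (h : IsPushforward f p)
    (h' : IsPushforward f p') : p = p' := by
  refine D.hom_ext fun E => ?_
  obtain ⟨F, hF, e⟩ := h E
  obtain ⟨F', hF', e'⟩ := h' E
  rw [e, e', CO.ext (hF.trans hF'.symm)]

theorem IsPullback.unique {f : X → Y} {q q' : D Y →+ D X} (h : IsPullback f q)
    (h' : IsPullback f q') : q = q' := by
  refine D.hom_ext fun F => ?_
  obtain ⟨s, hs⟩ := (h F).1
  rw [(h F).2 s hs, (h' F).2 s hs]

open Classical in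
/-- The unique homomorphism `f^s` with `f^s [E] = [f(E)]`, if there is one. -/
noncomputable def pushforward (f : X → Y) : D X →+ D Y :=
  if h : ∃ p, IsPushforward f p then h.choose else 0

open Classical in
/-- The unique homomorphism `f^{s*}` with `f^{s*} [F] = [f⁻¹(F)]`, if there is one. -/
noncomputable def pullback (f : X → Y) : D Y →+ D X :=
  if h : ∃ q, IsPullback f q then h.choose else 0

/-! ### Equivariant maps respect brackets of nearby points -/

theorem exists_br_close {η : ℝ} (hη : 0 < η) :
    ∃ δ > 0, δ ≤ ε X ∧ δ ≤ η ∧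
      ∀ x y : X, dist x y ≤ δ → dist x (br x y) ≤ η ∧ dist y (br x y) ≤ η := by
  have hK : IsCompact {p : X × X | dist p.1 p.2 ≤ ε X} :=
    (isClosed_le (by fun_prop) continuous_const).isCompact
  have hu := hK.uniformContinuousOn_of_continuous (br_cont (X := X))
  rw [Metric.uniformContinuousOn_iff_le] at hu
  obtain ⟨δ, hδ, h⟩ := hu (η / 2) (half_pos hη)
  refine ⟨min δ (min (ε X) (η / 2)), by have := ε_pos (X := X); positivity,
    (min_le_right _ _).trans (min_le_left _ _),
    ((min_le_right _ _).trans (min_le_right _ _)).trans (by linarith), fun x y hxy => ?_⟩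
  have h1 : dist x y ≤ δ := hxy.trans (min_le_left _ _)
  have h2 : dist x y ≤ ε X := hxy.trans ((min_le_right _ _).trans (min_le_left _ _))
  have h3 : dist x y ≤ η / 2 := hxy.trans ((min_le_right _ _).trans (min_le_right _ _))
  have h4 : dist x (br x y) ≤ η / 2 := by
    have := h (x, x) (by simp [(ε_pos (X := X)).le]) (x, y) h2 (by
      simpa [Prod.dist_eq] using h1)
    simpa [br_self] using this
  refine ⟨by linarith, ?_⟩
  have := dist_triangle y x (br x y)
  rw [dist_comm y x] at this
  linarith

theorem forward_close {x y : X} (hd : dist x y ≤ ε X) (hb : br x y = y) (n : ℕ) :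
    dist ((φ (X := X))^[n] x) ((φ (X := X))^[n] y) ≤ lam X ^ n * dist x y ∧
      br ((φ (X := X))^[n] x) ((φ (X := X))^[n] y) = (φ (X := X))^[n] y := by
  induction n with
  | zero => simpa using hb
  | succ n ih =>
    obtain ⟨h1, h2⟩ := ih
    have hl : lam X ^ n * dist x y ≤ dist x y :=
      mul_le_of_le_one_left dist_nonneg (pow_le_one₀ lam_pos.le lam_lt_one.le)
    have h3 := contract _ _ (h1.trans (hl.trans hd)) h2
    simp only [Function.iterate_succ_apply']
    have h4 : lam X * dist ((φ (X := X))^[n] x) ((φ (X := X))^[n] y)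
        ≤ lam X ^ (n + 1) * dist x y := by
      rw [pow_succ']
      nlinarith [lam_pos (X := X)]
    refine ⟨h3.trans h4, ?_⟩
    have hl' : lam X ^ (n + 1) * dist x y ≤ dist x y :=
      mul_le_of_le_one_left dist_nonneg (pow_le_one₀ lam_pos.le lam_lt_one.le)
    rw [← map_br _ _ (h1.trans (hl.trans hd)) (h3.trans (h4.trans (hl'.trans hd))), h2]

theorem backward_close {x y : X} (hd : dist x y ≤ ε X) (hb : br x y = x) (n : ℕ) :
    dist ((φ (X := X)).symm^[n] x) ((φ (X := X)).symm^[n] y) ≤ lam X ^ n * dist x y ∧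
      br ((φ (X := X)).symm^[n] x) ((φ (X := X)).symm^[n] y) = (φ (X := X)).symm^[n] x := by
  induction n with
  | zero => simpa using hb
  | succ n ih =>
    obtain ⟨h1, h2⟩ := ih
    have hl : lam X ^ n * dist x y ≤ dist x y :=
      mul_le_of_le_one_left dist_nonneg (pow_le_one₀ lam_pos.le lam_lt_one.le)
    have h3 := expand _ _ (h1.trans (hl.trans hd)) h2
    simp only [Function.iterate_succ_apply']
    have h4 : lam X * dist ((φ (X := X)).symm^[n] x) ((φ (X := X)).symm^[n] y)
        ≤ lam X ^ (n + 1) * dist x y := by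
      rw [pow_succ']
      nlinarith [lam_pos (X := X)]
    refine ⟨h3.trans h4, ?_⟩
    have hl' : lam X ^ (n + 1) * dist x y ≤ dist x y :=
      mul_le_of_le_one_left dist_nonneg (pow_le_one₀ lam_pos.le lam_lt_one.le)
    apply (φ (X := X)).injective
    rw [map_br _ _ (h3.trans (h4.trans (hl'.trans hd)))
      (by simpa using h1.trans (hl.trans hd))]
    simpa using h2

/-- Two points whose orbits stay close for all times coincide. -/
theorem exists_expansive :
    ∃ δ > 0, ∀ a b : X,
      (∀ n : ℕ, dist ((φ (X := X))^[n] a) ((φ (X := X))^[n] b) ≤ δ) →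
      (∀ n : ℕ, dist ((φ (X := X)).symm^[n] a) ((φ (X := X)).symm^[n] b) ≤ δ) → a = b := by
  obtain ⟨δ, hδ, hδε, -, hc⟩ := exists_br_close (X := X) (ε_pos (X := X))
  have key1 : ∀ x y : X, dist x y ≤ δ → br x (br x y) = br x y := fun x y h =>
    br_br_right x x y (h.trans hδε) (hc x y h).1 (h.trans hδε)
  have key2 : ∀ x y : X, dist x y ≤ δ → br (br x y) y = br x y := fun x y h =>
    br_br_left x y y (h.trans hδε) (by rw [dist_comm]; exact (hc x y h).2) (h.trans hδε)
  refine ⟨δ, hδ, fun a b hf hb => ?_⟩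
  have hfb : ∀ n : ℕ, (φ (X := X))^[n] (br a b)
      = br ((φ (X := X))^[n] a) ((φ (X := X))^[n] b) := by
    intro n
    induction n with
    | zero => rfl
    | succ n ih =>
      rw [Function.iterate_succ_apply', ih, map_br _ _ ((hf n).trans hδε)]
      · simp only [Function.iterate_succ_apply']
      · have := (hf (n + 1)).trans hδε
        simpa only [Function.iterate_succ_apply'] using this
  have hbb : ∀ n : ℕ, (φ (X := X)).symm^[n] (br a b)
      = br ((φ (X := X)).symm^[n] a) ((φ (X := X)).symm^[n] b) := by
    intro n
    induction n with
    | zero => rfl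
    | succ n ih =>
      apply (φ (X := X)).injective
      rw [map_br _ _ ((hb (n + 1)).trans hδε)]
      · simpa only [Function.iterate_succ_apply', Homeomorph.apply_symm_apply] using ih
      · have := (hb n).trans hδε
        simpa only [Function.iterate_succ_apply', Homeomorph.apply_symm_apply] using this
  have hlim : Tendsto (fun n : ℕ => lam X ^ n * ε X) atTop (𝓝 0) := by
    simpa using (tendsto_pow_atTop_nhds_zero_of_lt_one (lam_pos (X := X)).le
      lam_lt_one).mul_const (ε X)
  have inv1 : ∀ n : ℕ, ∀ x : X, (φ (X := X))^[n] ((φ (X := X)).symm^[n] x) = x := fun n =>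
    Function.LeftInverse.iterate (φ (X := X)).apply_symm_apply n
  have inv2 : ∀ n : ℕ, ∀ x : X, (φ (X := X)).symm^[n] ((φ (X := X))^[n] x) = x := fun n =>
    Function.LeftInverse.iterate (φ (X := X)).symm_apply_apply n
  have h1 : a = br a b := by
    refine dist_le_zero.1 (ge_of_tendsto' hlim fun n => ?_)
    have hd := (hc _ _ (hb n)).1
    have := (forward_close hd (key1 _ _ (hb n)) n).1
    rw [← hbb n, inv1, inv1] at this
    refine this.trans (mul_le_mul_of_nonneg_left ?_ (pow_nonneg lam_pos.le n))
    rw [hbb n]; exact hd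
  have h2 : br a b = b := by
    refine dist_le_zero.1 (ge_of_tendsto' hlim fun n => ?_)
    have hd := (hc _ _ (hf n)).2
    rw [dist_comm] at hd
    have := (backward_close hd (key2 _ _ (hf n)) n).1
    rw [← hfb n, inv2, inv2] at this
    refine this.trans (mul_le_mul_of_nonneg_left ?_ (pow_nonneg lam_pos.le n))
    rw [hfb n]; exact hd
  exact h1.trans h2

theorem exists_map_br {f : X → Y} (hc : Continuous f) (he : ∀ x, f (φ x) = φ (f x)) :
    ∃ δ > 0, ∀ x y : X, dist x y ≤ δ → f (br x y) = br (f x) (f y) := by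
  obtain ⟨δ₀, hδ₀, hexp⟩ := exists_expansive (X := Y)
  obtain ⟨δ₁, hδ₁, hδ₁ε, -, hY⟩ := exists_br_close (X := Y)
    (η := min (δ₀ / 2) (ε Y)) (lt_min (half_pos hδ₀) ε_pos)
  have hu := (CompactSpace.uniformContinuous_of_continuous hc)
  rw [Metric.uniformContinuous_iff_le] at hu
  obtain ⟨δ₂, hδ₂, hu₂⟩ := hu (δ₀ / 2) (half_pos hδ₀)
  obtain ⟨δ₃, hδ₃, hu₃⟩ := hu δ₁ hδ₁
  obtain ⟨δ₄, hδ₄, hδ₄ε, -, hX⟩ := exists_br_close (X := X)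
    (η := min δ₂ (ε X)) (lt_min hδ₂ ε_pos)
  have itf : ∀ n : ℕ, ∀ x, f ((φ (X := X))^[n] x) = (φ (X := Y))^[n] (f x) := fun n =>
    (Function.Semiconj.iterate_right (f := f) he n)
  have he' : ∀ x, f ((φ (X := X)).symm x) = (φ (X := Y)).symm (f x) := fun x => by
    apply (φ (X := Y)).injective
    rw [← he]; simp
  have itb : ∀ n : ℕ, ∀ x, f ((φ (X := X)).symm^[n] x) = (φ (X := Y)).symm^[n] (f x) := fun n =>
    (Function.Semiconj.iterate_right (f := f) he' n)
  have le1 : ∀ {W : Type _} [MetricSpace W] [CompactSpace W] [SmaleSpace W] (n : ℕ) (r : ℝ),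
      0 ≤ r → lam W ^ n * r ≤ r := fun n r hr =>
    mul_le_of_le_one_left hr (pow_le_one₀ lam_pos.le lam_lt_one.le)
  have le2 : ∀ {W : Type _} [MetricSpace W] [CompactSpace W] [SmaleSpace W] (n : ℕ) (r : ℝ),
      0 ≤ r → lam W ^ n * r ≤ r := fun n r hr =>
    mul_le_of_le_one_left hr (pow_le_one₀ lam_pos.le lam_lt_one.le)
  refine ⟨min δ₃ δ₄, lt_min hδ₃ hδ₄, fun x y hxy => ?_⟩
  have hx := hX x y (hxy.trans (min_le_right _ _))
  have hxε : dist x y ≤ ε X := (hxy.trans (min_le_right _ _)).trans hδ₄ε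
  have hfxy : dist (f x) (f y) ≤ δ₁ := hu₃ (hxy.trans (min_le_left _ _))
  have hy := hY (f x) (f y) hfxy
  have hyε : dist (f x) (f y) ≤ ε Y := hfxy.trans hδ₁ε
  have xs : br x (br x y) = br x y :=
    br_br_right x x y hxε (hx.1.trans (min_le_right _ _)) hxε
  have xu : br (br x y) y = br x y :=
    br_br_left x y y hxε (by rw [dist_comm]; exact hx.2.trans (min_le_right _ _)) hxε
  have ys : br (f x) (br (f x) (f y)) = br (f x) (f y) :=
    br_br_right _ _ _ hyε (hy.1.trans (min_le_right _ _)) hyε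
  have yu : br (br (f x) (f y)) (f y) = br (f x) (f y) :=
    br_br_left _ _ _ hyε (by rw [dist_comm]; exact hy.2.trans (min_le_right _ _)) hyε
  refine hexp _ _ (fun n => ?_) (fun n => ?_)
  · have a1 := (forward_close (hx.1.trans (min_le_right _ _)) xs n).1
    have a2 := hu₂ ((a1.trans (le1 n _ dist_nonneg)).trans (hx.1.trans (min_le_left _ _)))
    have a3 := (forward_close (hy.1.trans (min_le_right _ _)) ys n).1
    have a4 := (a3.trans (le2 n _ dist_nonneg)).trans (hy.1.trans (min_le_left _ _))
    rw [itf, itf] at a2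
    have := dist_triangle_left ((φ (X := Y))^[n] (f (br x y)))
      ((φ (X := Y))^[n] (br (f x) (f y))) ((φ (X := Y))^[n] (f x))
    linarith
  · have a1 := (backward_close (x := br x y) (y := y)
      (by rw [dist_comm]; exact hx.2.trans (min_le_right _ _)) xu n).1
    rw [dist_comm (br x y) y] at a1
    have a2 := hu₂ ((a1.trans (le1 n _ dist_nonneg)).trans (hx.2.trans (min_le_left _ _)))
    have a3 := (backward_close (x := br (f x) (f y)) (y := f y)
      (by rw [dist_comm]; exact hy.2.trans (min_le_right _ _)) yu n).1
    rw [dist_comm (br (f x) (f y)) (f y)] at a3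
    have a4 := (a3.trans (le2 n _ dist_nonneg)).trans (hy.2.trans (min_le_left _ _))
    rw [itb, itb] at a2
    have := dist_triangle ((φ (X := Y)).symm^[n] (f (br x y)))
      ((φ (X := Y)).symm^[n] (f y)) ((φ (X := Y)).symm^[n] (br (f x) (f y)))
    rw [dist_comm ((φ (X := Y)).symm^[n] (br (f x) (f y)))] at a4
    linarith

end SmaleSpace

open SmaleSpace

/-! ### s/u-bijective pairs and the spaces `Σ_{L,M}` -/

/-- An s/u-bijective pair `π = (Y, ψ, π_s, Z, ζ, π_u)` for the Smale space `X`. -/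
structure SUBijectivePair (X : Type u) (Y : Type v) (Z : Type w)
    [MetricSpace X] [CompactSpace X] [SmaleSpace X]
    [MetricSpace Y] [CompactSpace Y] [SmaleSpace Y]
    [MetricSpace Z] [CompactSpace Z] [SmaleSpace Z] where
  πs : Y → X
  πs_cont : Continuous πs
  πs_surj : Function.Surjective πs
  πs_equivariant : ∀ y, πs (φ y) = φ (πs y)
  πs_bij : SBijective πs
  totallyDisconnected_unstable :
    ∀ y : Y, @IsTotallyDisconnected Y (unstableTopology Y) (unstableSet y)
  πu : Z → X
  πu_cont : Continuous πu
  πu_surj : Function.Surjective πu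
  πu_equivariant : ∀ z, πu (φ z) = φ (πu z)
  πu_bij : UBijective πu
  totallyDisconnected_stable :
    ∀ z : Z, @IsTotallyDisconnected Z (stableTopology Z) (stableSet z)

/-! ### Double complexes -/

/-- A first-quadrant double complex of abelian groups, with `dh` lowering the first index, `dv`
raising the second one, and anticommuting squares (so that `dh + dv` is a differential on the
total complex). -/
structure DoubleComplex where
  obj : ℕ → ℕ → Type u
  [grp : ∀ L M, AddCommGroup (obj L M)]
  dh : ∀ L M, obj (L + 1) M →+ obj L M
  dv : ∀ L M, obj L M →+ obj L (M + 1)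
  dh_dh : ∀ L M a, dh L M (dh (L + 1) M a) = 0
  dv_dv : ∀ L M a, dv L (M + 1) (dv L M a) = 0
  anticomm : ∀ L M a, dh L (M + 1) (dv (L + 1) M a) + dv L M (dh L M a) = 0

namespace DoubleComplex

attribute [instance] DoubleComplex.grp

/-- An isomorphism of double complexes. -/
structure Iso (A B : DoubleComplex.{u}) where
  equiv : ∀ L M, A.obj L M ≃+ B.obj L M
  comm_h : ∀ L M a, equiv L M (A.dh L M a) = B.dh L M (equiv (L + 1) M a)
  comm_v : ∀ L M a, equiv L (M + 1) (A.dv L M a) = B.dv L M (equiv L M a)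

variable (C : DoubleComplex.{u})

/-- The family of subgroups `S` is preserved by both differentials. -/
structure IsSubcomplex (S : ∀ L M, AddSubgroup (C.obj L M)) : Prop where
  dh_mem : ∀ L M, S (L + 1) M ≤ (S L M).comap (C.dh L M)
  dv_mem : ∀ L M, S L M ≤ (S L (M + 1)).comap (C.dv L M)

variable {C} in
/-- The quotient double complex `C / S` with the induced differentials. -/
def quotient {S : ∀ L M, AddSubgroup (C.obj L M)} (hS : C.IsSubcomplex S) :
    DoubleComplex.{u} where
  obj L M := C.obj L M ⧸ S L M
  dh L M := QuotientAddGroup.map _ _ (C.dh L M) (hS.dh_mem L M)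
  dv L M := QuotientAddGroup.map _ _ (C.dv L M) (hS.dv_mem L M)
  dh_dh L M a := by
    induction a using QuotientAddGroup.induction_on with
    | H a => simp [C.dh_dh]
  dv_dv L M a := by
    induction a using QuotientAddGroup.induction_on with
    | H a => simp [C.dv_dv]
  anticomm L M a := by
    induction a using QuotientAddGroup.induction_on with
    | H a =>
      simp only [QuotientAddGroup.map_mk, ← QuotientAddGroup.mk_add, C.anticomm]
      rfl

/-- The chain complex `(C_{•,M}, dh)`. -/
noncomputable def row (M : ℕ) : ChainComplex AddCommGrpCat.{u} ℕ :=
  ChainComplex.of (fun L => AddCommGrpCat.of (C.obj L M)) (fun L => AddCommGrpCat.ofHom (C.dh L M))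
    (fun L => by ext a; exact C.dh_dh L M a)

variable {C} in
/-- The projection `C_{•,M} → (C / S)_{•,M}`. -/
noncomputable def rowProj {S : ∀ L M, AddSubgroup (C.obj L M)} (hS : C.IsSubcomplex S) (M : ℕ) :
    C.row M ⟶ (quotient hS).row M :=
  ChainComplex.ofHom (X := C.row M) (Y := (quotient hS).row M)
    (fun L => AddCommGrpCat.ofHom (QuotientAddGroup.mk' (S L M)))
    (fun L => by
      simp only [row, ChainComplex.of_d]
      ext a
      rfl)

end DoubleComplex

namespace SUBijectivePair

variable {X : Type u} {Y : Type v} {Z : Type w}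
  [MetricSpace X] [CompactSpace X] [SmaleSpace X]
  [MetricSpace Y] [CompactSpace Y] [SmaleSpace Y]
  [MetricSpace Z] [CompactSpace Z] [SmaleSpace Z]
  (π : SUBijectivePair X Y Z)

/-- `Σ_{L,M}(π)`: tuples `(y_0, …, y_L, z_0, …, z_M)` with `π_s(y_l) = π_u(z_m)` for all `l`,
`m`. -/
def Sig (L M : ℕ) : Type (max v w) :=
  {p : (Fin (L + 1) → Y) × (Fin (M + 1) → Z) // ∀ l m, π.πs (p.1 l) = π.πu (p.2 m)}

theorem exists_eps : ∃ δ > 0, δ ≤ ε Y ∧ δ ≤ ε Z ∧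
    (∀ y y' : Y, dist y y' ≤ δ → π.πs (br y y') = br (π.πs y) (π.πs y')) ∧
    (∀ z z' : Z, dist z z' ≤ δ → π.πu (br z z') = br (π.πu z) (π.πu z')) := by
  obtain ⟨a, ha, ha'⟩ := exists_map_br π.πs_cont π.πs_equivariant
  obtain ⟨b, hb, hb'⟩ := exists_map_br π.πu_cont π.πu_equivariant
  refine ⟨min (min (ε Y) (ε Z)) (min a b), lt_min (lt_min ε_pos ε_pos) (lt_min ha hb),
    (min_le_left _ _).trans (min_le_left _ _), (min_le_left _ _).trans (min_le_right _ _),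
    fun y y' h => ha' y y' (h.trans ((min_le_right _ _).trans (min_le_left _ _))),
    fun z z' h => hb' z z' (h.trans ((min_le_right _ _).trans (min_le_right _ _)))⟩

/-- A scale at which brackets in `Y` and `Z` exist and are preserved by `π_s` and `π_u`. -/
noncomputable def eps : ℝ := π.exists_eps.choose

theorem eps_spec : 0 < π.eps ∧ π.eps ≤ ε Y ∧ π.eps ≤ ε Z ∧
    (∀ y y' : Y, dist y y' ≤ π.eps → π.πs (br y y') = br (π.πs y) (π.πs y')) ∧
    (∀ z z' : Z, dist z z' ≤ π.eps → π.πu (br z z') = br (π.πu z) (π.πu z')) :=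
  π.exists_eps.choose_spec

namespace Sig

variable {π} {L M : ℕ}

/-- The supremum metric. -/
noncomputable instance : MetricSpace (π.Sig L M) :=
  inferInstanceAs (MetricSpace {p : (Fin (L + 1) → Y) × (Fin (M + 1) → Z) //
    ∀ l m, π.πs (p.1 l) = π.πu (p.2 m)})

instance : CompactSpace (π.Sig L M) := by
  have h : IsClosed {p : (Fin (L + 1) → Y) × (Fin (M + 1) → Z) |
      ∀ l m, π.πs (p.1 l) = π.πu (p.2 m)} := ?_
  · exact isCompact_iff_compactSpace.1 h.isCompact
  simp only [ofPred_forall]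
  refine isClosed_iInter fun l => isClosed_iInter fun m => isClosed_eq ?_ ?_
  · exact π.πs_cont.comp ((continuous_apply l).comp continuous_fst)
  · exact π.πu_cont.comp ((continuous_apply m).comp continuous_snd)

theorem dist_le_iff {p q : π.Sig L M} {r : ℝ} (hr : 0 ≤ r) :
    dist p q ≤ r ↔ (∀ l, dist (p.1.1 l) (q.1.1 l) ≤ r) ∧ ∀ m, dist (p.1.2 m) (q.1.2 m) ≤ r := by
  change dist p.1 q.1 ≤ r ↔ _
  rw [Prod.dist_eq, max_le_iff, dist_pi_le_iff hr, dist_pi_le_iff hr]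

/-- The coordinatewise homeomorphism. -/
def shift : π.Sig L M ≃ₜ π.Sig L M where
  toFun p := ⟨(fun l => φ (p.1.1 l), fun m => φ (p.1.2 m)), fun l m => by
    rw [π.πs_equivariant, π.πu_equivariant, p.2 l m]⟩
  invFun p := ⟨(fun l => φ.symm (p.1.1 l), fun m => φ.symm (p.1.2 m)), fun l m => by
    apply (φ (X := X)).injective
    rw [← π.πs_equivariant, ← π.πu_equivariant]
    simpa using p.2 l m⟩
  left_inv p := by apply Subtype.ext; simp
  right_inv p := by apply Subtype.ext; simp
  continuous_toFun := by
    refine Continuous.subtype_mk (f := fun p : π.Sig L M => _) ?_ _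
    have h : Continuous (fun p : π.Sig L M => p.1) := continuous_subtype_val
    refine Continuous.prodMk (continuous_pi fun l => ?_) (continuous_pi fun m => ?_)
    · exact (φ (X := Y)).continuous.comp ((continuous_apply l).comp (continuous_fst.comp h))
    · exact (φ (X := Z)).continuous.comp ((continuous_apply m).comp (continuous_snd.comp h))
  continuous_invFun := by
    refine Continuous.subtype_mk (f := fun p : π.Sig L M => _) ?_ _
    have h : Continuous (fun p : π.Sig L M => p.1) := continuous_subtype_val
    refine Continuous.prodMk (continuous_pi fun l => ?_) (continuous_pi fun m => ?_)
    · exact (φ (X := Y)).symm.continuous.comp ((continuous_apply l).comp (continuous_fst.comp h))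
    · exact (φ (X := Z)).symm.continuous.comp ((continuous_apply m).comp (continuous_snd.comp h))

open Classical in
/-- The coordinatewise bracket. -/
noncomputable def bracket (p q : π.Sig L M) : π.Sig L M :=
  if h : dist p q ≤ π.eps then
    ⟨(fun l => br (p.1.1 l) (q.1.1 l), fun m => br (p.1.2 m) (q.1.2 m)), fun l m => by
      obtain ⟨h0, -, -, hs, hu⟩ := π.eps_spec
      rw [dist_le_iff h0.le] at h
      rw [hs _ _ (h.1 l), hu _ _ (h.2 m), p.2 l m, q.2 l m]⟩
  else p

theorem bracket_val {p q : π.Sig L M} (h : dist p q ≤ π.eps) :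
    (bracket p q).1 = (fun l => br (p.1.1 l) (q.1.1 l), fun m => br (p.1.2 m) (q.1.2 m)) := by
  simp [bracket, h]

/-- `Σ_{L,M}(π)` as a Smale space, with the coordinatewise structure. -/
noncomputable instance : SmaleSpace (π.Sig L M) where
  φ := shift
  ε := π.eps
  ε_pos := π.eps_spec.1
  lam := max (lam Y) (lam Z)
  lam_pos := lt_max_of_lt_left lam_pos
  lam_lt_one := max_lt lam_lt_one lam_lt_one
  br := bracket
  br_cont := by
    obtain ⟨h0, hY, hZ, -, -⟩ := π.eps_spec
    have hi : IsInducing (fun p : π.Sig L M => p.1) := IsInducing.subtypeVal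
    rw [hi.continuousOn_iff]
    have hv : Continuous (fun p : π.Sig L M => p.1) := hi.continuous
    refine ContinuousOn.congr (f := fun p : π.Sig L M × π.Sig L M =>
      ((fun l => br (p.1.1.1 l) (p.2.1.1 l), fun m => br (p.1.1.2 m) (p.2.1.2 m)) :
        (Fin (L + 1) → Y) × (Fin (M + 1) → Z))) ?_ (fun p hp => bracket_val hp)
    refine ContinuousOn.prodMk (continuousOn_pi.2 fun l => ?_) (continuousOn_pi.2 fun m => ?_)
    · refine ContinuousOn.comp (g := fun q : Y × Y => br q.1 q.2)
        (f := fun p : π.Sig L M × π.Sig L M => (p.1.1.1 l, p.2.1.1 l)) br_cont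
        (Continuous.continuousOn ?_)
        (fun p hp => (((dist_le_iff h0.le).1 hp).1 l).trans hY)
      exact ((continuous_apply l).comp (continuous_fst.comp (hv.comp continuous_fst))).prodMk
        ((continuous_apply l).comp (continuous_fst.comp (hv.comp continuous_snd)))
    · refine ContinuousOn.comp (g := fun q : Z × Z => br q.1 q.2)
        (f := fun p : π.Sig L M × π.Sig L M => (p.1.1.2 m, p.2.1.2 m)) br_cont
        (Continuous.continuousOn ?_)
        (fun p hp => (((dist_le_iff h0.le).1 hp).2 m).trans hZ)
      exact ((continuous_apply m).comp (continuous_snd.comp (hv.comp continuous_fst))).prodMk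
        ((continuous_apply m).comp (continuous_snd.comp (hv.comp continuous_snd)))
  br_self p := by
    apply Subtype.ext
    rw [bracket_val (by simpa using π.eps_spec.1.le)]
    simp [br_self]
  br_br_right p q r h1 h2 h3 := by
    obtain ⟨h0, hY, hZ, -, -⟩ := π.eps_spec
    apply Subtype.ext
    rw [bracket_val h2, bracket_val h3]
    rw [dist_le_iff h0.le] at h1 h2 h3
    simp only [bracket_val ((dist_le_iff h0.le).2 h1)] at h2 ⊢
    refine Prod.ext (funext fun l => ?_) (funext fun m => ?_)
    · exact br_br_right _ _ _ ((h1.1 l).trans hY) ((h2.1 l).trans hY) ((h3.1 l).trans hY)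
    · exact br_br_right _ _ _ ((h1.2 m).trans hZ) ((h2.2 m).trans hZ) ((h3.2 m).trans hZ)
  br_br_left p q r h1 h2 h3 := by
    obtain ⟨h0, hY, hZ, -, -⟩ := π.eps_spec
    apply Subtype.ext
    rw [bracket_val h2, bracket_val h3]
    rw [dist_le_iff h0.le] at h1 h2 h3
    simp only [bracket_val ((dist_le_iff h0.le).2 h1)] at h2 ⊢
    refine Prod.ext (funext fun l => ?_) (funext fun m => ?_)
    · exact br_br_left _ _ _ ((h1.1 l).trans hY) ((h2.1 l).trans hY) ((h3.1 l).trans hY)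
    · exact br_br_left _ _ _ ((h1.2 m).trans hZ) ((h2.2 m).trans hZ) ((h3.2 m).trans hZ)
  map_br p q h1 h2 := by
    obtain ⟨h0, hY, hZ, -, -⟩ := π.eps_spec
    apply Subtype.ext
    rw [bracket_val h2]
    change ((fun l => φ ((bracket p q).1.1 l), fun m => φ ((bracket p q).1.2 m)) :
      (Fin (L + 1) → Y) × (Fin (M + 1) → Z)) = _
    rw [bracket_val h1]
    rw [dist_le_iff h0.le] at h1 h2
    refine Prod.ext (funext fun l => ?_) (funext fun m => ?_)
    · exact map_br _ _ ((h1.1 l).trans hY) ((h2.1 l).trans hY)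
    · exact map_br _ _ ((h1.2 m).trans hZ) ((h2.2 m).trans hZ)
  contract p q h hb := by
    obtain ⟨h0, hY, hZ, -, -⟩ := π.eps_spec
    have hb' := congrArg Subtype.val hb
    rw [bracket_val h] at hb'
    have hd := (dist_le_iff (p := p) (q := q) dist_nonneg).1 le_rfl
    rw [dist_le_iff h0.le] at h
    have hp : 0 < max (lam Y) (lam Z) := lt_max_of_lt_left lam_pos
    refine (dist_le_iff (mul_nonneg hp.le dist_nonneg)).2 ⟨fun l => ?_, fun m => ?_⟩
    · exact (contract _ _ ((h.1 l).trans hY) (congrFun (congrArg Prod.fst hb') l)).trans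
        (mul_le_mul (le_max_left _ _) (hd.1 l) dist_nonneg hp.le)
    · exact (contract _ _ ((h.2 m).trans hZ) (congrFun (congrArg Prod.snd hb') m)).trans
        (mul_le_mul (le_max_right _ _) (hd.2 m) dist_nonneg hp.le)
  expand p q h hb := by
    obtain ⟨h0, hY, hZ, -, -⟩ := π.eps_spec
    have hb' := congrArg Subtype.val hb
    rw [bracket_val h] at hb'
    have hd := (dist_le_iff (p := p) (q := q) dist_nonneg).1 le_rfl
    rw [dist_le_iff h0.le] at h
    have hp : 0 < max (lam Y) (lam Z) := lt_max_of_lt_left lam_pos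
    refine (dist_le_iff (mul_nonneg hp.le dist_nonneg)).2 ⟨fun l => ?_, fun m => ?_⟩
    · exact (expand _ _ ((h.1 l).trans hY) (congrFun (congrArg Prod.fst hb') l)).trans
        (mul_le_mul (le_max_left _ _) (hd.1 l) dist_nonneg hp.le)
    · exact (expand _ _ ((h.2 m).trans hZ) (congrFun (congrArg Prod.snd hb') m)).trans
        (mul_le_mul (le_max_right _ _) (hd.2 m) dist_nonneg hp.le)

/-- `δ_l`: delete the entry `y_l`. -/
def face (l : Fin (L + 2)) (p : π.Sig (L + 1) M) : π.Sig L M :=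
  ⟨(fun i => p.1.1 (l.succAbove i), p.1.2), fun _ m => p.2 _ m⟩

/-- `δ_{,m}`: delete the entry `z_m`. -/
def coface (m : Fin (M + 2)) (p : π.Sig L (M + 1)) : π.Sig L M :=
  ⟨(p.1.1, fun i => p.1.2 (m.succAbove i)), fun l _ => p.2 l _⟩

/-- `(y_0, …, y_L, z) ↦ (y_0, …, y_{k-1}, y_l, y_k, …, y_L, z)`: insert a copy of `y_l` at
position `k`. For `k = l + j` with `j ≥ 1` this is `σ_j s_l`. -/
def degen (l : Fin (L + 1)) (k : Fin (L + 2)) (p : π.Sig L M) : π.Sig (L + 1) M :=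
  ⟨(k.insertNth (p.1.1 l) p.1.1, p.1.2), fun i m => by
    refine Fin.succAboveCases k ?_ (fun j => ?_) i
    · simpa using p.2 l m
    · simpa using p.2 j m⟩

/-- The action of the symmetric group `S_{L+1}` on the entries `y_0, …, y_L`. -/
def perm (α : Equiv.Perm (Fin (L + 1))) (p : π.Sig L M) : π.Sig L M :=
  ⟨(fun i => p.1.1 (α.symm i), p.1.2), fun _ m => p.2 _ m⟩

end Sig

/-! ### The complexes -/

/-- All maps used below do induce maps of dimension groups: `δ_l`, `σ_j s_l` and the permutations
covariantly, by `[E] ↦ [f(E)]`, and `δ_{,m}` contravariantly, by `[F] ↦ [f⁻¹(F)]`. -/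
structure HasInducedMaps : Prop where
  face : ∀ L M (l : Fin (L + 2)),
    IsPushforward (Sig.face l) (pushforward (Sig.face l : π.Sig (L + 1) M → π.Sig L M))
  coface : ∀ L M (m : Fin (M + 2)),
    IsPullback (Sig.coface m) (pullback (Sig.coface m : π.Sig L (M + 1) → π.Sig L M))
  degen : ∀ L M (l : Fin (L + 1)) (k : Fin (L + 2)), l.castSucc < k →
    IsPushforward (Sig.degen l k) (pushforward (Sig.degen l k : π.Sig L M → π.Sig (L + 1) M))
  perm : ∀ L M (α : Equiv.Perm (Fin (L + 1))),
    IsPushforward (Sig.perm α) (pushforward (Sig.perm α : π.Sig L M → π.Sig L M))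

/-- `∂^s = ∑_l (-1)^l δ_l^s`. -/
noncomputable def bdry (L M : ℕ) : D (π.Sig (L + 1) M) →+ D (π.Sig L M) :=
  ∑ l : Fin (L + 2), ((-1 : ℤ) ^ (l : ℕ)) • pushforward (Sig.face l)

/-- `∂^{s*} = ∑_m (-1)^(L+m) δ_{,m}^{s*}`. -/
noncomputable def cobdry (L M : ℕ) : D (π.Sig L M) →+ D (π.Sig L (M + 1)) :=
  ∑ m : Fin (M + 2), ((-1 : ℤ) ^ (L + (m : ℕ))) • pullback (Sig.coface m)

/-- The maps `∂^s`, `∂^{s*}` square to zero and anticommute. -/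
structure IsDoubleComplex : Prop where
  bdry_bdry : ∀ L M a, π.bdry L M (π.bdry (L + 1) M a) = 0
  cobdry_cobdry : ∀ L M a, π.cobdry L (M + 1) (π.cobdry L M a) = 0
  anticomm : ∀ L M a, π.bdry L (M + 1) (π.cobdry (L + 1) M a) + π.cobdry L M (π.bdry L M a) = 0

variable {π} in
/-- The double complex `C^s(π)`, with `C_{L,M} = D^s(Σ_{L,M}(π))`. -/
noncomputable def complex (h : π.IsDoubleComplex) : DoubleComplex.{max v w} where
  obj L M := D (π.Sig L M)
  dh := π.bdry
  dv := π.cobdry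
  dh_dh := h.bdry_bdry
  dv_dv := h.cobdry_cobdry
  anticomm := h.anticomm

/-- `D^s_B(Σ_{L,M}(π))`. -/
noncomputable def DB (L M : ℕ) : AddSubgroup (D (π.Sig L M)) :=
  AddSubgroup.closure
    ({a | ∃ i j : Fin (L + 1), i ≠ j ∧ pushforward (Sig.perm (Equiv.swap i j)) a = a} ∪
     {b | ∃ (a : D (π.Sig L M)) (α : Equiv.Perm (Fin (L + 1))),
       b = a - (Equiv.Perm.sign α : ℤ) • pushforward (Sig.perm α) a})

/-- The sum of the images of all degeneracy maps `(σ_j s_l)^s`. -/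
noncomputable def DCtilde : ∀ L M : ℕ, AddSubgroup (D (π.Sig L M))
  | 0, _ => ⊥
  | L + 1, M => ⨆ (l : Fin (L + 1)) (k : Fin (L + 2)) (_ : l.castSucc < k),
      (pushforward (Sig.degen l k : π.Sig L M → π.Sig (L + 1) M)).range

/-- The degenerate chains `DC_{L,M}`. -/
noncomputable def DC (L M : ℕ) : AddSubgroup (D (π.Sig L M)) :=
  π.DCtilde L M ⊔ AddSubgroup.closure
    {b | ∃ (a : D (π.Sig L M)) (α : Equiv.Perm (Fin (L + 1))),
      b = pushforward (Sig.perm α) a - (Equiv.Perm.sign α : ℤ) • a}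

end SUBijectivePair

/-! For fixed `M` the groups D^s(Σ_{L,M}) form a contravariant functor on all maps θ : {0,…,K} →
{0,…,L}, acting by reindexing the entries y_l (`dRow`). Let `deg` be generated by the images of the
non-injective θ and by the elements αa − sgn(α)a. A non-injective map factors through the insertion
of a repeated entry, so DC = `deg`. Such an image is also fixed by a transposition, so `deg` ⊆ DB.
Two claims are not formal: an element fixed by a transposition lies in `deg`
(`SUBijectivePair.mem_deg_of_swap`), and a cycle in `deg` bounds inside `deg`
(`SUBijectivePair.exists_bdry_eq`). The first gives DB = DC. The second, together with `deg` = 0 in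
degree 0, makes the rows of `deg` acyclic, so that passing to the quotient is a quasi-isomorphism.

Both claims have classical models for ordered chains of a simplex with a finite, linearly ordered
vertex set. Sorting tuples with signs (and sending tuples with a repetition to 0) is a chain map,
homotopic to the identity by a homotopy that uses only the vertices of the given tuple. Sorting
kills degenerate chains, so there the homotopy contracts. For a chain fixed by the transposition of
i and j, the parts with c i < c j and c i > c j are exchanged, and the part with c i = c j is
degenerate. No division by 2 is needed.

Geometry reduces the theorem to this model. Because the stable sets of Z and the unstable sets of Y
are totally disconnected, Σ_{0,M} has a finite partition into small clopen sets, its colours; a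
point of Σ_{L,M} then has L + 1 colours. As π_s is s-bijective, a point of a given stable set of
Σ_{L,M} is determined by its entries in Z. Consequently, on a small piece of a stable set where y_i
and y_j have the same colour, reindexing through i or through j gives two sets that correspond under
the bracket and have the same class. Vertices of equal colour are thus interchangeable
(`SymAb.Colored`), and operators on ordered chains of colours act on the groups
(`SymAb.Colored.op`).

The relation defining the dimension group may identify sets of different colours, so the colour
decomposition lives instead on `Coloring.Grp`, where only additivity and colour-preserving holonomy
are imposed. The dimension group is recovered asymptotically: φ^{-n} contracts unstable directions,
so sets related by a bracket are, for large n, matched up point by point with equal colours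
(`Coloring.exists_sum_cls_eq`). Hence a formal sum that vanishes in the dimension group vanishes in
`Grp` after applying φ^{-n} (`Coloring.exists_approx_eq_zero`). An equation in the dimension group
is lifted to formal sums, made exact in `Grp` by φ^{-n}, solved there, and carried back by φ^n
(`Coloring.realize`). The same contraction shows that the pullbacks along δ_{,m} are well defined.
-/

namespace SmaleSpace

/-! ### The stable topology, compact open sets and additive functions -/

section Basic

variable {X : Type u} [MetricSpace X] [CompactSpace X] [SmaleSpace X]

variable (X) in
/-- The Smale space with inverse dynamics; it exchanges stable and unstable sets. -/
@[reducible] def dual : SmaleSpace X where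
  φ := (φ (X := X)).symm
  ε := ε X
  ε_pos := ε_pos
  lam := lam X
  lam_pos := lam_pos
  lam_lt_one := lam_lt_one
  br x y := br y x
  br_cont := by
    refine ContinuousOn.comp (g := fun p : X × X => br p.1 p.2) (f := Prod.swap) br_cont
      continuous_swap.continuousOn fun p hp => ?_
    simpa [dist_comm] using hp
  br_self := br_self
  br_br_right x y z h1 h2 h3 := by
    rw [dist_comm] at h1 h2 h3
    exact br_br_left z y x h1 h2 h3
  br_br_left x y z h1 h2 h3 := by
    rw [dist_comm] at h1 h2 h3
    exact br_br_right z y x h1 h2 h3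
  map_br x y h1 h2 := by
    apply (φ (X := X)).injective
    rw [map_br]
    · simp
    · rwa [dist_comm]
    · simpa [dist_comm] using h1
  contract x y h1 h2 := by
    have := expand y x (by rwa [dist_comm]) h2
    rwa [dist_comm, dist_comm x y]
  expand x y h1 h2 := by
    have := contract y x (by rwa [dist_comm]) h2
    rw [dist_comm, dist_comm x y]
    exact this

theorem mem_stableSet_self (x : X) : x ∈ stableSet x := by
  simp [stableSet]

theorem mem_stableSet_symm {x y : X} (h : y ∈ stableSet x) : x ∈ stableSet y := by
  simpa only [stableSet, mem_ofPred_eq, dist_comm] using h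

theorem mem_stableSet_trans {x y z : X} (h : y ∈ stableSet x) (h' : z ∈ stableSet y) :
    z ∈ stableSet x := by
  have h2 := Tendsto.add (f := fun n : ℕ => dist ((φ (X := X))^[n] x) ((φ (X := X))^[n] y)) h h'
  rw [add_zero] at h2
  exact squeeze_zero (fun _ => dist_nonneg) (fun _ => dist_triangle _ _ _) h2

theorem stableSet_eq {x y : X} (h : y ∈ stableSet x) : stableSet y = stableSet x :=
  Set.ext fun _ => ⟨mem_stableSet_trans h, mem_stableSet_trans (mem_stableSet_symm h)⟩

theorem mem_unstableSet_symm {x y : X} (h : y ∈ unstableSet x) : x ∈ unstableSet y :=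
  @mem_stableSet_symm X _ _ (dual X) _ _ h

theorem mem_unstableSet_self (x : X) : x ∈ unstableSet x :=
  @mem_stableSet_self X _ _ (dual X) x

theorem mem_unstableSet_trans {x y z : X} (h : y ∈ unstableSet x) (h' : z ∈ unstableSet y) :
    z ∈ unstableSet x :=
  @mem_stableSet_trans X _ _ (dual X) _ _ _ h h'

theorem mem_stableSet_of_br {x y : X} (hd : dist x y ≤ ε X) (hb : br x y = y) :
    y ∈ stableSet x := by
  have hlim : Tendsto (fun n : ℕ => lam X ^ n * dist x y) atTop (𝓝 0) := by
    simpa using (tendsto_pow_atTop_nhds_zero_of_lt_one (lam_pos (X := X)).le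
      lam_lt_one).mul_const (dist x y)
  exact squeeze_zero (fun _ => dist_nonneg) (fun n => (forward_close hd hb n).1) hlim

theorem mem_unstableSet_of_br {x y : X} (hd : dist x y ≤ ε X) (hb : br y x = y) :
    y ∈ unstableSet x :=
  @mem_stableSet_of_br X _ _ (dual X) _ _ hd hb

/-- The two one-sided conditions for local stable equivalence agree: if [y,x] = x, then [x,y] =
[[y,x],y] = [y,y] = y. -/
theorem br_eq_of_br_left {x y : X} (hd : dist x y ≤ ε X) (hb : br y x = x) : br x y = y := by
  have := br_br_left y x y (by rwa [dist_comm]) (by rwa [hb]) (by simp [(ε_pos (X := X)).le])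
  rwa [hb, br_self] at this

theorem br_eq_of_br_right {x y : X} (hd : dist x y ≤ ε X) (hb : br x y = x) : br y x = y :=
  @br_eq_of_br_left X _ _ (dual X) _ _ hd hb

theorem br_stable_trans {x y z : X} (hxy : dist x y ≤ ε X) (hyz : dist y z ≤ ε X)
    (hxz : dist x z ≤ ε X) (h : br x y = y) (h' : br y z = z) : br x z = z := by
  have := br_br_left x y z hxy (by rwa [h]) hxz
  rw [h] at this
  rw [← this, h']

theorem mem_localStable_self (x : X) {δ : ℝ} (hδ : 0 < δ) : x ∈ localStable x δ :=
  ⟨by simpa using hδ, br_self x⟩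

theorem localStable_mono (x : X) {δ δ' : ℝ} (h : δ ≤ δ') : localStable x δ ⊆ localStable x δ' :=
  fun _ hy => ⟨hy.1.trans_le h, hy.2⟩

theorem localStable_subset_stableSet (x : X) {δ : ℝ} (h : δ ≤ ε X) :
    localStable x δ ⊆ stableSet x := fun _ hy =>
  mem_stableSet_of_br (hy.1.le.trans h) (br_eq_of_br_left (hy.1.le.trans h) hy.2)

theorem exists_localStable_subset {x y : X} {δ : ℝ} (hδ : δ ≤ ε X) (hy : y ∈ localStable x δ) :
    ∃ δ' > 0, δ' ≤ ε X ∧ localStable y δ' ⊆ localStable x δ := by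
  refine ⟨min (ε X) (δ - dist x y), lt_min ε_pos (by linarith [hy.1]), min_le_left _ _,
    fun z hz => ?_⟩
  have h1 : dist x z < δ := by
    have := dist_triangle x y z
    have := hz.1.trans_le (min_le_right _ _)
    linarith
  refine ⟨h1, ?_⟩
  refine br_stable_trans (y := y) ?_ ?_ ?_ hz.2 hy.2
  · rw [dist_comm]; exact hz.1.le.trans (min_le_left _ _)
  · rw [dist_comm]; exact hy.1.le.trans hδ
  · rw [dist_comm]; exact h1.le.trans hδ

/-- A local stable set contains a smaller one around each of its points, by transitivity of local
stable equivalence, so the generating sets form a basis. -/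
theorem isOpen_stable_iff {U : Set X} :
    IsOpen[stableTopology X] U ↔ ∀ x ∈ U, ∃ δ > 0, δ ≤ ε X ∧ localStable x δ ⊆ U := by
  constructor
  · intro h
    induction h with
    | basic s hs =>
      obtain ⟨x, δ, -, hδ, rfl⟩ := hs
      exact fun y hy => exists_localStable_subset hδ hy
    | univ => exact fun x _ => ⟨ε X, ε_pos, le_rfl, subset_univ _⟩
    | inter s t _ _ hs ht =>
      intro x hx
      obtain ⟨a, ha, ha', has⟩ := hs x hx.1
      obtain ⟨b, hb, hb', hbt⟩ := ht x hx.2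
      exact ⟨min a b, lt_min ha hb, (min_le_left _ _).trans ha', subset_inter
        ((localStable_mono x (min_le_left _ _)).trans has)
        ((localStable_mono x (min_le_right _ _)).trans hbt)⟩
    | sUnion S _ ih =>
      rintro x ⟨s, hs, hx⟩
      obtain ⟨a, ha, ha', has⟩ := ih s hs x hx
      exact ⟨a, ha, ha', has.trans (subset_sUnion_of_mem hs)⟩
  · intro h
    choose δ h1 h2 h3 using h
    have : U = ⋃ (x : X) (hx : x ∈ U), localStable x (δ x hx) :=
      Subset.antisymm (fun x hx => mem_iUnion₂.2 ⟨x, hx, mem_localStable_self x (h1 x hx)⟩)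
        (iUnion₂_subset h3)
    rw [this]
    exact @isOpen_iUnion X _ (stableTopology X) _ fun x =>
      @isOpen_iUnion X _ (stableTopology X) _ fun hx =>
        TopologicalSpace.isOpen_generateFrom_of_mem ⟨x, _, h1 x hx, h2 x hx, rfl⟩

theorem isOpen_localStable (x : X) {δ : ℝ} (hδ : 0 < δ) (h : δ ≤ ε X) :
    IsOpen[stableTopology X] (localStable x δ) :=
  TopologicalSpace.isOpen_generateFrom_of_mem ⟨x, _, hδ, h, rfl⟩

theorem isOpen_stable_of_isOpen {U : Set X} (hU : IsOpen U) : IsOpen[stableTopology X] U := by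
  rw [isOpen_stable_iff]
  intro x hx
  obtain ⟨r, hr, hU⟩ := Metric.isOpen_iff.1 hU x hx
  refine ⟨min r (ε X), lt_min hr ε_pos, min_le_right _ _, fun y hy => hU ?_⟩
  rw [Metric.mem_ball, dist_comm]
  exact hy.1.trans_le (min_le_left _ _)

variable (X) in
theorem stableTopology_le : stableTopology X ≤ (inferInstance : TopologicalSpace X) :=
  fun _ hU => isOpen_stable_of_isOpen hU

variable (X) in
theorem t2Space_stable : @T2Space X (stableTopology X) :=
  t2Space_antitone (stableTopology_le X) inferInstance

theorem isOpen_stable_stableSet (x : X) : IsOpen[stableTopology X] (stableSet x) := by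
  rw [isOpen_stable_iff]
  intro y hy
  exact ⟨ε X, ε_pos, le_rfl,
    (localStable_subset_stableSet y le_rfl).trans (stableSet_eq hy).le⟩

/-- Compact open for the stable topology. -/
def COpen (A : Set X) : Prop :=
  IsOpen[stableTopology X] A ∧ @IsCompact X (stableTopology X) A

theorem CO.cOpen (E : CO X) : COpen E.carrier := ⟨E.isOpen, E.isCompact⟩

theorem COpen.inter_of_clopen {A U : Set X} (hA : COpen A) (hU : IsOpen[stableTopology X] U)
    (hU' : IsOpen[stableTopology X] Uᶜ) : COpen (A ∩ U) :=
  ⟨@IsOpen.inter X (stableTopology X) _ _ hA.1 hU,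
    @IsCompact.inter_right X (stableTopology X) _ _ hA.2 (by
      let := stableTopology X
      exact ⟨hU'⟩)⟩

theorem COpen.isClosed {A : Set X} (hA : COpen A) : IsOpen[stableTopology X] Aᶜ := by
  let := stableTopology X
  have := t2Space_stable X
  exact hA.2.isClosed.isOpen_compl

/-- The complement is a union of other stable sets, each of them open. Stable sets are therefore
clopen, which allows a compact open set to be cut along them. -/
theorem isOpen_stable_compl_stableSet (x : X) : IsOpen[stableTopology X] (stableSet x)ᶜ := by
  rw [isOpen_stable_iff]
  intro y hy
  refine ⟨ε X, ε_pos, le_rfl, fun z hz hzx => hy ?_⟩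
  exact mem_stableSet_trans hzx (mem_stableSet_symm (localStable_subset_stableSet y le_rfl hz))

/-- A compact open subset of a stable set. -/
@[simps]
def COpen.toCO {A : Set X} (hA : COpen A) {e : X} (h : A ⊆ stableSet e) : CO X :=
  ⟨A, ⟨e, h⟩, hA.1, hA.2⟩

namespace CO

/-- The part of `E` in a set which is clopen for the stable topology. -/
@[simps]
def restrict (E : CO X) (U : Set X) (hU : IsOpen[stableTopology X] U)
    (hU' : IsOpen[stableTopology X] Uᶜ) : CO X where
  carrier := E.carrier ∩ U
  exists_subset := E.exists_subset.imp fun _ h => inter_subset_left.trans h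
  isOpen := (E.cOpen.inter_of_clopen hU hU').1
  isCompact := (E.cOpen.inter_of_clopen hU hU').2

/-- Additive functions on `CO^s(X)`. -/
def IsAdditive {A : Type*} [AddCommGroup A] (χ : CO X → A) : Prop :=
  ∀ E F G : CO X, G.carrier = E.carrier ∪ F.carrier → Disjoint E.carrier F.carrier →
    χ G = χ E + χ F

/-- An indexed version of `IsCOPartition`. -/
def IsPart {ι : Type*} (s : Finset ι) (G : ι → CO X) (A : Set X) : Prop :=
  (s : Set ι).PairwiseDisjoint (fun i => (G i).carrier) ∧ ⋃ i ∈ s, (G i).carrier = A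

variable {A : Type*} [AddCommGroup A] {χ : CO X → A}

theorem IsAdditive.empty (hχ : IsAdditive χ) {E : CO X} (hE : E.carrier = ∅) : χ E = 0 := by
  have := hχ E E E (by simp) (by simp [hE])
  simpa using this

theorem IsAdditive.sum_eq (hχ : IsAdditive χ) {ι : Type*} {s : Finset ι} {G : ι → CO X}
    {E : CO X} (h : IsPart s G E.carrier) : ∑ i ∈ s, χ (G i) = χ E := by
  classical
  induction s using Finset.induction_on generalizing E with
  | empty =>
    rw [hχ.empty (E := E)]
    · simp
    · rw [← h.2]; simp
  | insert i s hi ih =>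
    rw [Finset.sum_insert hi]
    have hsub : (G i).carrier ⊆ E.carrier := by
      rw [← h.2]
      exact subset_biUnion_of_mem (u := fun j => (G j).carrier) (Finset.mem_insert_self i s)
    have hdisj : ∀ j ∈ s, Disjoint (G i).carrier (G j).carrier := fun j hj =>
      h.1 (by simp) (by simp [hj]) (fun e => hi (e ▸ hj))
    rw [ih (E := E.restrict (G i).carrierᶜ (G i).cOpen.isClosed
      (by rw [compl_compl]; exact (G i).isOpen)), hχ (G i) (E.restrict _ _ _) E]
    · rw [restrict_carrier, union_inter_distrib_left, union_compl_self, inter_univ,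
        union_eq_right.2 hsub]
    · simp only [restrict_carrier]
      exact disjoint_compl_right.mono_right inter_subset_right
    · refine ⟨h.1.subset (by simp), ?_⟩
      rw [restrict_carrier, ← h.2, Finset.set_biUnion_insert, union_inter_distrib_right,
        inter_compl_self, empty_union]
      symm
      rw [inter_eq_left]
      exact iUnion₂_subset fun j hj => (hdisj j hj).symm.subset_compl_right

theorem IsPart.inter {ι : Type*} {s : Finset ι} {G : ι → CO X} {S : Set X} (h : IsPart s G S)
    {E : CO X} (hE : E.carrier ⊆ S) :
    IsPart s (fun i => E.restrict (G i).carrier (G i).isOpen (G i).cOpen.isClosed) E.carrier := by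
  refine ⟨fun i hi j hj hij => (h.1 hi hj hij).mono inter_subset_right inter_subset_right, ?_⟩
  simp only [restrict_carrier]
  rw [← inter_iUnion₂, h.2, inter_eq_left.2 hE]

theorem IsPart.subset {ι : Type*} {s : Finset ι} {G : ι → CO X} {S : Set X} (h : IsPart s G S)
    {i : ι} (hi : i ∈ s) : (G i).carrier ⊆ S := by
  rw [← h.2]; exact subset_biUnion_of_mem (u := fun j => (G j).carrier) hi

/-- Both sums are compared with the sum over the common refinement of the two partitions. The union
`S` may meet several stable sets, so it need not have a class itself. -/
theorem IsAdditive.sum_eq_sum (hχ : IsAdditive χ) {ι κ : Type*} {s : Finset ι} {t : Finset κ}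
    {G : ι → CO X} {H : κ → CO X} {S : Set X} (h : IsPart s G S) (h' : IsPart t H S) :
    ∑ i ∈ s, χ (G i) = ∑ j ∈ t, χ (H j) := by
  have h1 : ∀ i ∈ s, χ (G i) = ∑ j ∈ t,
      χ ((G i).restrict (H j).carrier (H j).isOpen (H j).cOpen.isClosed) := fun i hi =>
    (hχ.sum_eq (h'.inter (h.subset hi))).symm
  have h2 : ∀ j ∈ t, χ (H j) = ∑ i ∈ s,
      χ ((H j).restrict (G i).carrier (G i).isOpen (G i).cOpen.isClosed) := fun j hj =>
    (hχ.sum_eq (h.inter (h'.subset hj))).symm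
  rw [Finset.sum_congr rfl h1, Finset.sum_congr rfl h2, Finset.sum_comm]
  refine Finset.sum_congr rfl fun j _ => Finset.sum_congr rfl fun i _ => ?_
  congr 1
  ext1
  exact inter_comm _ _

theorem isPart_iff {s : Finset (CO X)} {S : Set X} :
    IsPart s id S ↔ IsCOPartition s S := Iff.rfl

theorem IsPart.disjSum {ι κ : Type*} {s : Finset ι} {t : Finset κ} {G : ι → CO X} {H : κ → CO X}
    {S T : Set X} (h : IsPart s G S) (h' : IsPart t H T) (hST : Disjoint S T) :
    IsPart (s.disjSum t) (Sum.elim G H) (S ∪ T) := by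
  constructor
  · rintro (i | i) hi (j | j) hj hij
    · exact h.1 (by simpa using hi) (by simpa using hj) (by simpa using hij)
    · exact hST.mono (h.subset (by simpa using hi)) (h'.subset (by simpa using hj))
    · exact hST.symm.mono (h'.subset (by simpa using hi)) (h.subset (by simpa using hj))
    · exact h'.1 (by simpa using hi) (by simpa using hj) (by simpa using hij)
  · rw [← h.2, ← h'.2]
    ext x
    simp [Finset.mem_disjSum, Sum.exists, or_and_right]

theorem IsPart.sigma {ι : Type*} {κ : ι → Type*} {s : Finset ι} {t : ∀ i, Finset (κ i)}
    {T : ι → Set X} {S : Set X} {H : ∀ i, κ i → CO X}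
    (h1 : (s : Set ι).PairwiseDisjoint T) (h2 : ⋃ i ∈ s, T i = S)
    (h : ∀ i ∈ s, IsPart (t i) (H i) (T i)) :
    IsPart (s.sigma t) (fun p => H p.1 p.2) S := by
  constructor
  · rintro ⟨i, a⟩ hi ⟨j, b⟩ hj hij
    simp only [Finset.coe_sigma, mem_sigma_iff, SetLike.mem_coe] at hi hj
    by_cases e : i = j
    · subst e
      exact (h i hi.1).1 hi.2 hj.2 (fun e => hij (by rw [e]))
    · exact (h1 hi.1 hj.1 e).mono ((h i hi.1).subset hi.2) ((h j hj.1).subset hj.2)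
  · rw [← h2]
    ext x
    simp only [mem_iUnion, Finset.mem_sigma, exists_prop, Sigma.exists]
    constructor
    · rintro ⟨i, a, ⟨hi, ha⟩, hx⟩
      exact ⟨i, hi, (h i hi).subset ha hx⟩
    · rintro ⟨i, hi, hx⟩
      rw [← (h i hi).2] at hx
      simp only [mem_iUnion, exists_prop] at hx
      obtain ⟨a, ha, hx⟩ := hx
      exact ⟨i, a, ⟨hi, ha⟩, hx⟩

end CO

/-- The global stable sets are open and partition the space, so by compactness `A` meets only
finitely many of them. -/
theorem COpen.exists_partition {A : Set X} (hA : COpen A) :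
    ∃ s : Finset (CO X), IsCOPartition s A := by
  classical
  obtain ⟨t, ht⟩ := @IsCompact.elim_nhds_subcover X (stableTopology X) _ hA.2
    (fun x => stableSet x) (fun x _ => @IsOpen.mem_nhds X (stableTopology X) _ _
      (isOpen_stable_stableSet x) (mem_stableSet_self x))
  -- Points of `t` in the same stable set give the same piece, and taking the image as a finite set
  -- removes these repetitions.
  refine ⟨t.image fun x => (hA.inter_of_clopen (isOpen_stable_stableSet x)
    (isOpen_stable_compl_stableSet x)).toCO inter_subset_right, ?_, ?_⟩
  · intro E hE F hF hEF
    simp only [Finset.coe_image, mem_image] at hE hF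
    obtain ⟨x, hx, rfl⟩ := hE
    obtain ⟨y, hy, rfl⟩ := hF
    rw [Function.onFun, COpen.toCO_carrier, COpen.toCO_carrier, Set.disjoint_left]
    rintro z ⟨hz, hzx⟩ ⟨-, hzy⟩
    refine hEF ?_
    ext1
    simp only [COpen.toCO_carrier]
    rw [← stableSet_eq hzx, ← stableSet_eq hzy]
  · ext x
    simp only [Finset.mem_image, iUnion_exists, biUnion_and', iUnion_iUnion_eq_right,
      COpen.toCO_carrier, mem_iUnion, mem_inter_iff, exists_prop]
    constructor
    · rintro ⟨_, _, h, _⟩; exact h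
    · intro h
      obtain ⟨y, hy, hxy⟩ := mem_iUnion₂.1 (ht.2 h)
      exact ⟨y, hy, h, hxy⟩

theorem D.cls_additive : CO.IsAdditive (D.cls (X := X)) := by
  intro E F G h1 h2
  rw [← sub_eq_zero, ← sub_sub]
  exact (QuotientAddGroup.eq_zero_iff _).2 (AddSubgroup.subset_closure ⟨E, F, G, h1, h2, rfl⟩)

theorem D.cls_rel {E F : CO X} (h : CO.Rel E F) : D.cls E = D.cls F := by
  have : (Quotient.mk (CO.setoid X) E) = Quotient.mk (CO.setoid X) F := Quotient.sound h
  simp only [D.cls, this]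

/-- The universal property of the dimension group. -/
noncomputable def D.lift {A : Type*} [AddCommGroup A] (χ : CO X → A) (hχ : CO.IsAdditive χ)
    (hr : ∀ E F, CO.Rel E F → χ E = χ F) : D X →+ A :=
  QuotientAddGroup.lift _ (FreeAbelianGroup.lift (Quotient.lift χ hr)) (by
    rw [DRelations, AddSubgroup.closure_le]
    rintro _ ⟨E, F, G, h1, h2, rfl⟩
    change (FreeAbelianGroup.lift _) _ = 0
    rw [map_sub, map_sub]
    simp only [FreeAbelianGroup.lift_apply_of]
    change χ G - χ E - χ F = 0
    rw [hχ E F G h1 h2]; abel)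

@[simp]
theorem D.lift_cls {A : Type*} [AddCommGroup A] (χ : CO X → A) (hχ : CO.IsAdditive χ)
    (hr : ∀ E F, CO.Rel E F → χ E = χ F) (E : CO X) : D.lift χ hχ hr (D.cls E) = χ E := by
  exact FreeAbelianGroup.lift_apply_of _ _

end Basic

end SmaleSpace

namespace SmaleSpace

/-! ### Equivariant, s-bijective and u-bijective maps in the stable topology -/

section Maps

variable {X : Type u} [MetricSpace X] [CompactSpace X] [SmaleSpace X]
variable {Y : Type v} [MetricSpace Y] [CompactSpace Y] [SmaleSpace Y]

theorem continuousAt_br (x : X) : ContinuousAt (fun p : X × X => br p.1 p.2) (x, x) := by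
  refine br_cont.continuousAt (mem_of_superset ((isOpen_lt (f := fun p : X × X => dist p.1 p.2)
    (g := fun _ => ε X) (by fun_prop) continuous_const).mem_nhds ?_) fun p hp =>
    le_of_lt (show dist p.1 p.2 < ε X from hp))
  simpa using ε_pos

theorem tendsto_br {ι : Type*} {l : Filter ι} {a b : ι → X} {x : X} (ha : Tendsto a l (𝓝 x))
    (hb : Tendsto b l (𝓝 x)) : Tendsto (fun i => br (a i) (b i)) l (𝓝 x) := by
  have h := (continuousAt_br x).tendsto
  simp only [br_self] at h
  exact h.comp (ha.prodMk_nhds hb)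

theorem br_br_self_left {x y : X} (h : dist x y ≤ ε X) (h' : dist x (br x y) ≤ ε X) :
    br x (br x y) = br x y := br_br_right x x y h h' h

theorem br_mem_stableSet {x y : X} (h : dist x y ≤ ε X) (h' : dist x (br x y) ≤ ε X) :
    br x y ∈ stableSet x := mem_stableSet_of_br h' (br_br_self_left h h')

theorem br_mem_unstableSet {x y : X} (h : dist x y ≤ ε X) (h' : dist y (br x y) ≤ ε X) :
    br x y ∈ unstableSet y :=
  @br_mem_stableSet X _ _ (dual X) y x (by rwa [dist_comm]) h'

variable {f : X → Y}

theorem map_iterate (he : ∀ x, f (φ x) = φ (f x)) (n : ℕ) (x : X) :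
    f ((φ (X := X))^[n] x) = (φ (X := Y))^[n] (f x) :=
  Function.Semiconj.iterate_right (f := f) he n x

theorem map_symm (he : ∀ x, f (φ x) = φ (f x)) (x : X) :
    f ((φ (X := X)).symm x) = (φ (X := Y)).symm (f x) := by
  apply (φ (X := Y)).injective
  rw [← he]; simp

theorem map_symm_iterate (he : ∀ x, f (φ x) = φ (f x)) (n : ℕ) (x : X) :
    f ((φ (X := X)).symm^[n] x) = (φ (X := Y)).symm^[n] (f x) :=
  Function.Semiconj.iterate_right (f := f) (map_symm he) n x

theorem map_mem_stableSet (hc : Continuous f) (he : ∀ x, f (φ x) = φ (f x)) {x y : X}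
    (h : y ∈ stableSet x) : f y ∈ stableSet (f x) := by
  have hu := CompactSpace.uniformContinuous_of_continuous hc
  rw [Metric.uniformContinuous_iff] at hu
  have h' : Tendsto _ _ _ := h
  rw [Metric.tendsto_atTop] at h'
  change Tendsto _ _ _
  rw [Metric.tendsto_atTop]
  intro r hr
  obtain ⟨δ, hδ, hu⟩ := hu r hr
  obtain ⟨N, hN⟩ := h' δ hδ
  refine ⟨N, fun n hn => ?_⟩
  have := hN n hn
  rw [Real.dist_0_eq_abs, abs_of_nonneg dist_nonneg] at this ⊢
  rw [← map_iterate he, ← map_iterate he]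
  exact hu this

theorem map_mem_unstableSet (hc : Continuous f) (he : ∀ x, f (φ x) = φ (f x)) {x y : X}
    (h : y ∈ unstableSet x) : f y ∈ unstableSet (f x) :=
  @map_mem_stableSet X _ _ (dual X) Y _ _ (dual Y) f hc (map_symm he) x y h

theorem continuous_stable (hc : Continuous f) (he : ∀ x, f (φ x) = φ (f x)) :
    @Continuous X Y (stableTopology X) (stableTopology Y) f := by
  refine @Continuous.mk X Y (stableTopology X) (stableTopology Y) f fun U hU => ?_
  rw [isOpen_stable_iff] at hU ⊢
  intro x hx
  obtain ⟨δ, hδ, -, hU⟩ := hU (f x) hx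
  obtain ⟨δ₁, hδ₁, hbr⟩ := exists_map_br hc he
  obtain ⟨δ₂, hδ₂, hf⟩ := Metric.continuousAt_iff.1 (hc.continuousAt (x := x)) δ hδ
  refine ⟨min (min δ₁ δ₂) (ε X), lt_min (lt_min hδ₁ hδ₂) ε_pos, min_le_right _ _,
    fun y hy => hU ⟨?_, ?_⟩⟩
  · rw [dist_comm]
    apply hf
    rw [dist_comm]
    exact hy.1.trans_le ((min_le_left _ _).trans (min_le_right _ _))
  · rw [← hbr, hy.2]
    rw [dist_comm]
    exact hy.1.le.trans ((min_le_left _ _).trans (min_le_left _ _))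

/-- Nearby stably equivalent points lift to nearby points along an `s`-bijective map. -/
theorem SBijective.exists_lift_close (hs : SBijective f) (hc : Continuous f)
    (he : ∀ x, f (φ x) = φ (f x)) {δ : ℝ} (hδ : 0 < δ) :
    ∃ δ' > 0, ∀ e e' : X, e' ∈ stableSet e → dist (f e) (f e') ≤ δ' →
      br (f e') (f e) = f e → dist e e' ≤ δ ∧ br e' e = e := by
  -- Counterexamples for δ' = 1/(k+1) have subsequences converging to points u, u' with f u = f u'.
  -- It is shown that u = u', which contradicts the choice for a late index.
  by_contra! hcon
  obtain ⟨δ₁, hδ₁, hbr⟩ := exists_map_br hc he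
  obtain ⟨δ₂, hδ₂, hδ₂ε, -, hcl⟩ := exists_br_close (X := X) (ε_pos (X := X))
  choose e e' h1 h2 h3 h4 using fun k : ℕ => hcon (1 / ((k : ℝ) + 1)) (by positivity)
  obtain ⟨⟨u, u'⟩, -, g, hg, hlim⟩ := (isCompact_univ (X := X × X)).tendsto_subseq
    (x := fun k => (e k, e' k)) (fun _ => mem_univ _)
  have hu : Tendsto (fun k => e (g k)) atTop (𝓝 u) := (continuous_fst.tendsto _).comp hlim
  have hu' : Tendsto (fun k => e' (g k)) atTop (𝓝 u') := (continuous_snd.tendsto _).comp hlim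
  have hfu := (hc.tendsto u).comp hu
  have hfu' := (hc.tendsto u').comp hu'
  have heq : f u = f u' := by
    refine tendsto_nhds_unique (hfu.congr_dist ?_) hfu'
    have : Tendsto (fun k : ℕ => 1 / (((g k : ℕ) : ℝ) + 1)) atTop (𝓝 0) :=
      (tendsto_one_div_add_atTop_nhds_zero_nat (𝕜 := ℝ)).comp hg.tendsto_atTop
    exact squeeze_zero (fun _ => dist_nonneg) (fun k => h2 (g k)) this
  have ev : ∀ {Z : Type _} [MetricSpace Z] {a : ℕ → Z} {z : Z}, Tendsto a atTop (𝓝 z) → ∀ r > 0,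
      ∀ᶠ k in atTop, dist (a k) z ≤ r := fun h r hr =>
    ((Metric.tendsto_nhds.1 h) r hr).mono fun _ => le_of_lt
  have ev' : ∀ {Z : Type _} [MetricSpace Z] {a : ℕ → Z} {z : Z}, Tendsto a atTop (𝓝 z) → ∀ r > 0,
      ∀ᶠ k in atTop, dist (a k) z ≤ r := fun h r hr =>
    ((Metric.tendsto_nhds.1 h) r hr).mono fun _ => le_of_lt
  -- Both brackets are stably equivalent to `e (g k)`. Their images are [f e', f u] and [f e, f u],
  -- which agree because [f e', f e] = f e. Injectivity on the stable set identifies them, and in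
  -- the limit u' = u.
  have key : ∀ᶠ k in atTop, br (e' (g k)) u' = br (e (g k)) u := by
    filter_upwards [ev hu _ hδ₂, ev hu' _ hδ₂, ev hu _ hδ₁, ev hu' _ hδ₁,
      ev' hfu (ε Y / 2) (half_pos ε_pos), ev' hfu' (ε Y / 2) (half_pos ε_pos)]
      with k a1 a2 a3 a4 a5 a6
    refine (hs (e (g k))).injOn ?_ ?_ ?_
    · exact mem_stableSet_trans (h1 _) (br_mem_stableSet (a2.trans hδ₂ε) (hcl _ _ a2).1)
    · exact br_mem_stableSet (a1.trans hδ₂ε) (hcl _ _ a1).1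
    · rw [hbr _ _ a3, hbr _ _ a4, ← heq]
      simp only [Function.comp_apply] at a5 a6
      rw [← heq] at a6
      have := br_br_left (f (e' (g k))) (f (e (g k))) (f u)
        (by linarith [dist_triangle_right (f (e' (g k))) (f (e (g k))) (f u)])
        (by rw [h3]; linarith [ε_pos (X := Y)]) (by linarith [ε_pos (X := Y)])
      rw [h3] at this
      exact this.symm
  have huu : u' = u := tendsto_nhds_unique
    ((tendsto_congr' key).1 (tendsto_br hu' tendsto_const_nhds)) (tendsto_br hu tendsto_const_nhds)
  subst huu
  have hd : Tendsto (fun k => dist (e (g k)) (e' (g k))) atTop (𝓝 0) := by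
    simpa using hu.dist hu'
  have hd' : ∀ r > 0, ∀ᶠ k in atTop, dist (e (g k)) (e' (g k)) ≤ r := fun r hr =>
    (hd.eventually_lt_const hr).mono fun _ => le_of_lt
  obtain ⟨k, a1, a2, a3⟩ := ((hd' δ hδ).and ((hd' _ hδ₁).and (hd' _ hδ₂))).exists
  refine h4 _ a1 ((hs (e (g k))).injOn ?_ (mem_stableSet_self _) ?_)
  · rw [dist_comm] at a3
    exact mem_stableSet_trans (h1 _) (br_mem_stableSet (a3.trans hδ₂ε) (hcl _ _ a3).1)
  · rw [dist_comm] at a2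
    rw [hbr _ _ a2, h3]

/-- Nearby unstably equivalent points lift to nearby points along a `u`-bijective map. -/
theorem UBijective.exists_lift_close (hs : UBijective f) (hc : Continuous f)
    (he : ∀ x, f (φ x) = φ (f x)) {δ : ℝ} (hδ : 0 < δ) :
    ∃ δ' > 0, ∀ e e' : X, e' ∈ unstableSet e → dist (f e) (f e') ≤ δ' →
      br (f e) (f e') = f e → dist e e' ≤ δ ∧ br e e' = e :=
  @SBijective.exists_lift_close X _ _ (dual X) Y _ _ (dual Y) f hs hc (map_symm he) δ hδ

/-- Compactness passes along the continuous map. For openness, a point of a small local stable set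
of `f x` has a preimage in the stable set of `x`, and `exists_lift_close` places it in a small local
stable set. -/
theorem SBijective.cOpen_image (hs : SBijective f) (hc : Continuous f)
    (he : ∀ x, f (φ x) = φ (f x)) {A : Set X} (hA : COpen A) : COpen (f '' A) := by
  refine ⟨?_, @IsCompact.image X Y (stableTopology X) (stableTopology Y) _ f hA.2
    (continuous_stable hc he)⟩
  rw [isOpen_stable_iff]
  rintro _ ⟨x, hx, rfl⟩
  obtain ⟨δ, hδ, -, hAx⟩ := isOpen_stable_iff.1 hA.1 x hx
  obtain ⟨δ', hδ', h⟩ := hs.exists_lift_close hc he (half_pos hδ)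
  refine ⟨min δ' (ε Y), lt_min hδ' ε_pos, min_le_right _ _, fun q hq => ?_⟩
  obtain ⟨p, hp, rfl⟩ := (hs x).surjOn (localStable_subset_stableSet _ (min_le_right _ _) hq)
  obtain ⟨h1, h2⟩ := h x p hp (hq.1.le.trans (min_le_left _ _)) hq.2
  exact ⟨p, hAx ⟨h1.trans_lt (half_lt_self hδ), h2⟩, rfl⟩

/-- The image of a compact open subset of a stable set under an `s`-bijective map. -/
@[simps]
def CO.map (f : X → Y) (hs : SBijective f) (hc : Continuous f) (he : ∀ x, f (φ x) = φ (f x))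
    (E : CO X) : CO Y where
  carrier := f '' E.carrier
  exists_subset := E.exists_subset.elim fun e h =>
    ⟨f e, (image_mono h).trans (hs e).mapsTo.image_subset⟩
  isOpen := (hs.cOpen_image hc he E.cOpen).1
  isCompact := (hs.cOpen_image hc he E.cOpen).2

theorem SBijective.injOn_CO (hs : SBijective f) (E : CO X) : InjOn f E.carrier := by
  obtain ⟨e, he⟩ := E.exists_subset
  exact (hs e).injOn.mono he

/-- Only compactness needs an argument. Over a small closed piece of a local stable set, nearby
points x, y of the preimage satisfy f[y,x] = [f y, f x] = f x, and [y,x] is unstably equivalent to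
x. So [y,x] = x by u-injectivity: the ordinary and the stable topology agree there, and ordinary
compactness suffices. -/
theorem UBijective.cOpen_preimage (hu : UBijective f) (hc : Continuous f)
    (he : ∀ x, f (φ x) = φ (f x)) {A : Set Y} (hA : COpen A) : COpen (f ⁻¹' A) := by
  refine ⟨@IsOpen.preimage X Y (stableTopology X) (stableTopology Y) f (continuous_stable hc he)
    _ hA.1, ?_⟩
  classical
  choose! r hr hrε hrA using isOpen_stable_iff.1 hA.1
  -- Half the radius is used so that the closed piece stays inside `A` and any two of its points are
  -- within the range of the bracket.
  let K : Y → Set Y := fun a => {b | dist b a ≤ r a / 2 ∧ br b a = a}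
  have hKA : ∀ a ∈ A, K a ⊆ A := fun a ha b hb => hrA a ha ⟨by
    rw [dist_comm]; exact hb.1.trans_lt (half_lt_self (hr a ha)), hb.2⟩
  have hKc : ∀ a ∈ A, IsClosed (K a) := by
    intro a ha
    have h0 : IsClosed {b : Y | dist b a ≤ r a / 2} :=
      isClosed_le (by fun_prop) continuous_const
    have h1 : ContinuousOn (fun b => br b a) {b : Y | dist b a ≤ r a / 2} := by
      refine ContinuousOn.comp (g := fun p : Y × Y => br p.1 p.2) (f := fun b => (b, a)) br_cont
        (by fun_prop) fun b hb => ?_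
      have := hr a ha
      have := hrε a ha
      have hb : dist b a ≤ r a / 2 := hb
      change dist b a ≤ ε Y
      linarith
    exact h1.preimage_isClosed_of_isClosed h0 (isClosed_singleton (x := a))
  obtain ⟨δ₁, hδ₁, hbr⟩ := exists_map_br hc he
  obtain ⟨δ₂, hδ₂, hδ₂ε, -, hcl⟩ := exists_br_close (X := X) (ε_pos (X := X))
  have hKs : ∀ a ∈ A, @IsCompact X (stableTopology X) (f ⁻¹' K a) := by
    intro a ha
    have hcomp : IsCompact (f ⁻¹' K a) := ((hKc a ha).preimage hc).isCompact
    have := @IsCompact.image_of_continuousOn X X _ (stableTopology X) (f ⁻¹' K a) id hcomp ?_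
    · rwa [image_id] at this
    intro x hx
    refine Filter.tendsto_def.2 fun U hU => ?_
    obtain ⟨V, hVU, hV, hxV⟩ := (@mem_nhds_iff X (stableTopology X) _ _).1 hU
    obtain ⟨δ, hδ, hδε, hδV⟩ := isOpen_stable_iff.1 hV x hxV
    refine mem_of_superset (inter_mem_nhdsWithin _
      (Metric.ball_mem_nhds x (lt_min (lt_min hδ hδ₁) hδ₂))) ?_
    rintro y ⟨hy, hyx⟩
    rw [Metric.mem_ball] at hyx
    have d1 := hyx.trans_le ((min_le_left _ _).trans (min_le_left _ _))
    have d2 := hyx.trans_le ((min_le_left _ _).trans (min_le_right _ _))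
    have d3 := hyx.trans_le (min_le_right _ _)
    refine hVU (hδV ⟨by rwa [dist_comm], ?_⟩)
    refine (hu x).injOn ?_ (mem_unstableSet_self x) ?_
    · exact br_mem_unstableSet (d3.le.trans hδ₂ε) (hcl _ _ d3.le).2
    · rw [hbr _ _ d2.le]
      have e1 := hr a ha
      have e2 := hrε a ha
      have e3 := hy.1
      have e4 := hx.1
      have e5 := dist_triangle_right (f y) (f x) a
      have e6 : br a (f x) = f x := by
        refine br_eq_of_br_left ?_ hx.2
        rw [dist_comm]; linarith
      exact br_stable_trans (y := a) (by linarith) (by rw [dist_comm]; linarith) (by linarith)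
        hy.2 e6
  obtain ⟨t, htA, ht⟩ := @IsCompact.elim_nhds_subcover Y (stableTopology Y) _ hA.2
    (fun a => localStable a (if a ∈ A then r a / 2 else ε Y)) (fun a ha =>
      @IsOpen.mem_nhds Y (stableTopology Y) _ _
      (isOpen_localStable a (by simpa [ha] using hr a ha)
        (by have := hr a ha; have := hrε a ha; simp only [ha, if_true]; linarith))
      (mem_localStable_self a (by simpa [ha] using hr a ha)))
  have hAeq : f ⁻¹' A = ⋃ a ∈ t, f ⁻¹' K a := by
    rw [← preimage_iUnion₂]
    congr 1
    refine Subset.antisymm (fun b hb => ?_) (iUnion₂_subset fun a ha => hKA a (htA a ha))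
    obtain ⟨a, ha, hab⟩ := mem_iUnion₂.1 (ht hb)
    rw [if_pos (htA a ha)] at hab
    exact mem_iUnion₂.2 ⟨a, ha, by rw [dist_comm]; exact hab.1.le, hab.2⟩
  rw [hAeq]
  exact @Finset.isCompact_biUnion X _ (stableTopology X) t _ fun a ha => hKs a (htA a ha)

end Maps

end SmaleSpace

namespace SmaleSpace

/-! ### Iterates of the homeomorphism and maps compatible with the bracket scale -/

section Shift

variable {X : Type u} [MetricSpace X] [CompactSpace X] [SmaleSpace X]
variable {Y : Type v} [MetricSpace Y] [CompactSpace Y] [SmaleSpace Y]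
variable {Z : Type w} [MetricSpace Z] [CompactSpace Z] [SmaleSpace Z]

theorem UBijective.comp {f : X → Y} {g : Y → Z} (hg : UBijective g) (hf : UBijective f) :
    UBijective (g ∘ f) := fun x => (hg (f x)).comp (hf x)

theorem UBijective.id : UBijective (id : X → X) := fun _ => bijOn_id _

variable (X) in
theorem sBijective_φ : SBijective (φ (X := X)) := fun x =>
  ⟨fun _ hy => map_mem_stableSet (φ (X := X)).continuous (fun _ => rfl) hy,
    (φ (X := X)).injective.injOn, fun y hy => ⟨(φ (X := X)).symm y, by
      have := map_mem_stableSet (φ (X := X)).symm.continuous (fun _ => by simp) hy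
      simpa using this, by simp⟩⟩

variable (X) in
theorem sBijective_φ_symm : SBijective (φ (X := X)).symm := fun x =>
  ⟨fun _ hy => map_mem_stableSet (φ (X := X)).symm.continuous (fun _ => by simp) hy,
    (φ (X := X)).symm.injective.injOn, fun y hy => ⟨φ (X := X) y, by
      have := map_mem_stableSet (φ (X := X)).continuous (fun _ => rfl) hy
      simpa using this, by simp⟩⟩

variable (X) in
theorem uBijective_φ : UBijective (φ (X := X)) := @sBijective_φ_symm X _ _ (dual X)

variable (X) in
theorem uBijective_φ_iterate (n : ℕ) : UBijective (φ (X := X))^[n] := by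
  induction n with
  | zero => exact UBijective.id
  | succ n ih => exact ih.comp (uBijective_φ X)

theorem map_br_iterate {a b : X} {n : ℕ}
    (h : ∀ k ≤ n, dist ((φ (X := X))^[k] a) ((φ (X := X))^[k] b) ≤ ε X) :
    (φ (X := X))^[n] (br a b) = br ((φ (X := X))^[n] a) ((φ (X := X))^[n] b) := by
  induction n with
  | zero => rfl
  | succ n ih =>
    rw [Function.iterate_succ_apply', ih fun k hk => h k (by omega), map_br _ _ (h n (by omega))]
    · simp only [Function.iterate_succ_apply']
    · have := h (n + 1) le_rfl
      simpa only [Function.iterate_succ_apply'] using this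

theorem iterate_symm_iterate {k n : ℕ} (h : k ≤ n) (a : X) :
    (φ (X := X))^[k] ((φ (X := X)).symm^[n] a) = (φ (X := X)).symm^[n - k] a := by
  obtain ⟨m, rfl⟩ := Nat.exists_eq_add_of_le h
  rw [Function.iterate_add_apply, Nat.add_sub_cancel_left]
  exact Function.LeftInverse.iterate (φ (X := X)).apply_symm_apply k _

/-- Continuous equivariant maps which do not increase distances and respect the brackets. -/
structure IsScaleMap (f : X → Y) : Prop where
  cont : Continuous f
  equivariant : ∀ x, f (φ x) = φ (f x)
  ε_eq : ε X = ε Y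
  lam_eq : lam X = lam Y
  dist_le : ∀ a b, dist (f a) (f b) ≤ dist a b
  map_br : ∀ a b, dist a b ≤ ε X → f (br a b) = br (f a) (f b)

theorem IsScaleMap.id : IsScaleMap (id : X → X) :=
  ⟨continuous_id, fun _ => rfl, rfl, rfl, fun _ _ => le_rfl, fun _ _ _ => rfl⟩

end Shift

/-! ### Colourings and approximating groups -/

variable {X : Type u} [MetricSpace X] [CompactSpace X] [SmaleSpace X]
variable {Y : Type v} [MetricSpace Y] [CompactSpace Y] [SmaleSpace Y]
variable {V : Type*}

variable (X V) in
/-- A locally constant function all of whose fibres are small. -/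
structure Coloring where
  toFun : X → V
  isOpen : ∀ v, IsOpen (toFun ⁻¹' {v})
  -- The radius ε/2 is the one in the definition of the equivalence of compact open sets. The bound
  -- (1 − λ)ε leaves room, in a triangle inequality, for an unstable distance already contracted to
  -- λε. The last two bounds make brackets of points of the same colour stably and unstably
  -- equivalent to their arguments.
  close : ∀ a b, toFun a = toFun b → dist a b < ε X / 2 ∧ dist a b ≤ (1 - lam X) * ε X ∧
    dist a (br a b) ≤ ε X ∧ dist b (br a b) ≤ ε X

namespace Coloring

instance : CoeFun (Coloring X V) (fun _ => X → V) := ⟨toFun⟩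

variable (κ : Coloring X V)

theorem dist_le {a b : X} (h : κ a = κ b) : dist a b ≤ ε X := by
  have := (κ.close a b h).1
  linarith [ε_pos (X := X)]

theorem exists_eq_of_dist_le : ∃ δ > 0, ∀ a b, dist a b ≤ δ → κ a = κ b := by
  obtain ⟨δ, hδ, h⟩ := lebesgue_number_lemma_of_metric (isCompact_univ (X := X))
    (c := fun v => κ ⁻¹' {v}) κ.isOpen (fun x _ => mem_iUnion.2 ⟨κ x, rfl⟩)
  refine ⟨δ / 2, half_pos hδ, fun a b hab => ?_⟩
  obtain ⟨v, hv⟩ := h a (mem_univ _)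
  have h1 : κ a = v := hv (Metric.mem_ball_self hδ)
  have h2 : κ b = v := hv (by rw [Metric.mem_ball, dist_comm]; linarith)
  rw [h1, h2]

/-- The points of the same colour which are locally stably equivalent to `x`. -/
def slice (x : X) : Set X := {p | κ p = κ x ∧ br p x = x}

theorem mem_slice_self (x : X) : x ∈ κ.slice x := ⟨rfl, br_self x⟩

variable {κ}

theorem slice_symm {x y : X} (h : y ∈ κ.slice x) : x ∈ κ.slice y :=
  ⟨h.1.symm, br_eq_of_br_left (κ.dist_le h.1.symm) h.2⟩

theorem slice_trans {x y z : X} (h : y ∈ κ.slice x) (h' : z ∈ κ.slice y) : z ∈ κ.slice x :=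
  ⟨h'.1.trans h.1, br_stable_trans (κ.dist_le h'.1) (κ.dist_le h.1) (κ.dist_le (h'.1.trans h.1))
    h'.2 h.2⟩

theorem slice_subset_localStable (x : X) : κ.slice x ⊆ localStable x (ε X / 2) := fun _ hy =>
  ⟨(κ.close _ _ hy.1.symm).1, hy.2⟩

theorem slice_subset_stableSet (x : X) : κ.slice x ⊆ stableSet x :=
  (slice_subset_localStable x).trans
    (localStable_subset_stableSet x (by linarith [ε_pos (X := X)]))

theorem isOpen_slice (x : X) : IsOpen[stableTopology X] (κ.slice x) := by
  obtain ⟨δ, hδ, h⟩ := κ.exists_eq_of_dist_le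
  rw [isOpen_stable_iff]
  refine fun y hy => ⟨min δ (ε X), lt_min hδ ε_pos, min_le_right _ _, fun z hz =>
    slice_trans hy ⟨(h _ _ (hz.1.le.trans (min_le_left _ _))).symm, hz.2⟩⟩

theorem isOpen_compl_slice (x : X) : IsOpen[stableTopology X] (κ.slice x)ᶜ := by
  rw [isOpen_stable_iff]
  intro y hy
  obtain ⟨δ, hδ, hδε, h⟩ := isOpen_stable_iff.1 (isOpen_slice (κ := κ) y) y (κ.mem_slice_self y)
  exact ⟨δ, hδ, hδε, fun z hz hzx => hy (slice_trans hzx (slice_symm (h hz)))⟩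

theorem mem_slice_of_br {x a b : X} (ha : κ a = κ x) (hb : κ b = κ x) (h : br x a = b) :
    b ∈ κ.slice x := by
  refine ⟨hb, br_eq_of_br_left (κ.dist_le hb) ?_⟩
  rw [← h]
  exact br_br_self_left (κ.dist_le ha.symm) (by rw [h]; exact κ.dist_le hb.symm)

/-- Slices are the classes of an equivalence relation and are open in the stable topology. A finite
subcover thus needs only one representative per class. -/
theorem exists_slice_reps {G : Set X} (hG : COpen G) :
    ∃ t : Finset X, (∀ x ∈ t, x ∈ G) ∧ (t : Set X).PairwiseDisjoint κ.slice ∧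
      G ⊆ ⋃ x ∈ t, κ.slice x := by
  classical
  obtain ⟨t, htG, ht⟩ := @IsCompact.elim_nhds_subcover X (stableTopology X) _ hG.2
    κ.slice (fun x _ => @IsOpen.mem_nhds X (stableTopology X) _ _
      (isOpen_slice x) (κ.mem_slice_self x))
  let st : Setoid X := ⟨fun x y => y ∈ κ.slice x, ⟨κ.mem_slice_self, slice_symm, slice_trans⟩⟩
  have hr : ∀ q ∈ t.image (Quotient.mk st), ∃ x ∈ t, Quotient.mk st x = q := fun q hq =>
    Finset.mem_image.1 hq
  have : Nonempty X ∨ IsEmpty X := (isEmpty_or_nonempty X).symm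
  rcases this with _ | _
  swap
  · exact ⟨∅, by simp, by simp, fun x => isEmptyElim x⟩
  choose! r hrt hrq using hr
  refine ⟨(t.image (Quotient.mk st)).image r, ?_, ?_, ?_⟩
  · intro x hx
    obtain ⟨q, hq, rfl⟩ := Finset.mem_image.1 hx
    exact htG _ (hrt q hq)
  · intro x hx y hy hxy
    obtain ⟨q, hq, rfl⟩ := Finset.mem_image.1 hx
    obtain ⟨q', hq', rfl⟩ := Finset.mem_image.1 hy
    refine Set.disjoint_left.2 fun z hz hz' => hxy ?_
    have h1 : Quotient.mk st (r q) = Quotient.mk st z := Quotient.sound hz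
    have h2 : Quotient.mk st (r q') = Quotient.mk st z := Quotient.sound hz'
    rw [← hrq q hq, ← hrq q' hq', h1, h2]
  · intro x hx
    obtain ⟨y, hy, hxy⟩ := mem_iUnion₂.1 (ht hx)
    have hq : Quotient.mk st y ∈ t.image (Quotient.mk st) := Finset.mem_image_of_mem _ hy
    refine mem_iUnion₂.2 ⟨r (Quotient.mk st y), Finset.mem_image_of_mem _ hq, ?_⟩
    have : y ∈ κ.slice (r (Quotient.mk st y)) := Quotient.exact (hrq _ hq)
    exact slice_trans this hxy

variable (κ)

/-- `E` and `F` are contained in slices of the same colour and correspond to each other under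
the holonomy map between these slices. -/
def Rel (E F : CO X) : Prop :=
  ∃ x y, κ x = κ y ∧ E.carrier ⊆ κ.slice x ∧ F.carrier ⊆ κ.slice y ∧
    (∀ a ∈ E.carrier, br y a ∈ F.carrier) ∧ (∀ b ∈ F.carrier, br x b ∈ E.carrier)

variable {κ}

theorem Rel.symm {E F : CO X} (h : κ.Rel E F) : κ.Rel F E := by
  obtain ⟨x, y, h1, h2, h3, h4, h5⟩ := h
  exact ⟨y, x, h1.symm, h3, h2, h5, h4⟩

/-- For a in the slice of x one has [a,b] = [[a,x],b] = [x,b], so the set-wise bracket reduces to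
the single holonomy map b ↦ [x,b], which is onto E because a = [x,[y,a]]. -/
theorem Rel.image2_br {E F : CO X} (h : κ.Rel E F) :
    image2 br E.carrier F.carrier = E.carrier := by
  obtain ⟨x, y, h1, h2, h3, h4, h5⟩ := h
  have key : ∀ a ∈ E.carrier, ∀ b ∈ F.carrier, br a b = br x b := by
    intro a ha b hb
    have e1 := h2 ha
    have e2 := h3 hb
    have := br_br_left a x b (κ.dist_le e1.1) (by rw [e1.2]; exact κ.dist_le (h1.trans e2.1.symm))
      (κ.dist_le (e1.1.trans (h1.trans e2.1.symm)))
    rw [e1.2] at this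
    exact this.symm
  ext a
  constructor
  · rintro ⟨a, ha, b, hb, rfl⟩
    rw [key a ha b hb]
    exact h5 b hb
  · intro ha
    refine ⟨a, ha, br y a, h4 a ha, ?_⟩
    have e1 := h2 ha
    have e2 := h3 (h4 a ha)
    rw [br_br_right a y a (κ.dist_le (h1.symm.trans e1.1.symm))
      (κ.dist_le (e1.1.trans (h1.trans e2.1.symm))) (by simp [(ε_pos (X := X)).le]), br_self]

theorem Rel.rel {E F : CO X} (h : κ.Rel E F) : CO.Rel E F := by
  obtain ⟨x, y, h1, h2, h3, -, -⟩ := id h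
  exact CO.Rel.bracket x y (h2.trans (slice_subset_localStable x))
    (h3.trans (slice_subset_localStable y))
    (fun a ha b hb => κ.dist_le (((h2 ha).1.trans h1).trans (h3 hb).1.symm))
    h.image2_br h.symm.image2_br

variable (κ) in
/-- The relations between classes of compact open sets which are visible for the colouring. -/
def relations : AddSubgroup (FreeAbelianGroup (CO X)) :=
  AddSubgroup.closure ({a | ∃ E F G : CO X, G.carrier = E.carrier ∪ F.carrier ∧
    Disjoint E.carrier F.carrier ∧
    a = FreeAbelianGroup.of G - FreeAbelianGroup.of E - FreeAbelianGroup.of F} ∪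
    {a | ∃ E F, κ.Rel E F ∧ a = FreeAbelianGroup.of E - FreeAbelianGroup.of F})

variable (κ) in
/-- An approximation of the dimension group, depending on a colouring. -/
abbrev Grp := FreeAbelianGroup (CO X) ⧸ κ.relations

variable (κ) in
/-- The class of `E` in `Grp`. -/
def cls (E : CO X) : κ.Grp := QuotientAddGroup.mk (FreeAbelianGroup.of E)

theorem cls_additive : CO.IsAdditive κ.cls := by
  intro E F G h1 h2
  rw [← sub_eq_zero, ← sub_sub]
  exact (QuotientAddGroup.eq_zero_iff _).2
    (AddSubgroup.subset_closure (Or.inl ⟨E, F, G, h1, h2, rfl⟩))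

theorem cls_rel {E F : CO X} (h : κ.Rel E F) : κ.cls E = κ.cls F := by
  rw [← sub_eq_zero]
  exact (QuotientAddGroup.eq_zero_iff _).2 (AddSubgroup.subset_closure (Or.inr ⟨E, F, h, rfl⟩))

/-- The universal property of `Grp`. -/
noncomputable def lift {A : Type*} [AddCommGroup A] (χ : CO X → A) (hχ : CO.IsAdditive χ)
    (hr : ∀ E F, κ.Rel E F → χ E = χ F) : κ.Grp →+ A :=
  QuotientAddGroup.lift _ (FreeAbelianGroup.lift χ) (by
    rw [relations, AddSubgroup.closure_le]
    rintro _ (⟨E, F, G, h1, h2, rfl⟩ | ⟨E, F, h, rfl⟩)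
    · change (FreeAbelianGroup.lift _) _ = 0
      rw [map_sub, map_sub]
      simp only [FreeAbelianGroup.lift_apply_of]
      rw [hχ E F G h1 h2]; abel
    · change (FreeAbelianGroup.lift _) _ = 0
      rw [map_sub]
      simp only [FreeAbelianGroup.lift_apply_of]
      rw [hr E F h, sub_self])

@[simp]
theorem lift_cls {A : Type*} [AddCommGroup A] (χ : CO X → A) (hχ : CO.IsAdditive χ)
    (hr : ∀ E F, κ.Rel E F → χ E = χ F) (E : CO X) : κ.lift χ hχ hr (κ.cls E) = χ E :=
  FreeAbelianGroup.lift_apply_of _ _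

theorem hom_ext {A : Type*} [AddCommGroup A] {p q : κ.Grp →+ A}
    (h : ∀ E, p (κ.cls E) = q (κ.cls E)) : p = q := by
  apply QuotientAddGroup.addMonoidHom_ext
  exact FreeAbelianGroup.lift_ext _ _ h

/-- A colour-preserving correspondence that on each slice coincides with the holonomy map to the
slice of a partner point cuts `G` and `G'` into pieces related by `Rel`. Additivity makes the given
partitions irrelevant. -/
theorem sum_eq_of_pairing {G G' : Set X} (hG : COpen G) (hG' : COpen G') (T : X → X → Prop)
    (h1 : ∀ e ∈ G, ∃ e' ∈ G', T e e') (h2 : ∀ e' ∈ G', ∃ e ∈ G, T e e')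
    (hκ : ∀ e ∈ G, ∀ e' ∈ G', T e e' → κ e = κ e')
    (h3 : ∀ e ∈ G, ∀ x ∈ G, ∀ e' ∈ G', ∀ x' ∈ G', T e e' → T x x' → e ∈ κ.slice x →
      br x' e = e')
    (h4 : ∀ e ∈ G, ∀ x ∈ G, ∀ e' ∈ G', ∀ x' ∈ G', T e e' → T x x' → e' ∈ κ.slice x' →
      br x e' = e)
    {s t : Finset (CO X)} (hs : IsCOPartition s G) (ht : IsCOPartition t G') :
    ∑ E ∈ s, κ.cls E = ∑ E ∈ t, κ.cls E := by
  obtain ⟨r, hrG, hrd, hr⟩ := exists_slice_reps (κ := κ) hG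
  choose! p hpG hpT using h1
  have g1 : ∀ e ∈ G, ∀ x ∈ G, e ∈ κ.slice x → br (p x) e = p e ∧ p e ∈ κ.slice (p x) := by
    intro e he x hx hex
    have e1 := h3 e he x hx (p e) (hpG e he) (p x) (hpG x hx) (hpT e he) (hpT x hx) hex
    have e2 := hκ e he _ (hpG e he) (hpT e he)
    have e3 := hκ x hx _ (hpG x hx) (hpT x hx)
    exact ⟨e1, mem_slice_of_br (hex.1.trans e3) (e2.symm.trans (hex.1.trans e3)) e1⟩
  have g2 : ∀ e ∈ G, ∀ x ∈ G, ∀ e' ∈ G', T e e' → e' ∈ κ.slice (p x) →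
      br x e' = e ∧ e ∈ κ.slice x := by
    intro e he x hx e' he' hT hex
    have e1 := h4 e he x hx e' he' (p x) (hpG x hx) hT (hpT x hx) hex
    have e2 := hκ e he _ he' hT
    have e3 := hκ x hx _ (hpG x hx) (hpT x hx)
    exact ⟨e1, mem_slice_of_br (hex.1.trans e3.symm) (e2.trans (hex.1.trans e3.symm)) e1⟩
  let A : X → CO X := fun x => (hG.inter_of_clopen (isOpen_slice (κ := κ) x)
    (isOpen_compl_slice x)).toCO (inter_subset_right.trans (slice_subset_stableSet x))
  let B : X → CO X := fun x => (hG'.inter_of_clopen (isOpen_slice (κ := κ) (p x))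
    (isOpen_compl_slice (p x))).toCO (inter_subset_right.trans (slice_subset_stableSet (p x)))
  have hA : CO.IsPart r A G := by
    refine ⟨fun x hx y hy hxy => (hrd hx hy hxy).mono inter_subset_right inter_subset_right, ?_⟩
    change ⋃ x ∈ r, G ∩ κ.slice x = G
    rw [← inter_iUnion₂, inter_eq_left.2 hr]
  have hB : CO.IsPart r B G' := by
    refine ⟨fun x hx y hy hxy => Set.disjoint_left.2 fun e' he1 he2 => ?_, ?_⟩
    · obtain ⟨e, he, hT⟩ := h2 e' he1.1
      exact Set.disjoint_left.1 (hrd hx hy hxy) (g2 e he x (hrG x hx) e' he1.1 hT he1.2).2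
        (g2 e he y (hrG y hy) e' he1.1 hT he2.2).2
    · change ⋃ x ∈ r, G' ∩ κ.slice (p x) = G'
      refine Subset.antisymm (iUnion₂_subset fun _ _ => inter_subset_left) fun e' he' => ?_
      obtain ⟨e, he, hT⟩ := h2 e' he'
      obtain ⟨x, hx, hex⟩ := mem_iUnion₂.1 (hr he)
      have e0 := (g1 e he x (hrG x hx) hex).1
      have e1 := h3 e he x (hrG x hx) e' he' (p x) (hpG x (hrG x hx)) hT (hpT x (hrG x hx)) hex
      refine mem_iUnion₂.2 ⟨x, hx, he', ?_⟩
      rw [← e1, e0]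
      exact (g1 e he x (hrG x hx) hex).2
  calc ∑ E ∈ s, κ.cls E = ∑ x ∈ r, κ.cls (A x) :=
        cls_additive.sum_eq_sum (CO.isPart_iff.2 hs) hA
    _ = ∑ x ∈ r, κ.cls (B x) := by
        refine Finset.sum_congr rfl fun x hx => cls_rel ⟨x, p x, ?_, inter_subset_right,
          inter_subset_right, ?_, ?_⟩
        · exact hκ x (hrG x hx) _ (hpG x (hrG x hx)) (hpT x (hrG x hx))
        · rintro a ⟨ha, hax⟩
          obtain ⟨e1, e2⟩ := g1 a ha x (hrG x hx) hax
          rw [e1]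
          exact ⟨hpG a ha, e2⟩
        · rintro b ⟨hb, hbx⟩
          obtain ⟨e, he, hT⟩ := h2 b hb
          obtain ⟨e1, e2⟩ := g2 e he x (hrG x hx) b hb hT hbx
          rw [e1]
          exact ⟨he, e2⟩
    _ = ∑ E ∈ t, κ.cls E := cls_additive.sum_eq_sum hB (CO.isPart_iff.2 ht)

/-- Writing a = [a₁,b] with b in the second set gives [a,b] = [[a₁,b],b] = a, so every point has a
partner on its local unstable set. -/
theorem exists_br_eq {F F' : Set Y} (hd : ∀ a ∈ F, ∀ b ∈ F', dist a b ≤ ε Y)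
    (h : image2 br F F' = F) {a : Y} (ha : a ∈ F) : ∃ b ∈ F', br a b = a := by
  rw [← h] at ha
  obtain ⟨a₁, ha₁, b, hb, rfl⟩ := ha
  refine ⟨b, hb, br_br_left _ _ _ (hd _ ha₁ _ hb) (hd _ ?_ _ hb) (hd _ ha₁ _ hb)⟩
  rw [← h]
  exact mem_image2_of_mem ha₁ hb

/-- The partner relation is shown to be a holonomy. Write g = f∘φ^n. Both [x',e] and e' are unstably
equivalent to e, and g is injective on unstable sets, so images can be compared. These agree because
[g x', g e] = [[g e', g x'], g e] = [g e', g e] = g e'. -/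
theorem br_eq_of_pairing {f : X → Y} (hf : IsScaleMap f) (hu : UBijective f) {n : ℕ}
    {F F' : Set Y} {f₀ : Y} (hF' : F' ⊆ localStable f₀ (ε Y / 2))
    (hd : ∀ a ∈ F, ∀ b ∈ F', dist a b ≤ ε Y) {e x e' x' : X}
    (he : f ((φ (X := X))^[n] e) ∈ F) (hx : f ((φ (X := X))^[n] x) ∈ F)
    (he' : f ((φ (X := X))^[n] e') ∈ F') (hx' : f ((φ (X := X))^[n] x') ∈ F')
    (hee : e' ∈ unstableSet e)
    (hbe : br (f ((φ (X := X))^[n] e)) (f ((φ (X := X))^[n] e')) = f ((φ (X := X))^[n] e))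
    (hbx : br (f ((φ (X := X))^[n] x)) (f ((φ (X := X))^[n] x')) = f ((φ (X := X))^[n] x))
    (hκ : κ x = κ x') (hex : e ∈ κ.slice x) : br x' e = e' := by
  have hcl := κ.close x' e (hκ.symm.trans hex.1.symm)
  have hdx : dist x' e ≤ ε X := κ.dist_le (hκ.symm.trans hex.1.symm)
  refine ((hu.comp (uBijective_φ_iterate X n)) e).injOn
    (br_mem_unstableSet hdx hcl.2.2.2) hee ?_
  have hit : ∀ a : X, f ((φ (X := X))^[n] a) = (φ (X := Y))^[n] (f a) :=
    map_iterate hf.equivariant n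
  have hinv : ∀ a : X, f a = (φ (X := Y)).symm^[n] (f ((φ (X := X))^[n] a)) := fun a => by
    rw [hit]
    exact (Function.LeftInverse.iterate (φ (X := Y)).symm_apply_apply n _).symm
  have hlam := lam_pos (X := Y)
  have hlam1 := lam_lt_one (X := Y)
  have hε := ε_pos (X := Y)
  -- The homeomorphism may be moved through the bracket n times only if the orbits stay within ε
  -- throughout. For k < n the pair x, x' has been contracted at least once backwards in time,
  -- contributing at most λε, while the stable pair x, e contributes at most (1 − λ)ε. The case k =
  -- n is the hypothesis on F and F'.
  have hdk : ∀ k ≤ n, dist ((φ (X := Y))^[k] (f x')) ((φ (X := Y))^[k] (f e)) ≤ ε Y := by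
    intro k hk
    rcases hk.eq_or_lt with rfl | hk'
    · rw [← hit, ← hit, dist_comm]
      exact hd _ he _ hx'
    · have d1 : dist ((φ (X := Y))^[k] (f x)) ((φ (X := Y))^[k] (f x')) ≤ lam Y * ε Y := by
        rw [hinv x, hinv x', iterate_symm_iterate hk, iterate_symm_iterate hk]
        refine (backward_close (hd _ hx _ hx') hbx (n - k)).1.trans ?_
        exact mul_le_mul (pow_le_of_le_one hlam.le hlam1.le (by omega)) (hd _ hx _ hx')
          dist_nonneg hlam.le
      have d2 : dist ((φ (X := Y))^[k] (f x)) ((φ (X := Y))^[k] (f e)) ≤ (1 - lam Y) * ε Y := by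
        have d3 : dist x e ≤ ε X := κ.dist_le hex.1.symm
        have d4 : dist (f x) (f e) ≤ dist x e := hf.dist_le _ _
        have d5 := (κ.close x e hex.1.symm).2.1
        rw [hf.ε_eq, hf.lam_eq] at d5
        have d6 : br (f x) (f e) = f e := by
          rw [← hf.map_br _ _ d3, br_eq_of_br_left d3 hex.2]
        refine (forward_close (d4.trans (d3.trans hf.ε_eq.le)) d6 k).1.trans ?_
        exact (mul_le_of_le_one_left dist_nonneg (pow_le_one₀ hlam.le hlam1.le)).trans
          (d4.trans d5)
      have := dist_triangle_left ((φ (X := Y))^[k] (f x')) ((φ (X := Y))^[k] (f e))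
        ((φ (X := Y))^[k] (f x))
      linarith
  simp only [Function.comp_apply]
  rw [hit, hf.map_br _ _ hdx, map_br_iterate hdk, ← hit, ← hit]
  have hst : br (f ((φ (X := X))^[n] e')) (f ((φ (X := X))^[n] x')) = f ((φ (X := X))^[n] x') := by
    have a1 := hF' he'
    have a2 := hF' hx'
    have a3 := a1.1
    have a4 := a2.1
    have a5 := dist_triangle_left (f ((φ (X := X))^[n] e')) (f ((φ (X := X))^[n] x')) f₀
    exact br_stable_trans (y := f₀) (by rw [dist_comm]; linarith) (by linarith) (by linarith) a1.2
      (br_eq_of_br_left (by linarith) a2.2)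
  have h1 := br_br_left (f ((φ (X := X))^[n] e')) (f ((φ (X := X))^[n] x'))
    (f ((φ (X := X))^[n] e)) (by
      have a3 := (hF' he').1
      have a4 := (hF' hx').1
      have a5 := dist_triangle_left (f ((φ (X := X))^[n] e')) (f ((φ (X := X))^[n] x')) f₀
      linarith) (by rw [hst, dist_comm]; exact hd _ he _ hx') (by
      rw [dist_comm]; exact hd _ he _ he')
  rw [hst] at h1
  rw [h1]
  exact br_eq_of_br_right (hd _ he _ he') hbe

variable (κ) in
/-- The classes of the preimages of two sets related by a bracket agree in the approximating
group, after applying a sufficiently high power of the inverse homeomorphism. -/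
theorem exists_sum_cls_eq {f : X → Y} (hf : IsScaleMap f) (hu : UBijective f) :
    ∃ n₀ : ℕ, ∀ n ≥ n₀, ∀ F F' : CO Y, ∀ e₀ f₀ : Y,
      F.carrier ⊆ localStable e₀ (ε Y / 2) → F'.carrier ⊆ localStable f₀ (ε Y / 2) →
      (∀ a ∈ F.carrier, ∀ b ∈ F'.carrier, dist a b ≤ ε Y) →
      image2 br F.carrier F'.carrier = F.carrier → image2 br F'.carrier F.carrier = F'.carrier →
      ∀ s t : Finset (CO X), IsCOPartition s ((f ∘ (φ (X := X))^[n]) ⁻¹' F.carrier) →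
        IsCOPartition t ((f ∘ (φ (X := X))^[n]) ⁻¹' F'.carrier) →
        ∑ E ∈ s, κ.cls E = ∑ E ∈ t, κ.cls E := by
  obtain ⟨δ, hδ, hκδ⟩ := κ.exists_eq_of_dist_le
  obtain ⟨δ', hδ', hlift⟩ := hu.exists_lift_close hf.cont hf.equivariant hδ
  -- The number n₀ is chosen so that λ^n ε < δ' for n ≥ n₀: partners then have images closer than
  -- δ', lift to points closer than δ, and so have the same colour.
  have hlim : Tendsto (fun n : ℕ => lam Y ^ n * ε Y) atTop (𝓝 0) := by
    simpa using (tendsto_pow_atTop_nhds_zero_of_lt_one (lam_pos (X := Y)).le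
      lam_lt_one).mul_const (ε Y)
  obtain ⟨n₀, hn₀⟩ := eventually_atTop.1 (hlim.eventually_lt_const hδ')
  refine ⟨n₀, fun n hn F F' e₀ f₀ hF hF' hd h1 h2 s t hs ht => ?_⟩
  have hgu : UBijective (f ∘ (φ (X := X))^[n]) := hu.comp (uBijective_φ_iterate X n)
  have hit : ∀ a : X, f ((φ (X := X))^[n] a) = (φ (X := Y))^[n] (f a) :=
    map_iterate hf.equivariant n
  have hinv : ∀ a : X, f a = (φ (X := Y)).symm^[n] (f ((φ (X := X))^[n] a)) := fun a => by
    rw [hit]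
    exact (Function.LeftInverse.iterate (φ (X := Y)).symm_apply_apply n _).symm
  have hgc : Continuous (f ∘ (φ (X := X))^[n]) :=
    hf.cont.comp ((φ (X := X)).continuous.iterate n)
  have hge : ∀ x, (f ∘ (φ (X := X))^[n]) (φ x) = φ ((f ∘ (φ (X := X))^[n]) x) := fun x => by
    simp only [Function.comp_apply]
    rw [hit, hit, hf.equivariant]
    exact (Function.Commute.iterate_self (φ (X := Y)) n) (f x)
  have hd' : ∀ a ∈ F'.carrier, ∀ b ∈ F.carrier, dist a b ≤ ε Y := fun a ha b hb => by
    rw [dist_comm]; exact hd b hb a ha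
  -- Points are paired if they are unstably equivalent and their images in F and F' are locally
  -- unstably equivalent. Partners exist in both directions because f∘φ^n is u-bijective.
  refine sum_eq_of_pairing (hgu.cOpen_preimage hgc hge F.cOpen)
    (hgu.cOpen_preimage hgc hge F'.cOpen) (fun e e' => e' ∈ unstableSet e ∧
      br (f ((φ (X := X))^[n] e)) (f ((φ (X := X))^[n] e')) = f ((φ (X := X))^[n] e))
    ?_ ?_ ?_ ?_ ?_ hs ht
  · intro e he
    obtain ⟨b, hb, hbr⟩ := exists_br_eq hd h1 he
    obtain ⟨e', he', rfl⟩ := (hgu e).surjOn (mem_unstableSet_of_br (hd _ he _ hb)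
      (br_eq_of_br_right (hd _ he _ hb) hbr))
    exact ⟨e', hb, he', hbr⟩
  · intro e' he'
    obtain ⟨b, hb, hbr⟩ := exists_br_eq hd' h2 he'
    obtain ⟨e, he, rfl⟩ := (hgu e').surjOn (mem_unstableSet_of_br (hd' _ he' _ hb)
      (br_eq_of_br_right (hd' _ he' _ hb) hbr))
    exact ⟨e, hb, mem_unstableSet_symm he, br_eq_of_br_right (hd' _ he' _ hb) hbr⟩
  · rintro e he e' he' ⟨hT, hbr⟩
    refine hκδ _ _ (hlift _ _ hT ?_ ?_).1
    · rw [hinv e, hinv e']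
      refine (backward_close (hd _ he _ he') hbr n).1.trans (le_of_lt ?_)
      refine lt_of_le_of_lt ?_ (hn₀ n hn)
      exact mul_le_mul_of_nonneg_left (hd _ he _ he') (pow_nonneg lam_pos.le n)
    · rw [hinv e, hinv e']
      exact (backward_close (hd _ he _ he') hbr n).2
  · rintro e he x hx e' he' x' hx' ⟨hT, hbr⟩ ⟨hTx, hbrx⟩ hex
    refine br_eq_of_pairing hf hu hF' hd he hx he' hx' hT hbr hbrx ?_ hex
    refine hκδ _ _ (hlift _ _ hTx ?_ ?_).1
    · rw [hinv x, hinv x']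
      refine (backward_close (hd _ hx _ hx') hbrx n).1.trans (le_of_lt ?_)
      refine lt_of_le_of_lt ?_ (hn₀ n hn)
      exact mul_le_mul_of_nonneg_left (hd _ hx _ hx') (pow_nonneg lam_pos.le n)
    · rw [hinv x, hinv x']
      exact (backward_close (hd _ hx _ hx') hbrx n).2
  · rintro e he x hx e' he' x' hx' ⟨hT, hbr⟩ ⟨hTx, hbrx⟩ hex
    refine br_eq_of_pairing hf hu hF hd' he' hx' he hx (mem_unstableSet_symm hT)
      (br_eq_of_br_right (hd _ he _ he') hbr) (br_eq_of_br_right (hd _ hx _ hx') hbrx) ?_ hex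
    refine (hκδ _ _ (hlift _ _ hTx ?_ ?_).1).symm
    · rw [hinv x, hinv x']
      refine (backward_close (hd _ hx _ hx') hbrx n).1.trans (le_of_lt ?_)
      refine lt_of_le_of_lt ?_ (hn₀ n hn)
      exact mul_le_mul_of_nonneg_left (hd _ hx _ hx') (pow_nonneg lam_pos.le n)
    · rw [hinv x, hinv x']
      exact (backward_close (hd _ hx _ hx') hbrx n).2

end Coloring

end SmaleSpace

/-! ### Induced maps, and the dimension group as a limit of approximating groups -/

namespace SmaleSpace

variable {X : Type u} [MetricSpace X] [CompactSpace X] [SmaleSpace X]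
variable {Y : Type v} [MetricSpace Y] [CompactSpace Y] [SmaleSpace Y]

theorem disjoint_image_of_injOn {α β : Type*} {f : α → β} {S A B : Set α} (hf : InjOn f S)
    (hA : A ⊆ S) (hB : B ⊆ S) (h : Disjoint A B) : Disjoint (f '' A) (f '' B) := by
  rw [Set.disjoint_left] at h ⊢
  rintro _ ⟨a, ha, rfl⟩ ⟨b, hb, hab⟩
  exact h ha (hf (hB hb) (hA ha) hab ▸ hb)

theorem CO.IsPart.map {f : X → Y} (hs : SBijective f) (hc : Continuous f)
    (he : ∀ x, f (φ x) = φ (f x)) {ι : Type*} {s : Finset ι} {G : ι → CO X} {S : Set X}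
    (h : CO.IsPart s G S) (hinj : InjOn f S) :
    CO.IsPart s (fun i => (G i).map f hs hc he) (f '' S) := by
  refine ⟨fun i hi j hj hij => ?_, ?_⟩
  · exact disjoint_image_of_injOn hinj (h.subset hi) (h.subset hj) (h.1 hi hj hij)
  · simp only [CO.map_carrier]
    rw [← image_iUnion₂, h.2]

/-- The action of the homeomorphism on compact open sets. -/
abbrev CO.shift (E : CO X) : CO X :=
  E.map (φ (X := X)) (sBijective_φ X) (φ (X := X)).continuous fun _ => rfl

/-- The action of the inverse homeomorphism on compact open sets. -/
abbrev CO.unshift (E : CO X) : CO X :=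
  E.map (φ (X := X)).symm (sBijective_φ_symm X) (φ (X := X)).symm.continuous fun _ => by simp

theorem CO.shift_carrier (E : CO X) : E.shift.carrier = φ (X := X) '' E.carrier := rfl

theorem CO.unshift_carrier (E : CO X) : E.unshift.carrier = (φ (X := X)).symm '' E.carrier := rfl

theorem CO.shift_unshift (E : CO X) : E.unshift.shift = E := by
  ext1
  rw [shift_carrier, unshift_carrier, image_image]
  simp

theorem CO.unshift_shift (E : CO X) : E.shift.unshift = E := by
  ext1
  rw [unshift_carrier, shift_carrier, image_image]
  simp

theorem CO.unshift_iterate_carrier (E : CO X) (n : ℕ) :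
    (CO.unshift^[n] E).carrier = (φ (X := X))^[n] ⁻¹' E.carrier := by
  induction n with
  | zero => rfl
  | succ n ih =>
    rw [Function.iterate_succ_apply', unshift_carrier, ih, Function.iterate_succ, preimage_comp,
      Homeomorph.image_symm]

theorem CO.shift_iterate_carrier (E : CO X) (n : ℕ) :
    (CO.shift^[n] E).carrier = (φ (X := X))^[n] '' E.carrier := by
  induction n with
  | zero => exact (image_id _).symm
  | succ n ih =>
    rw [Function.iterate_succ_apply', shift_carrier, ih, Function.iterate_succ', image_comp]

theorem CO.map_shift {f : X → Y} (hs : SBijective f) (hc : Continuous f)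
    (he : ∀ x, f (φ x) = φ (f x)) (E : CO X) :
    (E.shift).map f hs hc he = (E.map f hs hc he).shift := by
  ext1
  simp only [map_carrier, image_image, he]

theorem CO.map_unshift {f : X → Y} (hs : SBijective f) (hc : Continuous f)
    (he : ∀ x, f (φ x) = φ (f x)) (E : CO X) :
    (E.unshift).map f hs hc he = (E.map f hs hc he).unshift := by
  ext1
  simp only [map_carrier, image_image, map_symm he]

theorem CO.map_unshift_iterate {f : X → Y} (hs : SBijective f) (hc : Continuous f)
    (he : ∀ x, f (φ x) = φ (f x)) (n : ℕ) (E : CO X) :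
    (CO.unshift^[n] E).map f hs hc he = CO.unshift^[n] (E.map f hs hc he) :=
  Function.Semiconj.iterate_right (f := fun E : CO X => E.map f hs hc he)
    (CO.map_unshift hs hc he) n E

theorem CO.map_disjoint {f : X → Y} (hs : SBijective f) (hc : Continuous f)
    (he : ∀ x, f (φ x) = φ (f x)) {E F G : CO X} (h : G.carrier = E.carrier ∪ F.carrier)
    (h' : Disjoint E.carrier F.carrier) :
    (G.map f hs hc he).carrier = (E.map f hs hc he).carrier ∪ (F.map f hs hc he).carrier ∧
      Disjoint (E.map f hs hc he).carrier (F.map f hs hc he).carrier := by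
  constructor
  · simp only [map_carrier]
    rw [h, image_union]
  · refine disjoint_image_of_injOn (hs.injOn_CO G) ?_ ?_ h'
    · rw [h]; exact subset_union_left
    · rw [h]; exact subset_union_right

theorem CO.IsAdditive.map {A : Type*} [AddCommGroup A] {χ : CO Y → A} (hχ : CO.IsAdditive χ)
    {f : X → Y} (hs : SBijective f) (hc : Continuous f) (he : ∀ x, f (φ x) = φ (f x)) :
    CO.IsAdditive fun E : CO X => χ (E.map f hs hc he) := fun E F G h h' => by
  obtain ⟨h1, h2⟩ := CO.map_disjoint hs hc he h h'
  exact hχ _ _ _ h1 h2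

namespace D

variable (X) in
/-- The automorphism of the dimension group induced by the homeomorphism. -/
noncomputable def shift : D X ≃+ D X :=
  AddMonoidHom.toAddEquiv
    (D.lift (fun E => D.cls E.shift) (D.cls_additive.map (sBijective_φ X)
      (φ (X := X)).continuous fun _ => rfl)
      (fun E F h => D.cls_rel (CO.Rel.map rfl rfl h)))
    (D.lift (fun E => D.cls E.unshift) (D.cls_additive.map (sBijective_φ_symm X)
        (φ (X := X)).symm.continuous fun _ => by simp)
      (fun E F h => D.cls_rel (CO.Rel.of_map (E' := E) (F' := F)
        (congrArg CO.carrier E.shift_unshift).symm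
        (congrArg CO.carrier F.shift_unshift).symm h)))
    (D.hom_ext fun E => by
      rw [AddMonoidHom.comp_apply, D.lift_cls, D.lift_cls, CO.unshift_shift]; rfl)
    (D.hom_ext fun E => by
      rw [AddMonoidHom.comp_apply, D.lift_cls, D.lift_cls, CO.shift_unshift]; rfl)

@[simp]
theorem shift_cls (E : CO X) : shift X (cls E) = cls E.shift :=
  D.lift_cls (fun E => D.cls E.shift)
    (D.cls_additive.map (sBijective_φ X)
      (φ (X := X)).continuous fun _ => rfl)
    (fun _ _ h => D.cls_rel (CO.Rel.map rfl rfl h)) E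

theorem shift_iterate_cls (E : CO X) (n : ℕ) : (shift X)^[n] (cls E) = cls (CO.shift^[n] E) := by
  induction n with
  | zero => rfl
  | succ n ih => rw [Function.iterate_succ_apply', Function.iterate_succ_apply', ih, shift_cls]

theorem shift_iterate_sum {ι : Type*} (s : Finset ι) (g : ι → D X) (n : ℕ) :
    (shift X)^[n] (∑ i ∈ s, g i) = ∑ i ∈ s, (shift X)^[n] (g i) := by
  induction n with
  | zero => rfl
  | succ n ih =>
    rw [Function.iterate_succ_apply', ih, map_sum]
    simp only [Function.iterate_succ_apply']

/-- The map induced by a covariant map of compact open sets is well defined. -/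
theorem exists_pushforward {f : X → Y} (hf : IsScaleMap f) (hs : SBijective f) :
    ∃ p : D X →+ D Y, ∀ E, p (cls E) = cls (E.map f hs hf.cont hf.equivariant) := by
  refine ⟨D.lift (fun E => cls (E.map f hs hf.cont hf.equivariant)) (D.cls_additive.map hs _ _)
    (fun E F h => D.cls_rel ?_), fun E => by simp⟩
  · have hbr : ∀ (E F : CO X), (∀ a ∈ E.carrier, ∀ b ∈ F.carrier, dist a b ≤ ε X) →
        image2 br (f '' E.carrier) (f '' F.carrier) = f '' (image2 br E.carrier F.carrier) := by
      intro E F hd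
      rw [image_image2, image2_image_left, image2_image_right]
      exact image2_congr fun a ha b hb => (hf.map_br a b (hd a ha b hb)).symm
    have hloc : ∀ (E : CO X) e, E.carrier ⊆ localStable e (ε X / 2) →
        f '' E.carrier ⊆ localStable (f e) (ε Y / 2) := by
      rintro E e h _ ⟨a, ha, rfl⟩
      have h1 := (h ha).1
      refine ⟨(hf.dist_le _ _).trans_lt (hf.ε_eq ▸ h1), ?_⟩
      rw [← hf.map_br, (h ha).2]
      rw [dist_comm]; linarith [ε_pos (X := X)]
    -- The map preserves the scale ε and the brackets at that scale, so each generating relation is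
    -- carried directly to a generating relation, with no shift of time.
    induction h with
    | refl => exact .refl _
    | symm _ ih => exact ih.symm
    | trans _ _ ih ih' => exact ih.trans ih'
    | bracket e f' hE hF hd hEF hFE =>
      refine .bracket (f e) (f f') (hloc _ _ hE) (hloc _ _ hF) ?_ ?_ ?_
      · rintro _ ⟨a, ha, rfl⟩ _ ⟨b, hb, rfl⟩
        exact (hf.dist_le _ _).trans ((hd a ha b hb).trans hf.ε_eq.le)
      · simp only [CO.map_carrier]
        rw [hbr _ _ hd, hEF]
      · simp only [CO.map_carrier]
        rw [hbr _ _ (fun a ha b hb => by rw [dist_comm]; exact hd b hb a ha), hFE]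
    | map hE hF _ ih =>
      refine .map ?_ ?_ ih
      · simp only [CO.map_carrier, hE, image_image, hf.equivariant]
      · simp only [CO.map_carrier, hF, image_image, hf.equivariant]
    | of_map hE hF _ ih =>
      refine .of_map ?_ ?_ ih
      · simp only [CO.map_carrier, hE, image_image, hf.equivariant]
      · simp only [CO.map_carrier, hF, image_image, hf.equivariant]

end D

namespace Coloring

variable {V : Type*} (κ : Coloring X V)

/-- The map from the approximating group to the dimension group. -/
noncomputable def toD : κ.Grp →+ D X :=
  κ.lift D.cls D.cls_additive fun _ _ h => D.cls_rel h.rel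

@[simp]
theorem toD_cls (E : CO X) : κ.toD (κ.cls E) = D.cls E := by simp [toD]

theorem shift_toD_sum {n : ℕ} {s : Finset (CO X)} :
    (D.shift X)^[n] (κ.toD (∑ E ∈ s, κ.cls E)) = ∑ E ∈ s, D.cls (CO.shift^[n] E) := by
  rw [map_sum, D.shift_iterate_sum]
  exact Finset.sum_congr rfl fun E _ => by rw [toD_cls, D.shift_iterate_cls]

theorem isPart_shift {n : ℕ} {s : Finset (CO X)} {A : Set X}
    (h : IsCOPartition s ((φ (X := X))^[n] ⁻¹' A)) : CO.IsPart s (CO.shift^[n]) A := by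
  have hinj : Function.Injective ((φ (X := X))^[n]) := (φ (X := X)).injective.iterate n
  have hsurj : Function.Surjective ((φ (X := X))^[n]) := (φ (X := X)).surjective.iterate n
  refine ⟨fun E hE F hF hEF => ?_, ?_⟩
  · rw [Function.onFun, CO.shift_iterate_carrier, CO.shift_iterate_carrier,
      disjoint_image_iff hinj]
    exact h.1 hE hF hEF
  · simp only [CO.shift_iterate_carrier]
    rw [← image_iUnion₂, h.2, image_preimage_eq _ hsurj]

/-- `u`-bijective maps induce contravariant maps of dimension groups. -/
theorem exists_pullback (κ : Coloring X V) {f : X → Y} (hf : IsScaleMap f) (hu : UBijective f) :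
    ∃ q : D Y →+ D X, IsPullback f q := by
  choose s hs using fun F : CO Y =>
    (hu.cOpen_preimage hf.cont hf.equivariant F.cOpen).exists_partition
  let χ : CO Y → D X := fun F => ∑ E ∈ s F, D.cls E
  have hχ : ∀ (F : CO Y) {ι : Type (max u v)} (t : Finset ι) (G : ι → CO X),
      CO.IsPart t G (f ⁻¹' F.carrier) → χ F = ∑ i ∈ t, D.cls (G i) := fun F _ t G h =>
    D.cls_additive.sum_eq_sum (CO.isPart_iff.2 (hs F)) h
  have hχ' : ∀ (F : CO Y) (t : Finset (CO X)) (G : CO X → CO X),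
      CO.IsPart t G (f ⁻¹' F.carrier) → χ F = ∑ i ∈ t, D.cls (G i) := fun F t G h =>
    D.cls_additive.sum_eq_sum (CO.isPart_iff.2 (hs F)) h
  have hadd : CO.IsAdditive χ := by
    intro E F G h h'
    have := (CO.isPart_iff.2 (hs E)).disjSum (CO.isPart_iff.2 (hs F)) (h'.preimage f)
    rw [← preimage_union, ← h] at this
    change (∑ E ∈ s G, D.cls (id E)) = _
    rw [D.cls_additive.sum_eq_sum (CO.isPart_iff.2 (hs G)) this, Finset.sum_disjSum]
    rfl
  -- Compatibility with the homeomorphism allows the bracket relation to be tested after passing to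
  -- φ^{-n}.
  have hshift : ∀ E E' : CO Y, E'.carrier = φ (X := Y) '' E.carrier →
      χ E' = D.shift X (χ E) := by
    intro E E' h
    have h1 := (CO.isPart_iff.2 (hs E)).map (sBijective_φ X) (φ (X := X)).continuous
      (fun _ => rfl) (φ (X := X)).injective.injOn
    have h2 : φ (X := X) '' (f ⁻¹' E.carrier) = f ⁻¹' E'.carrier := by
      rw [h, Homeomorph.image_eq_preimage_symm, Homeomorph.image_eq_preimage_symm,
        ← preimage_comp, ← preimage_comp]
      congr 1
      funext x
      exact map_symm hf.equivariant x
    rw [h2] at h1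
    rw [hχ' _ _ _ h1, map_sum]
    exact Finset.sum_congr rfl fun E _ => (D.shift_cls E).symm
  obtain ⟨n, hn⟩ := κ.exists_sum_cls_eq hf hu
  have hrel : ∀ E F, CO.Rel E F → χ E = χ F := by
    intro E F h
    induction h with
    | refl => rfl
    | symm _ ih => exact ih.symm
    | trans _ _ ih ih' => exact ih.trans ih'
    | @bracket E F e₀ f₀ hE hF hd hEF hFE =>
      have hgu : UBijective (f ∘ (φ (X := X))^[n]) := hu.comp (uBijective_φ_iterate X n)
      have hgc : Continuous (f ∘ (φ (X := X))^[n]) :=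
        hf.cont.comp ((φ (X := X)).continuous.iterate n)
      have hge : ∀ x, (f ∘ (φ (X := X))^[n]) (φ x) = φ ((f ∘ (φ (X := X))^[n]) x) := fun x => by
        simp only [Function.comp_apply]
        rw [← hf.equivariant, Function.Commute.iterate_self (φ (X := X)) n x]
      obtain ⟨a, ha⟩ := (hgu.cOpen_preimage hgc hge E.cOpen).exists_partition
      obtain ⟨b, hb⟩ := (hgu.cOpen_preimage hgc hge F.cOpen).exists_partition
      -- The classes agree in the approximating group for preimages under f∘φ^n, that is, for φ^{-n}
      -- of the preimages under f. Mapping to the dimension group and applying φ^n returns to the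
      -- latter.
      have h := hn n le_rfl E F e₀ f₀ hE hF hd hEF hFE a b ha hb
      have h' := congrArg (fun z => (D.shift X)^[n] (κ.toD z)) h
      simp only [shift_toD_sum] at h'
      rw [hχ' E a _ (isPart_shift ha), hχ' F b _ (isPart_shift hb), h']
    | map hE hF _ ih => rw [hshift _ _ hE, hshift _ _ hF, ih]
    | of_map hE hF _ ih =>
      rw [hshift _ _ hE, hshift _ _ hF] at ih
      exact (D.shift X).injective ih
  exact ⟨D.lift χ hadd hrel, fun F => ⟨⟨s F, hs F⟩, fun t ht => by
    rw [D.lift_cls]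
    exact hχ' F t id (CO.isPart_iff.2 ht)⟩⟩

/-- The class of `φ^{-n} E` in the approximating group. -/
noncomputable def approx (n : ℕ) : FreeAbelianGroup (CO X) →+ κ.Grp :=
  FreeAbelianGroup.lift fun E => κ.cls (CO.unshift^[n] E)

@[simp]
theorem approx_of (n : ℕ) (E : CO X) :
    κ.approx n (FreeAbelianGroup.of E) = κ.cls (CO.unshift^[n] E) :=
  FreeAbelianGroup.lift_apply_of _ _

end Coloring

variable (X) in
/-- The canonical map onto the dimension group. -/
noncomputable def freeToD : FreeAbelianGroup (CO X) →+ D X := FreeAbelianGroup.lift D.cls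

@[simp]
theorem freeToD_of (E : CO X) : freeToD X (FreeAbelianGroup.of E) = D.cls E :=
  FreeAbelianGroup.lift_apply_of _ _

variable (X) in
theorem freeToD_surjective : Function.Surjective (freeToD X) := by
  intro a
  have h : (QuotientAddGroup.mk' (freeToD X).range) = 0 :=
    D.hom_ext fun E => (QuotientAddGroup.eq_zero_iff _).2 ⟨FreeAbelianGroup.of E, freeToD_of E⟩
  exact (QuotientAddGroup.eq_zero_iff a).1 (DFunLike.congr_fun h a)

namespace Coloring

variable {V : Type*} (κ : Coloring X V)

theorem shift_toD_approx (n : ℕ) (x : FreeAbelianGroup (CO X)) :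
    (D.shift X)^[n] (κ.toD (κ.approx n x)) = freeToD X x := by
  induction x using FreeAbelianGroup.induction_on with
  | zero => simp only [map_zero, iterate_map_zero]
  | of E =>
    rw [approx_of, toD_cls, D.shift_iterate_cls, freeToD_of]
    exact congrArg D.cls (Function.LeftInverse.iterate CO.shift_unshift n E)
  | neg E ih => rw [map_neg, map_neg, iterate_map_neg, ih, map_neg]
  | add x y hx hy => rw [map_add, map_add, iterate_map_add, hx, hy, map_add]

/-- The formal sums that eventually vanish form a subgroup, and the quotient by it satisfies every
relation of the dimension group. Hence the quotient map factors through the dimension group. The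
bracket relation is the contraction argument of `exists_sum_cls_eq` for the identity map. -/
theorem exists_approx_eq_zero {x : FreeAbelianGroup (CO X)} (hx : freeToD X x = 0) :
    ∃ n₀, ∀ n ≥ n₀, κ.approx n x = 0 := by
  let N : AddSubgroup (FreeAbelianGroup (CO X)) :=
    { carrier := {x | ∃ n₀, ∀ n ≥ n₀, κ.approx n x = 0}
      zero_mem' := ⟨0, by simp⟩
      add_mem' := by
        rintro a b ⟨n, hn⟩ ⟨m, hm⟩
        exact ⟨max n m, fun k hk => by
          rw [map_add, hn k ((le_max_left _ _).trans hk), hm k ((le_max_right _ _).trans hk),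
            add_zero]⟩
      neg_mem' := by
        rintro a ⟨n, hn⟩
        exact ⟨n, fun k hk => by rw [map_neg, hn k hk, neg_zero]⟩ }
  let χ : CO X → FreeAbelianGroup (CO X) ⧸ N := fun E =>
    QuotientAddGroup.mk (FreeAbelianGroup.of E)
  have hadd : CO.IsAdditive χ := by
    intro E F G h h'
    rw [← sub_eq_zero, ← sub_sub]
    refine (QuotientAddGroup.eq_zero_iff _).2 ⟨0, fun n _ => ?_⟩
    rw [map_sub, map_sub, approx_of, approx_of, approx_of,
      cls_additive (CO.unshift^[n] E) (CO.unshift^[n] F) (CO.unshift^[n] G)]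
    · abel
    · simp only [CO.unshift_iterate_carrier, h, preimage_union]
    · simp only [CO.unshift_iterate_carrier]
      exact h'.preimage _
  have hiff : ∀ E F, χ E = χ F ↔
      ∃ n₀, ∀ n ≥ n₀, κ.cls (CO.unshift^[n] E) = κ.cls (CO.unshift^[n] F) := by
    intro E F
    rw [← sub_eq_zero]
    refine (QuotientAddGroup.eq_zero_iff (N := N) _).trans ?_
    change (∃ n₀, ∀ n ≥ n₀, κ.approx n (FreeAbelianGroup.of E - FreeAbelianGroup.of F) = 0) ↔ _
    simp only [map_sub, approx_of, sub_eq_zero]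
  have hsh : ∀ E E' : CO X, E'.carrier = φ (X := X) '' E.carrier → E' = E.shift :=
    fun E E' h => CO.ext h
  obtain ⟨n₀, hn₀⟩ := κ.exists_sum_cls_eq IsScaleMap.id UBijective.id
  have hrel : ∀ E F, CO.Rel E F → χ E = χ F := by
    intro E F h
    induction h with
    | refl => rfl
    | symm _ ih => exact ih.symm
    | trans _ _ ih ih' => exact ih.trans ih'
    | @bracket E F e₀ f₀ hE hF hd hEF hFE =>
      refine (hiff _ _).2 ⟨n₀, fun n hn => ?_⟩
      have h := hn₀ n hn E F e₀ f₀ hE hF hd hEF hFE {CO.unshift^[n] E} {CO.unshift^[n] F} ?_ ?_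
      · simpa using h
      · exact ⟨by simp, by simp [CO.unshift_iterate_carrier]⟩
      · exact ⟨by simp, by simp [CO.unshift_iterate_carrier]⟩
    -- Adding or removing one application of φ only shifts the threshold by one. This is why the
    -- condition is eventual vanishing, not vanishing at a fixed n.
    | map hE hF _ ih =>
      obtain ⟨n₁, h⟩ := (hiff _ _).1 ih
      refine (hiff _ _).2 ⟨n₁ + 1, fun n hn => ?_⟩
      obtain ⟨m, rfl⟩ := Nat.exists_eq_add_of_le' hn
      rw [hsh _ _ hE, hsh _ _ hF, ← add_assoc, Function.iterate_succ_apply,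
        Function.iterate_succ_apply, CO.unshift_shift, CO.unshift_shift]
      exact h _ (by omega)
    | of_map hE hF _ ih =>
      obtain ⟨n₁, h⟩ := (hiff _ _).1 ih
      refine (hiff _ _).2 ⟨n₁, fun n hn => ?_⟩
      have := h (n + 1) (by omega)
      rwa [hsh _ _ hE, hsh _ _ hF, Function.iterate_succ_apply,
        Function.iterate_succ_apply, CO.unshift_shift, CO.unshift_shift] at this
  have hcomp : (D.lift χ hadd hrel).comp (freeToD X) = QuotientAddGroup.mk' N :=
    FreeAbelianGroup.lift_ext _ _ fun E => by
      rw [AddMonoidHom.comp_apply, freeToD_of, D.lift_cls]; rfl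
  have := DFunLike.congr_fun hcomp x
  rw [AddMonoidHom.comp_apply, hx, map_zero] at this
  exact (QuotientAddGroup.eq_zero_iff (N := N) x).1 this.symm

end Coloring

end SmaleSpace

/-! ### Symmetric simplicial abelian groups -/

/-- The indices are split at i: those above i are written as successors of k ≥ i, and those at most
i as casts of k ≤ i. This prepares the cancellation in an alternating double sum. -/
theorem Fin.sum_univ_eq_sum_ite {G : Type*} [AddCommGroup G] {n : ℕ} (i : Fin (n + 1))
    (f : Fin (n + 2) → G) :
    ∑ j, f j = ∑ k, ((if i ≤ k then f k.succ else 0) + if k ≤ i then f k.castSucc else 0) := by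
  rw [Fin.sum_univ_succAbove f i.castSucc]
  have : f i.castSucc = ∑ k, if k = i then f k.castSucc else 0 := by simp
  rw [this, ← Finset.sum_add_distrib]
  refine Finset.sum_congr rfl fun k _ => ?_
  rcases lt_trichotomy k i with h | rfl | h
  · rw [Fin.succAbove_of_castSucc_lt _ _ (by simpa using h)]
    simp [h.ne, h.le, not_le.2 h]
  · rw [Fin.succAbove_of_le_castSucc _ _ le_rfl]
    simp [add_comm]
  · rw [Fin.succAbove_of_le_castSucc _ _ (by simpa using h.le)]
    simp [h.ne', h.le, not_le.2 h]

theorem Fin.succ_succAbove_succAbove_of_le {n : ℕ} {i j : Fin (n + 2)} (H : i ≤ j)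
    (k : Fin (n + 1)) :
    j.succ.succAbove (i.succAbove k) = i.castSucc.succAbove (j.succAbove k) := by
  ext
  rw [Fin.le_def] at H
  simp only [Fin.succAbove, Fin.lt_def]
  split_ifs <;> simp_all <;> omega

/-- The terms (i, j+1) and (j, i), for i ≤ j, are equal and carry opposite signs. The same
cancellation serves the boundary and the coboundary. -/
theorem sum_sum_alternating_eq_zero {G : Type*} [AddCommGroup G] {n : ℕ}
    (u : Fin (n + 2) → Fin (n + 3) → G)
    (h : ∀ i j : Fin (n + 2), i ≤ j → u i j.succ = u j i.castSucc) :
    ∑ i : Fin (n + 2), ∑ j : Fin (n + 3), ((-1 : ℤ) ^ ((i : ℕ) + (j : ℕ))) • u i j = 0 := by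
  rw [Finset.sum_congr rfl fun i _ => Fin.sum_univ_eq_sum_ite i
    fun j => ((-1 : ℤ) ^ ((i : ℕ) + (j : ℕ))) • u i j]
  simp_rw [Finset.sum_add_distrib]
  rw [Finset.sum_comm (f := fun i k : Fin (n + 2) => if k ≤ i then
    ((-1 : ℤ) ^ ((i : ℕ) + (k.castSucc : ℕ))) • u i k.castSucc else 0),
    ← Finset.sum_add_distrib]
  refine Finset.sum_eq_zero fun i _ => ?_
  rw [← Finset.sum_add_distrib]
  refine Finset.sum_eq_zero fun j _ => ?_
  split_ifs with hij
  · rw [h i j hij, ← add_smul]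
    simp only [Fin.val_succ, Fin.val_castSucc]
    rw [← add_assoc, pow_succ, add_comm (j : ℕ)]
    simp
  · simp

/-- Composing `α` with the cycles that move i and α i to position 0 gives a permutation fixing 0,
whose restriction is β. The two cycles have signs (−1)^i and (−1)^(α i). -/
theorem Equiv.Perm.exists_succAbove {n : ℕ} (α : Equiv.Perm (Fin (n + 1))) (i : Fin (n + 1)) :
    ∃ β : Equiv.Perm (Fin n), (∀ k, α (i.succAbove k) = (α i).succAbove (β k)) ∧
      (Equiv.Perm.sign β : ℤ) = (-1) ^ ((i : ℕ) + (α i : ℕ)) * Equiv.Perm.sign α := by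
  set γ : Equiv.Perm (Fin (n + 1)) := (α i).cycleRange * α * i.cycleRange⁻¹ with hγ
  obtain ⟨⟨p, β⟩, hβ⟩ := Equiv.Perm.decomposeFin.symm.surjective γ
  have h0 : γ 0 = 0 := by
    simp only [hγ, Equiv.Perm.mul_apply, Equiv.Perm.inv_def, Fin.cycleRange_symm_zero]
    exact Fin.cycleRange_self _
  have hp : p = 0 := by
    rw [← hβ, Equiv.Perm.decomposeFin_symm_apply_zero] at h0
    exact h0
  subst hp
  refine ⟨β, fun k => ?_, ?_⟩
  · have h1 : γ k.succ = (β k).succ := by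
      rw [← hβ, Equiv.Perm.decomposeFin_symm_apply_succ]
      simp
    simp only [hγ, Equiv.Perm.mul_apply, Equiv.Perm.inv_def] at h1
    rw [Fin.cycleRange_symm_succ] at h1
    rw [← Fin.cycleRange_symm_succ (α i), ← h1, Equiv.symm_apply_apply]
  · have h1 : Equiv.Perm.sign γ = Equiv.Perm.sign β := by
      rw [← hβ, Equiv.Perm.decomposeFin.symm_sign]; simp
    rw [← h1, hγ]
    simp only [Equiv.Perm.sign_mul, Equiv.Perm.sign_inv, Fin.sign_cycleRange]
    push_cast
    rw [pow_add]; ring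

/-- A contravariant functor from the nonempty finite sets `{0, …, L}` to abelian groups. -/
structure SymAb (A : ℕ → Type u) [∀ L, AddCommGroup (A L)] where
  map : ∀ {K L : ℕ}, (Fin (K + 1) → Fin (L + 1)) → (A L →+ A K)
  map_id : ∀ {L : ℕ} (a : A L), map id a = a
  map_comp : ∀ {J K L : ℕ} (θ : Fin (K + 1) → Fin (L + 1)) (η : Fin (J + 1) → Fin (K + 1))
    (a : A L), map (θ ∘ η) a = map η (map θ a)

namespace SymAb

variable {A : ℕ → Type u} [∀ L, AddCommGroup (A L)] (𝒜 : SymAb A)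

/-- The alternating sum of the face maps. -/
def bdry (L : ℕ) : A (L + 1) →+ A L :=
  ∑ l : Fin (L + 2), ((-1 : ℤ) ^ (l : ℕ)) • 𝒜.map l.succAbove

theorem bdry_apply (L : ℕ) (a : A (L + 1)) :
    𝒜.bdry L a = ∑ l : Fin (L + 2), ((-1 : ℤ) ^ (l : ℕ)) • 𝒜.map l.succAbove a := by
  simp [bdry]

theorem bdry_bdry (L : ℕ) (a : A (L + 2)) : 𝒜.bdry L (𝒜.bdry (L + 1) a) = 0 := by
  have := sum_sum_alternating_eq_zero (n := L)
    (fun i j => 𝒜.map i.succAbove (𝒜.map j.succAbove a)) (fun i j hij => by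
      rw [← 𝒜.map_comp, ← 𝒜.map_comp]
      congr 2
      funext k
      exact Fin.succ_succAbove_succAbove_of_le hij k)
  rw [bdry_apply, bdry_apply, ← this]
  simp only [map_sum, map_zsmul, Finset.smul_sum, smul_smul, ← pow_add]

/-- The subgroup generated by degenerate elements and by all `α a - sgn(α) a`. -/
def deg (L : ℕ) : AddSubgroup (A L) :=
  AddSubgroup.closure
    ({x | ∃ (K : ℕ) (θ : Fin (L + 1) → Fin (K + 1)) (b : A K), ¬ Function.Injective θ ∧
      x = 𝒜.map θ b} ∪
    {x | ∃ (α : Equiv.Perm (Fin (L + 1))) (a : A L),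
      x = 𝒜.map α a - (Equiv.Perm.sign α : ℤ) • a})

variable {𝒜}

theorem map_mem_deg {K L : ℕ} {θ : Fin (L + 1) → Fin (K + 1)} (hθ : ¬ Function.Injective θ)
    (b : A K) : 𝒜.map θ b ∈ 𝒜.deg L :=
  AddSubgroup.subset_closure (Or.inl ⟨K, θ, b, hθ, rfl⟩)

theorem map_perm_sub_mem_deg {L : ℕ} (α : Equiv.Perm (Fin (L + 1))) (a : A L) :
    𝒜.map α a - (Equiv.Perm.sign α : ℤ) • a ∈ 𝒜.deg L :=
  AddSubgroup.subset_closure (Or.inr ⟨α, a, rfl⟩)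

variable (𝒜) in
-- Every map out of a one-point set is injective, and the symmetric group on one point is trivial.
theorem deg_zero : 𝒜.deg 0 = ⊥ := by
  rw [deg, AddSubgroup.closure_eq_bot_iff]
  have : Subsingleton (Fin (0 + 1)) := inferInstanceAs (Subsingleton (Fin 1))
  rintro _ (⟨K, θ, b, hθ, rfl⟩ | ⟨α, a, rfl⟩)
  · exact (hθ (Function.injective_of_subsingleton θ)).elim
  · have : α = 1 := Subsingleton.elim _ _
    subst this
    have := 𝒜.map_id a
    simp only [Equiv.Perm.sign_one, Units.val_one, one_smul, mem_singleton_iff]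
    rw [sub_eq_zero]
    exact this

/-- If θ i = θ j, every face other than the i-th and j-th still comes from a non-injective map.
Those two differ by a permutation of sign −(−1)^(i+j), so their signed sum has the form βx − sgn(β)x
up to sign. For αa − sgn(α)a, the faces are matched through α and compared one by one by the induced
permutations. -/
theorem bdry_mem_deg {L : ℕ} {a : A (L + 1)} (ha : a ∈ 𝒜.deg (L + 1)) :
    𝒜.bdry L a ∈ 𝒜.deg L := by
  suffices h : 𝒜.deg (L + 1) ≤ (𝒜.deg L).comap (𝒜.bdry L) from h ha
  rw [deg, AddSubgroup.closure_le]
  rintro _ (⟨K, θ, b, hθ, rfl⟩ | ⟨α, a, rfl⟩)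
  · obtain ⟨i, j, hij, hne⟩ := Function.not_injective_iff.1 hθ
    rw [SetLike.mem_coe, AddSubgroup.mem_comap, bdry_apply]
    simp only [← 𝒜.map_comp]
    rw [← Finset.add_sum_erase _ _ (Finset.mem_univ i),
      ← Finset.add_sum_erase _ _ (show j ∈ Finset.univ.erase i by simp [hne.symm]), ← add_assoc]
    refine add_mem ?_ (sum_mem fun k hk => ?_)
    · obtain ⟨β, hβ, hs⟩ := (Equiv.swap i j).exists_succAbove i
      simp only [Equiv.swap_apply_left] at hβ hs
      have h1 : θ ∘ i.succAbove = (θ ∘ j.succAbove) ∘ β := by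
        funext k
        simp only [Function.comp_apply]
        rw [← hβ k]
        by_cases h : i.succAbove k = j
        · rw [h, Equiv.swap_apply_right, hij]
        · rw [Equiv.swap_apply_of_ne_of_ne (Fin.succAbove_ne i k) h]
      rw [h1, 𝒜.map_comp]
      have h2 := map_perm_sub_mem_deg (𝒜 := 𝒜) β (𝒜.map (θ ∘ j.succAbove) b)
      have h3 := AddSubgroup.zsmul_mem _ h2 ((-1 : ℤ) ^ (i : ℕ))
      rw [hs, Equiv.Perm.sign_swap hne, smul_sub, smul_smul] at h3
      convert! h3 using 1
      rw [sub_eq_add_neg, ← neg_smul]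
      congr 2
      rw [pow_add]
      push_cast
      have : ((-1 : ℤ) ^ (i : ℕ)) * (-1) ^ (i : ℕ) = 1 := by
        rw [← mul_pow]; simp
      linear_combination (-(-1 : ℤ) ^ (j : ℕ)) * this
    · refine AddSubgroup.zsmul_mem _ (map_mem_deg (fun hinj => hne ?_) b) _
      simp only [Finset.mem_erase, Finset.mem_univ, and_true] at hk
      obtain ⟨i', hi'⟩ := Fin.exists_succAbove_eq hk.2.symm
      obtain ⟨j', hj'⟩ := Fin.exists_succAbove_eq hk.1.symm
      rw [← hi', ← hj', hinj (a₁ := i') (a₂ := j') (by simp [hi', hj', hij])]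
  · choose β hβ hs using α.exists_succAbove
    rw [SetLike.mem_coe, AddSubgroup.mem_comap, map_sub, map_zsmul, bdry_apply, bdry_apply,
      ← Equiv.sum_comp α
      (fun l => ((-1 : ℤ) ^ (l : ℕ)) • 𝒜.map l.succAbove a), Finset.smul_sum,
      ← Finset.sum_sub_distrib]
    refine sum_mem fun i _ => ?_
    have h1 : (α : Fin (L + 2) → Fin (L + 2)) ∘ i.succAbove = (α i).succAbove ∘ β i :=
      funext (hβ i)
    rw [← 𝒜.map_comp, h1, 𝒜.map_comp]
    have h3 := AddSubgroup.zsmul_mem _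
      (map_perm_sub_mem_deg (𝒜 := 𝒜) (β i) (𝒜.map (α i).succAbove a)) ((-1 : ℤ) ^ (i : ℕ))
    rw [hs, smul_sub, smul_smul] at h3
    convert! h3 using 2
    rw [smul_smul]
    congr 1
    rw [pow_add]
    have : ((-1 : ℤ) ^ (i : ℕ)) * (-1) ^ (i : ℕ) = 1 := by
      rw [← mul_pow]; simp
    linear_combination (-(-1 : ℤ) ^ (α i : ℕ) * (Equiv.Perm.sign α : ℤ)) * this

section Hom

variable {B : ℕ → Type v} [∀ L, AddCommGroup (B L)] {ℬ : SymAb B}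

variable (𝒜 ℬ) in
/-- Compatibility of a family of homomorphisms with the structure maps. -/
def IsHom (f : ∀ L, A L →+ B L) : Prop :=
  ∀ ⦃K L : ℕ⦄ (θ : Fin (K + 1) → Fin (L + 1)) (a : A L), f K (𝒜.map θ a) = ℬ.map θ (f L a)

theorem IsHom.bdry {f : ∀ L, A L →+ B L} (hf : IsHom 𝒜 ℬ f) (L : ℕ) (a : A (L + 1)) :
    f L (𝒜.bdry L a) = ℬ.bdry L (f (L + 1) a) := by
  simp only [bdry_apply, map_sum, map_zsmul, hf _ a]

theorem IsHom.mem_deg {f : ∀ L, A L →+ B L} (hf : IsHom 𝒜 ℬ f) {L : ℕ} {a : A L}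
    (ha : a ∈ 𝒜.deg L) : f L a ∈ ℬ.deg L := by
  suffices h : 𝒜.deg L ≤ (ℬ.deg L).comap (f L) from h ha
  rw [deg, AddSubgroup.closure_le]
  rintro _ (⟨K, θ, b, hθ, rfl⟩ | ⟨α, a, rfl⟩)
  · rw [SetLike.mem_coe, AddSubgroup.mem_comap, hf]
    exact map_mem_deg hθ _
  · rw [SetLike.mem_coe, AddSubgroup.mem_comap, map_sub, map_zsmul, hf]
    exact map_perm_sub_mem_deg α _

/-- Generators of `deg` lift to generators. This allows a degenerate class to be represented by a
degenerate formal sum before passing to the approximating group. -/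
theorem IsHom.exists_mem_deg {f : ∀ L, A L →+ B L} (hf : IsHom 𝒜 ℬ f)
    (hsurj : ∀ L, Function.Surjective (f L)) {L : ℕ} {b : B L} (hb : b ∈ ℬ.deg L) :
    ∃ a ∈ 𝒜.deg L, f L a = b := by
  suffices h : ℬ.deg L ≤ (𝒜.deg L).map (f L) from h hb
  rw [deg, AddSubgroup.closure_le]
  rintro _ (⟨K, θ, b, hθ, rfl⟩ | ⟨α, b, rfl⟩)
  · obtain ⟨a, rfl⟩ := hsurj K b
    exact ⟨_, map_mem_deg hθ a, hf _ _⟩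
  · obtain ⟨a, rfl⟩ := hsurj L b
    exact ⟨_, map_perm_sub_mem_deg α a, by rw [map_sub, map_zsmul, hf]⟩

end Hom

end SymAb

/-! ### Ordered and oriented chains of a simplex -/

namespace OrderedChains

variable (V : Type v)

/-- Ordered chains of the full simplex with vertex set `V`. -/
abbrev Chain (L : ℕ) := FreeAbelianGroup (Fin (L + 1) → V)

/-- The structure maps of the ordered chains. -/
noncomputable def symAb : SymAb (Chain V) where
  map θ := FreeAbelianGroup.lift fun c => FreeAbelianGroup.of (c ∘ θ)
  map_id {L} a := by
    have : FreeAbelianGroup.lift (fun c : Fin (L + 1) → V => FreeAbelianGroup.of (c ∘ id)) =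
        AddMonoidHom.id _ := FreeAbelianGroup.lift_ext _ _ fun c => by
      rw [FreeAbelianGroup.lift_apply_of]; rfl
    exact DFunLike.congr_fun this a
  map_comp {J K L} θ η a := by
    have : FreeAbelianGroup.lift (fun c : Fin (L + 1) → V => FreeAbelianGroup.of (c ∘ θ ∘ η)) =
        (FreeAbelianGroup.lift fun c => FreeAbelianGroup.of (c ∘ η)).comp
          (FreeAbelianGroup.lift fun c => FreeAbelianGroup.of (c ∘ θ)) :=
      FreeAbelianGroup.lift_ext _ _ fun c => by
        simp only [AddMonoidHom.comp_apply, FreeAbelianGroup.lift_apply_of]; rfl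
    exact DFunLike.congr_fun this a

variable {V}

@[simp]
theorem map_of {K L : ℕ} (θ : Fin (K + 1) → Fin (L + 1)) (c : Fin (L + 1) → V) :
    (symAb V).map θ (FreeAbelianGroup.of c) = FreeAbelianGroup.of (c ∘ θ) :=
  FreeAbelianGroup.lift_apply_of _ _

theorem bdry_of {L : ℕ} (c : Fin (L + 2) → V) :
    (symAb V).bdry L (FreeAbelianGroup.of c) =
      ∑ l : Fin (L + 2), ((-1 : ℤ) ^ (l : ℕ)) • FreeAbelianGroup.of (c ∘ l.succAbove) := by
  simp only [SymAb.bdry_apply, map_of]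

/-- The cone with vertex `v`. -/
noncomputable def cone (v : V) (L : ℕ) : Chain V L →+ Chain V (L + 1) :=
  FreeAbelianGroup.lift fun c => FreeAbelianGroup.of (Fin.cons v c : Fin (L + 2) → V)

@[simp]
theorem cone_of (v : V) {L : ℕ} (c : Fin (L + 1) → V) :
    cone v L (FreeAbelianGroup.of c) = FreeAbelianGroup.of (Fin.cons v c : Fin (L + 2) → V) :=
  FreeAbelianGroup.lift_apply_of _ _

theorem cons_comp_zero {L : ℕ} (v : V) (c : Fin (L + 1) → V) :
    (Fin.cons v c : Fin (L + 2) → V) ∘ (0 : Fin (L + 2)).succAbove = c := by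
  funext k
  simp

theorem cons_comp_succ {L : ℕ} (v : V) (c : Fin (L + 2) → V) (i : Fin (L + 2)) :
    (Fin.cons v c : Fin (L + 3) → V) ∘ i.succ.succAbove = Fin.cons v (c ∘ i.succAbove) := by
  funext k
  refine Fin.cases ?_ (fun k => ?_) k <;> simp

theorem bdry_cone (v : V) {L : ℕ} (x : Chain V (L + 1)) :
    (symAb V).bdry (L + 1) (cone v (L + 1) x) = x - cone v L ((symAb V).bdry L x) := by
  have : ((symAb V).bdry (L + 1)).comp (cone v (L + 1)) =
      AddMonoidHom.id _ - (cone v L).comp ((symAb V).bdry L) :=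
    FreeAbelianGroup.lift_ext _ _ fun c => by
      rw [AddMonoidHom.comp_apply, cone_of, bdry_of, AddMonoidHom.sub_apply,
        AddMonoidHom.comp_apply, bdry_of, Fin.sum_univ_succ, cons_comp_zero]
      simp only [cons_comp_succ, map_sum, map_zsmul, cone_of, Fin.val_zero, pow_zero, one_smul,
        Fin.val_succ, pow_succ, mul_neg, mul_one, neg_smul, Finset.sum_neg_distrib]
      rw [← sub_eq_add_neg]; rfl
  exact DFunLike.congr_fun this x

/-- The chains all of whose tuples satisfy `P`. -/
def supported (L : ℕ) (P : (Fin (L + 1) → V) → Prop) : AddSubgroup (Chain V L) :=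
  AddSubgroup.closure (FreeAbelianGroup.of '' {c | P c})

theorem of_mem_supported {L : ℕ} {P : (Fin (L + 1) → V) → Prop} {c : Fin (L + 1) → V}
    (h : P c) : FreeAbelianGroup.of c ∈ supported L P :=
  AddSubgroup.subset_closure ⟨c, h, rfl⟩

theorem supported_le {L : ℕ} {B : Type*} [AddCommGroup B] {P : (Fin (L + 1) → V) → Prop}
    {S : AddSubgroup B} (f : Chain V L →+ B)
    (h : ∀ c, P c → f (FreeAbelianGroup.of c) ∈ S) {x : Chain V L} (hx : x ∈ supported L P) :
    f x ∈ S := by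
  suffices h : supported L P ≤ S.comap f from h hx
  rw [supported, AddSubgroup.closure_le]
  rintro _ ⟨c, hc, rfl⟩
  exact h c hc

theorem supported_mono {L : ℕ} {P Q : (Fin (L + 1) → V) → Prop} (h : ∀ c, P c → Q c) :
    supported L P ≤ supported L Q := fun _ hx =>
  supported_le (AddMonoidHom.id _) (fun c hc => of_mem_supported (h c hc)) hx

variable [LinearOrder V]

/-- The cone with vertex `m`, on tuples whose first entry is larger than `m`. -/
noncomputable def coneLT (m : V) (L : ℕ) : Chain V L →+ Chain V (L + 1) :=
  FreeAbelianGroup.lift fun c =>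
    if m < c 0 then FreeAbelianGroup.of (Fin.cons m c : Fin (L + 2) → V) else 0

theorem coneLT_of (m : V) {L : ℕ} (c : Fin (L + 1) → V) :
    coneLT m L (FreeAbelianGroup.of c) =
      if m < c 0 then FreeAbelianGroup.of (Fin.cons m c : Fin (L + 2) → V) else 0 :=
  FreeAbelianGroup.lift_apply_of _ _

/-- If m < c 0, all faces also begin above m and this is the usual cone formula. If m = c 0, the
cone of c is dropped; the zeroth face, coned, gives back c, and the other faces begin with m and are
dropped. -/
theorem bdry_coneLT_of (m : V) {L : ℕ} {c : Fin (L + 2) → V} (hc : StrictMono c) (hm : m ≤ c 0) :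
    (symAb V).bdry (L + 1) (coneLT m (L + 1) (FreeAbelianGroup.of c)) =
      FreeAbelianGroup.of c - coneLT m L ((symAb V).bdry L (FreeAbelianGroup.of c)) := by
  rcases hm.lt_or_eq with h | h
  · rw [coneLT_of, if_pos h, ← cone_of, bdry_cone, bdry_of]
    congr 1
    simp only [map_sum, map_zsmul, cone_of]
    refine Finset.sum_congr rfl fun i _ => ?_
    rw [coneLT_of, if_pos]
    exact h.trans_le (hc.monotone (Fin.zero_le _))
  · rw [coneLT_of, if_neg h.not_lt, map_zero, bdry_of, Fin.sum_univ_succ, map_add, map_sum,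
      map_zsmul, coneLT_of, if_pos, Finset.sum_eq_zero]
    · rw [eq_comm, sub_eq_zero]
      simp only [Fin.val_zero, pow_zero, one_smul, add_zero]
      congr 1
      funext k
      refine Fin.cases ?_ (fun k => ?_) k
      · simp [h]
      · simp
    · intro i _
      rw [map_zsmul, coneLT_of, if_neg, smul_zero]
      rw [Function.comp_apply, Fin.succ_succAbove_zero, h]
      exact lt_irrefl _
    · rw [h]
      exact hc (by simp)

theorem bdry_coneLT (m : V) {L : ℕ} {x : Chain V (L + 1)}
    (hx : x ∈ supported (L + 1) fun c => StrictMono c ∧ m ≤ c 0) :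
    (symAb V).bdry (L + 1) (coneLT m (L + 1) x) = x - coneLT m L ((symAb V).bdry L x) := by
  have := supported_le (S := ⊥) (((symAb V).bdry (L + 1)).comp (coneLT m (L + 1)) -
      (AddMonoidHom.id _ - (coneLT m L).comp ((symAb V).bdry L))) (fun c hc => by
        simp only [AddMonoidHom.sub_apply, AddMonoidHom.comp_apply, AddSubgroup.mem_bot,
          AddMonoidHom.id_apply]
        rw [bdry_coneLT_of m hc.1 hc.2, sub_self]) hx
  simpa [sub_eq_zero] using this

theorem bdry_coneLT_zero (m : V) {c : Fin 1 → V} (hm : m ≤ c 0) :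
    (symAb V).bdry 0 (coneLT m 0 (FreeAbelianGroup.of c)) =
      FreeAbelianGroup.of c - FreeAbelianGroup.of fun _ => m := by
  rcases hm.lt_or_eq with h | h
  · rw [coneLT_of, if_pos h, bdry_of, Fin.sum_univ_succ, cons_comp_zero]
    simp only [Fin.val_zero, pow_zero, one_smul, Finset.univ_unique, Finset.sum_singleton,
      Fin.val_succ, sub_eq_add_neg]
    congr 1
    simp only [Fin.default_eq_zero, Fin.val_zero, zero_add, pow_one, neg_smul, one_smul]
    congr 2
    funext k
    rw [Fin.fin_one_eq_zero k]
    rfl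
  · rw [coneLT_of, if_neg h.not_lt, map_zero, eq_comm, sub_eq_zero]
    congr 1
    funext k
    rw [Fin.fin_one_eq_zero k, h]

/-- The smallest entry of a tuple. -/
def minEntry {L : ℕ} (c : Fin (L + 1) → V) : V := Finset.univ.inf' Finset.univ_nonempty c

theorem minEntry_le {L : ℕ} (c : Fin (L + 1) → V) (i : Fin (L + 1)) : minEntry c ≤ c i :=
  Finset.inf'_le _ (Finset.mem_univ i)

theorem minEntry_mem {L : ℕ} (c : Fin (L + 1) → V) : minEntry c ∈ range c := by
  obtain ⟨i, -, hi⟩ := Finset.exists_mem_eq_inf' Finset.univ_nonempty c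
  exact ⟨i, hi.symm⟩

theorem minEntry_comp_perm {L : ℕ} (c : Fin (L + 1) → V) (α : Equiv.Perm (Fin (L + 1))) :
    minEntry (c ∘ α) = minEntry c := by
  refine le_antisymm ?_ ?_
  · obtain ⟨i, hi⟩ := minEntry_mem c
    rw [← hi]
    simpa using minEntry_le (c ∘ α) (α.symm i)
  · obtain ⟨i, hi⟩ := minEntry_mem (c ∘ α)
    rw [← hi]
    exact minEntry_le c (α i)

/-- Sorting of ordered chains, with signs; tuples with repetitions are mapped to zero. -/
noncomputable def sort : ∀ L : ℕ, Chain V L →+ Chain V L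
  | 0 => AddMonoidHom.id _
  | L + 1 => FreeAbelianGroup.lift fun c =>
      -- For injective c, sorted faces that still contain the minimum begin with it and are dropped.
      -- Only the face omitting the minimum survives, with its sign, and the minimum is put in
      -- front. The recursive form makes the chain map property an induction.
      coneLT (minEntry c) L (sort L ((symAb V).bdry L (FreeAbelianGroup.of c)))

theorem sort_of {L : ℕ} (c : Fin (L + 2) → V) : sort (L + 1) (FreeAbelianGroup.of c) =
    coneLT (minEntry c) L (sort L ((symAb V).bdry L (FreeAbelianGroup.of c))) :=
  FreeAbelianGroup.lift_apply_of _ _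

theorem sort_mem_supported {L : ℕ} (c : Fin (L + 1) → V) : sort L (FreeAbelianGroup.of c) ∈
    supported L fun c' => StrictMono c' ∧ range c' ⊆ range c := by
  induction L with
  | zero =>
    refine of_mem_supported ⟨?_, subset_rfl⟩
    intro i j hij
    exact absurd hij (by rw [Fin.lt_def]; omega)
  | succ L ih =>
    rw [sort_of]
    refine supported_le (P := fun c' => StrictMono c' ∧ range c' ⊆ range c) _ (fun c' hc' => ?_) ?_
    · rw [coneLT_of]
      split_ifs with h
      · refine of_mem_supported ⟨?_, ?_⟩
        · refine Fin.strictMono_iff_lt_succ.2 fun i => ?_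
          refine Fin.cases ?_ (fun i => ?_) i
          · simpa using h
          · rw [← Fin.succ_castSucc, Fin.cons_succ, Fin.cons_succ]
            exact hc'.1 (by simp)
        · rw [Fin.range_cons]
          exact insert_subset (minEntry_mem c) hc'.2
      · exact zero_mem _
    · rw [bdry_of, map_sum]
      refine sum_mem fun i _ => ?_
      rw [map_zsmul]
      refine AddSubgroup.zsmul_mem _ (supported_mono (fun c' hc' => ?_) (ih _)) _
      exact ⟨hc'.1, hc'.2.trans (range_comp_subset_range _ _)⟩

/-- Sorted faces of c are increasing and begin at or above the minimum, so the cone formula gives ∂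
sort c = sort ∂c − cone(∂ sort ∂c). The last term vanishes by induction and ∂∂ = 0. -/
theorem bdry_sort (L : ℕ) (x : Chain V (L + 1)) :
    (symAb V).bdry L (sort (L + 1) x) = sort L ((symAb V).bdry L x) := by
  suffices h : ((symAb V).bdry L).comp (sort (L + 1)) = (sort L).comp ((symAb V).bdry L) from
    DFunLike.congr_fun h x
  clear x
  refine FreeAbelianGroup.lift_ext _ _ fun c => ?_
  rw [AddMonoidHom.comp_apply, AddMonoidHom.comp_apply, sort_of]
  induction L with
  | zero =>
    change (symAb V).bdry 0 (coneLT _ 0 ((symAb V).bdry 0 _)) = (symAb V).bdry 0 _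
    rw [bdry_of, Fin.sum_univ_two]
    simp only [map_add, map_zsmul]
    rw [bdry_coneLT_zero _ (minEntry_le c _), bdry_coneLT_zero _ (minEntry_le c _)]
    simp
    abel
  | succ L ih =>
    rw [bdry_coneLT]
    · have h : (symAb V).bdry L (sort (L + 1) ((symAb V).bdry (L + 1) (FreeAbelianGroup.of c))) =
          0 := by
        have h' : ((symAb V).bdry L).comp (sort (L + 1)) = (sort L).comp ((symAb V).bdry L) :=
          FreeAbelianGroup.lift_ext _ _ fun c => by
            rw [AddMonoidHom.comp_apply, AddMonoidHom.comp_apply, sort_of]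
            exact ih c
        have h2 := DFunLike.congr_fun h' ((symAb V).bdry (L + 1) (FreeAbelianGroup.of c))
        rw [AddMonoidHom.comp_apply, AddMonoidHom.comp_apply, SymAb.bdry_bdry, map_zero] at h2
        exact h2
      rw [h, map_zero, sub_zero]
    · rw [bdry_of, map_sum]
      refine sum_mem fun i _ => ?_
      rw [map_zsmul]
      refine AddSubgroup.zsmul_mem _ (supported_mono (fun c' hc' => ⟨hc'.1, ?_⟩)
        (sort_mem_supported _)) _
      obtain ⟨j, hj⟩ := hc'.2 (mem_range_self 0)
      rw [← hj]
      exact minEntry_le c _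

/-- The minimum is unchanged, and the faces of c∘α are permuted faces of c. The signs of the induced
permutations combine with those of the boundary to give sgn(α). -/
theorem sort_perm {L : ℕ} (c : Fin (L + 1) → V) (α : Equiv.Perm (Fin (L + 1))) :
    sort L (FreeAbelianGroup.of (c ∘ α)) =
      (Equiv.Perm.sign α : ℤ) • sort L (FreeAbelianGroup.of c) := by
  induction L with
  | zero =>
    have : Subsingleton (Fin (0 + 1)) := inferInstanceAs (Subsingleton (Fin 1))
    have : α = 1 := Subsingleton.elim _ _
    subst this
    simp
  | succ L ih =>
    rw [sort_of, sort_of, minEntry_comp_perm, ← map_zsmul (coneLT (minEntry c) L)]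
    congr 1
    rw [bdry_of, bdry_of, map_sum, map_sum, Finset.smul_sum, ← Equiv.sum_comp α
      (fun l => (Equiv.Perm.sign α : ℤ) • sort L (((-1 : ℤ) ^ (l : ℕ)) •
        FreeAbelianGroup.of (c ∘ l.succAbove)))]
    refine Finset.sum_congr rfl fun i _ => ?_
    obtain ⟨β, hβ, hs⟩ := α.exists_succAbove i
    have : (c ∘ α) ∘ i.succAbove = (c ∘ (α i).succAbove) ∘ β :=
      funext fun k => congrArg c (hβ k)
    rw [map_zsmul, map_zsmul, this, ih, hs, smul_smul, smul_smul]
    congr 1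
    have h1 : ((-1 : ℤ) ^ (i : ℕ)) * (-1) ^ (i : ℕ) = 1 := by
      rw [← mul_pow]; simp
    rw [pow_add]
    linear_combination ((-1 : ℤ) ^ (α i : ℕ) * (Equiv.Perm.sign α : ℤ)) * h1

/-- A transposition of two equal entries gives sort c = −sort c, and free abelian groups have no
2-torsion. -/
theorem sort_of_not_injective {L : ℕ} {c : Fin (L + 1) → V} (hc : ¬ Function.Injective c) :
    sort L (FreeAbelianGroup.of c) = 0 := by
  obtain ⟨i, j, hij, hne⟩ := Function.not_injective_iff.1 hc
  have h := sort_perm c (Equiv.swap i j)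
  have hc' : c ∘ Equiv.swap i j = c := by
    funext k
    simp only [Function.comp_apply]
    rw [Equiv.swap_apply_def]
    split_ifs with h1 h2
    · rw [h1, hij]
    · rw [h2, hij]
    · rfl
  rw [hc', Equiv.Perm.sign_swap hne] at h
  have h2 : (2 : ℤ) • sort L (FreeAbelianGroup.of c) = 0 := by
    rw [two_smul]
    nth_rewrite 1 [h]
    simp
  have h3 := congrArg (FreeAbelianGroup.equivFinsupp _) h2
  rw [map_zsmul, map_zero, smul_eq_zero, or_iff_right two_ne_zero] at h3
  exact (FreeAbelianGroup.equivFinsupp _).map_eq_zero_iff.1 h3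

/-- The chain homotopy between the identity and `sort`. -/
noncomputable def homotopy : ∀ L : ℕ, Chain V L →+ Chain V (L + 1)
  | 0 => 0
  | L + 1 => FreeAbelianGroup.lift fun c =>
      -- The chain id − sort − homotopy∂ is a cycle, and the cone with a vertex of c itself bounds
      -- it without introducing vertices outside c. In degree 0 sorting is the identity, hence the
      -- value 0.
      cone (c 0) (L + 1) (FreeAbelianGroup.of c - sort (L + 1) (FreeAbelianGroup.of c) -
        homotopy L ((symAb V).bdry L (FreeAbelianGroup.of c)))

theorem homotopy_of {L : ℕ} (c : Fin (L + 2) → V) : homotopy (L + 1) (FreeAbelianGroup.of c) =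
    cone (c 0) (L + 1) (FreeAbelianGroup.of c - sort (L + 1) (FreeAbelianGroup.of c) -
      homotopy L ((symAb V).bdry L (FreeAbelianGroup.of c))) :=
  FreeAbelianGroup.lift_apply_of _ _

theorem homotopy_mem_supported {L : ℕ} (c : Fin (L + 1) → V) :
    homotopy L (FreeAbelianGroup.of c) ∈ supported (L + 1) fun c' => range c' ⊆ range c := by
  induction L with
  | zero => exact zero_mem _
  | succ L ih =>
    rw [homotopy_of]
    refine supported_le (P := fun c' => range c' ⊆ range c) _ (fun c' hc' => ?_) ?_
    · rw [cone_of]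
      refine of_mem_supported ?_
      rw [Fin.range_cons]
      exact insert_subset (mem_range_self 0) hc'
    · refine sub_mem (sub_mem (of_mem_supported subset_rfl)
        (supported_mono (fun _ h => h.2) (sort_mem_supported c))) ?_
      rw [bdry_of, map_sum]
      refine sum_mem fun i _ => ?_
      rw [map_zsmul]
      exact AddSubgroup.zsmul_mem _ (supported_mono
        (fun c' hc' => hc'.trans (range_comp_subset_range _ _)) (ih _)) _

theorem bdry_homotopy (L : ℕ) (x : Chain V (L + 1)) :
    (symAb V).bdry (L + 1) (homotopy (L + 1) x) + homotopy L ((symAb V).bdry L x) =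
      x - sort (L + 1) x := by
  suffices h : ((symAb V).bdry (L + 1)).comp (homotopy (L + 1)) +
      (homotopy L).comp ((symAb V).bdry L) = AddMonoidHom.id _ - sort (L + 1) from
    DFunLike.congr_fun h x
  clear x
  induction L with
  | zero =>
    refine FreeAbelianGroup.lift_ext _ _ fun c => ?_
    simp only [AddMonoidHom.add_apply, AddMonoidHom.comp_apply, AddMonoidHom.sub_apply,
      AddMonoidHom.id_apply]
    rw [homotopy_of, bdry_cone, map_sub ((symAb V).bdry 0), map_sub ((symAb V).bdry 0), bdry_sort]
    simp [sort, homotopy]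
  | succ L ih =>
    refine FreeAbelianGroup.lift_ext _ _ fun c => ?_
    have h := DFunLike.congr_fun ih ((symAb V).bdry (L + 1) (FreeAbelianGroup.of c))
    simp only [AddMonoidHom.add_apply, AddMonoidHom.comp_apply, AddMonoidHom.sub_apply,
      AddMonoidHom.id_apply, SymAb.bdry_bdry, map_zero, add_zero] at h ⊢
    rw [homotopy_of, bdry_cone, map_sub ((symAb V).bdry (L + 1)),
      map_sub ((symAb V).bdry (L + 1)), bdry_sort, h]
    simp

end OrderedChains

/-! ### Operators on groups whose vertices are coloured -/

namespace SymAb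

variable {A : ℕ → Type u} [∀ L, AddCommGroup (A L)]

/-- A decomposition of `𝒜` according to the colours of the vertices, such that vertices of the
same colour are interchangeable. -/
structure Colored (𝒜 : SymAb A) (V : Type v) [Fintype V] [DecidableEq V] where
  e : ∀ {L : ℕ}, (Fin (L + 1) → V) → (A L →+ A L)
  sum_e : ∀ {L : ℕ} (a : A L), ∑ c, e c a = a
  e_map : ∀ {K L : ℕ} (θ : Fin (K + 1) → Fin (L + 1)) (c : Fin (L + 1) → V)
    (c' : Fin (K + 1) → V) (a : A L),
    e c' (𝒜.map θ (e c a)) = if c' = c ∘ θ then 𝒜.map θ (e c a) else 0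
  map_eq_map : ∀ {K L : ℕ} (θ θ' : Fin (K + 1) → Fin (L + 1)) (c : Fin (L + 1) → V) (a : A L),
    c ∘ θ = c ∘ θ' → 𝒜.map θ (e c a) = 𝒜.map θ' (e c a)

namespace Colored

open OrderedChains

variable {𝒜 : SymAb A} {V : Type v}

open Classical in
/-- A vertex of a given colour, if there is one. -/
noncomputable def vertex {L : ℕ} (c : Fin (L + 1) → V) (v : V) : Fin (L + 1) :=
  if h : ∃ i, c i = v then h.choose else 0

theorem comp_vertex {L : ℕ} (c : Fin (L + 1) → V) {v : V} (h : v ∈ range c) :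
    c (vertex c v) = v := by
  have h' : ∃ i, c i = v := h
  rw [vertex, dif_pos h']
  exact h'.choose_spec

variable (𝒜) in
/-- The action of ordered chains of colours on elements with vertices of colours `c`. -/
noncomputable def act {L : ℕ} (c : Fin (L + 1) → V) (K : ℕ) : Chain V K →+ (A L →+ A K) :=
  FreeAbelianGroup.lift fun c' => 𝒜.map (vertex c ∘ c')

theorem act_of {L K : ℕ} (c : Fin (L + 1) → V) (c' : Fin (K + 1) → V) :
    act 𝒜 c K (FreeAbelianGroup.of c') = 𝒜.map (vertex c ∘ c') :=
  FreeAbelianGroup.lift_apply_of _ _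

theorem bdry_act {L K : ℕ} (c : Fin (L + 1) → V) (x : Chain V (K + 1)) (a : A L) :
    𝒜.bdry K (act 𝒜 c (K + 1) x a) = act 𝒜 c K ((symAb V).bdry K x) a := by
  have h : ((AddMonoidHom.compHom (𝒜.bdry K)).comp (act 𝒜 c (K + 1))) =
      (act 𝒜 c K).comp ((symAb V).bdry K) := FreeAbelianGroup.lift_ext _ _ fun c' => by
    ext a
    simp only [AddMonoidHom.comp_apply, AddMonoidHom.compHom_apply_apply, act_of, bdry_of,
      𝒜.bdry_apply, map_sum, map_zsmul, AddMonoidHom.finsetSum_apply, AddMonoidHom.zsmul_apply,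
      ← 𝒜.map_comp]
    rfl
  exact DFunLike.congr_fun (DFunLike.congr_fun h x) a

variable [Fintype V] [LinearOrder V] (𝒞 : 𝒜.Colored V)

/-- The vertices chosen for c∘θ and for c differ in general but have the same colours, so the
interchangeability axiom applies. The support condition ensures that every colour used occurs, so no
default vertex enters. -/
theorem act_comp {L M K : ℕ} (c : Fin (L + 1) → V) (θ : Fin (M + 1) → Fin (L + 1))
    {x : Chain V K} (hx : x ∈ supported K fun c' => range c' ⊆ range (c ∘ θ)) (a : A L) :
    act 𝒜 (c ∘ θ) K x (𝒜.map θ (𝒞.e c a)) = act 𝒜 c K x (𝒞.e c a) := by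
  have := supported_le (S := ⊥) ((AddMonoidHom.eval (𝒜.map θ (𝒞.e c a))).comp (act 𝒜 (c ∘ θ) K) -
      (AddMonoidHom.eval (𝒞.e c a)).comp (act 𝒜 c K)) (fun c' hc' => by
        simp only [AddMonoidHom.sub_apply, AddMonoidHom.comp_apply, AddSubgroup.mem_bot,
          AddMonoidHom.eval_apply_apply, act_of]
        rw [sub_eq_zero, ← 𝒜.map_comp]
        refine 𝒞.map_eq_map _ _ _ _ (funext fun k => ?_)
        have h1 := comp_vertex (c ∘ θ) (hc' (mem_range_self k))
        have h2 := comp_vertex c (range_comp_subset_range _ _ (hc' (mem_range_self k)))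
        simp only [Function.comp_apply] at h1 h2 ⊢
        rw [h1, h2]) hx
  simpa [sub_eq_zero] using this

/-- The operator on `𝒜` defined by an operator on ordered chains of colours. -/
noncomputable def op {L K : ℕ} (g : Chain V L →+ Chain V K) : A L →+ A K :=
  ∑ c : Fin (L + 1) → V, (act 𝒜 c K (g (FreeAbelianGroup.of c))).comp (𝒞.e c)

theorem op_apply {L K : ℕ} (g : Chain V L →+ Chain V K) (a : A L) :
    𝒞.op g a = ∑ c : Fin (L + 1) → V, act 𝒜 c K (g (FreeAbelianGroup.of c)) (𝒞.e c a) := by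
  simp [op]

/-- On the part of colour c, the element `map θ a` has colour c∘θ only, so one summand of the
operator survives, and `act_comp` rewrites it with the vertices of c. -/
theorem op_map {L M K : ℕ} (g : Chain V M →+ Chain V K)
    (hg : ∀ c, g (FreeAbelianGroup.of c) ∈ supported K fun c' => range c' ⊆ range c)
    (θ : Fin (M + 1) → Fin (L + 1)) (a : A L) :
    𝒞.op g (𝒜.map θ a) =
      ∑ c : Fin (L + 1) → V, act 𝒜 c K (g (FreeAbelianGroup.of (c ∘ θ))) (𝒞.e c a) := by
  conv_lhs => rw [← 𝒞.sum_e a]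
  rw [map_sum, map_sum]
  refine Finset.sum_congr rfl fun c _ => ?_
  rw [op_apply, Finset.sum_eq_single (c ∘ θ)]
  · rw [𝒞.e_map, if_pos rfl, 𝒞.act_comp c θ (hg _)]
  · intro c' _ h
    rw [𝒞.e_map, if_neg h, map_zero]
  · simp

theorem bdry_op {L K : ℕ} (g : Chain V L →+ Chain V (K + 1)) (a : A L) :
    𝒜.bdry K (𝒞.op g a) = 𝒞.op (((symAb V).bdry K).comp g) a := by
  simp only [op_apply, map_sum, bdry_act, AddMonoidHom.comp_apply]

theorem op_bdry {L K : ℕ} (g : Chain V L →+ Chain V K)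
    (hg : ∀ c, g (FreeAbelianGroup.of c) ∈ supported K fun c' => range c' ⊆ range c)
    (a : A (L + 1)) : 𝒞.op g (𝒜.bdry L a) = 𝒞.op (g.comp ((symAb V).bdry L)) a := by
  rw [bdry_apply, map_sum]
  simp only [map_zsmul, 𝒞.op_map g hg, op_apply, AddMonoidHom.comp_apply, bdry_of, map_sum,
    AddMonoidHom.finsetSum_apply, AddMonoidHom.zsmul_apply, Finset.smul_sum]
  exact Finset.sum_comm

theorem op_id {L : ℕ} (a : A L) : 𝒞.op (AddMonoidHom.id _) a = a := by
  rw [op_apply]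
  conv_rhs => rw [← 𝒞.sum_e a]
  refine Finset.sum_congr rfl fun c _ => ?_
  rw [AddMonoidHom.id_apply, act_of]
  conv_rhs => rw [← 𝒜.map_id (𝒞.e c a)]
  exact 𝒞.map_eq_map _ _ _ _ (funext fun k => comp_vertex c (mem_range_self k))

theorem op_add {L K : ℕ} (g g' : Chain V L →+ Chain V K) (a : A L) :
    𝒞.op (g + g') a = 𝒞.op g a + 𝒞.op g' a := by
  simp [op_apply, Finset.sum_add_distrib]

theorem op_sort_eq_zero {L : ℕ} {a : A L} (ha : a ∈ 𝒜.deg L) : 𝒞.op (sort L) a = 0 := by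
  have hs : ∀ c : Fin (L + 1) → V, sort L (FreeAbelianGroup.of c) ∈
      supported L fun c' => range c' ⊆ range c := fun c =>
    supported_mono (fun _ h => h.2) (sort_mem_supported c)
  suffices h : 𝒜.deg L ≤ (𝒞.op (sort L)).ker from h ha
  rw [deg, AddSubgroup.closure_le]
  rintro _ (⟨K, θ, b, hθ, rfl⟩ | ⟨α, a, rfl⟩)
  · rw [SetLike.mem_coe, AddMonoidHom.mem_ker, 𝒞.op_map _ hs]
    refine Finset.sum_eq_zero fun c _ => ?_
    rw [sort_of_not_injective fun h => hθ h.of_comp]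
    simp
  · rw [SetLike.mem_coe, AddMonoidHom.mem_ker, map_sub, map_zsmul, 𝒞.op_map _ hs, op_apply,
      Finset.smul_sum, sub_eq_zero]
    refine Finset.sum_congr rfl fun c _ => ?_
    rw [sort_perm, map_zsmul, AddMonoidHom.zsmul_apply]

/-- By the pigeonhole principle: the homotopy produces tuples with L + 2 entries, realized by
vertices among only L + 1, so each resulting map is non-injective. -/
theorem op_homotopy_mem_deg {L : ℕ} (a : A L) : 𝒞.op (homotopy L) a ∈ 𝒜.deg (L + 1) := by
  rw [op_apply]
  refine sum_mem fun c _ => ?_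
  refine supported_le (P := fun _ => True) ((AddMonoidHom.eval (𝒞.e c a)).comp
    (act 𝒜 c (L + 1))) (fun c' _ => ?_)
    (supported_mono (fun _ _ => trivial) (homotopy_mem_supported c))
  rw [AddMonoidHom.comp_apply, act_of]
  refine map_mem_deg (fun h => ?_) _
  have := Fintype.card_le_of_injective _ h
  simp at this

/-- Cycles in the subgroup of degenerate elements are boundaries of degenerate elements. -/
theorem exists_bdry_eq (𝒞 : 𝒜.Colored V) {L : ℕ} {a : A (L + 1)} (ha : a ∈ 𝒜.deg (L + 1))
    (h : 𝒜.bdry L a = 0) :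
    ∃ b ∈ 𝒜.deg (L + 2), 𝒜.bdry (L + 1) b = a := by
  refine ⟨𝒞.op (homotopy (L + 1)) a, 𝒞.op_homotopy_mem_deg a, ?_⟩
  -- Evaluated on a degenerate cycle, the identity ∂h + h∂ + sort = id loses its sort term by
  -- degeneracy and its h∂ term because a is a cycle.
  have h1 : ((symAb V).bdry (L + 1)).comp (homotopy (L + 1)) +
      (homotopy L).comp ((symAb V).bdry L) + sort (L + 1) = AddMonoidHom.id _ := by
    ext1 x
    simp only [AddMonoidHom.add_apply, AddMonoidHom.comp_apply, AddMonoidHom.id_apply]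
    rw [bdry_homotopy, sub_add_cancel]
  have h2 := 𝒞.op_id a
  rw [← h1, op_add, op_add, 𝒞.op_sort_eq_zero ha, ← bdry_op, ← 𝒞.op_bdry _ homotopy_mem_supported,
    h, map_zero, add_zero, add_zero] at h2
  exact h2

/-- Elements which are invariant under a transposition are degenerate. -/
theorem mem_deg_of_swap (𝒞 : 𝒜.Colored V) {L : ℕ} {i j : Fin (L + 1)} (hij : i ≠ j) {a : A L}
    (h : 𝒜.map (Equiv.swap i j) a = a) : a ∈ 𝒜.deg L := by
  have hcomp : ∀ c : Fin (L + 1) → V, (c ∘ Equiv.swap i j) ∘ Equiv.swap i j = c := fun c => by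
    funext k; simp
  have he : ∀ c : Fin (L + 1) → V,
      𝒞.e c a = 𝒜.map (Equiv.swap i j) (𝒞.e (c ∘ Equiv.swap i j) a) := by
    intro c
    conv_lhs => rw [← h, ← 𝒞.sum_e a]
    rw [map_sum, map_sum, Finset.sum_eq_single (c ∘ Equiv.swap i j)]
    · rw [𝒞.e_map, if_pos (hcomp c).symm]
    · intro c' _ hc'
      rw [𝒞.e_map, if_neg]
      rintro rfl
      exact hc' (hcomp c').symm
    · simp
  rw [← 𝒞.sum_e a]
  -- The linear order on colours selects one element from each pair {c, c∘(i j)} with c i ≠ c j, so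
  -- the invariant element splits over the integers as d + x + (i j)x.
  have hsplit : ∑ c, 𝒞.e c a = (∑ c : Fin (L + 1) → V with c i = c j, 𝒞.e c a) +
      ((∑ c : Fin (L + 1) → V with c i < c j, 𝒞.e c a) +
        ∑ c : Fin (L + 1) → V with c j < c i, 𝒞.e c a) := by
    simp only [Finset.sum_filter, ← Finset.sum_add_distrib]
    refine Finset.sum_congr rfl fun c _ => ?_
    rcases lt_trichotomy (c i) (c j) with h | h | h
    · simp [h, h.ne, h.not_gt]
    · simp [h]
    · simp [h, h.ne', h.not_gt]
  have hgt : ∑ c : Fin (L + 1) → V with c j < c i, 𝒞.e c a =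
      𝒜.map (Equiv.swap i j) (∑ c : Fin (L + 1) → V with c i < c j, 𝒞.e c a) := by
    rw [map_sum]
    refine Finset.sum_bij' (fun c _ => c ∘ Equiv.swap i j) (fun c _ => c ∘ Equiv.swap i j)
      ?_ ?_ ?_ ?_ ?_
    · intro c hc
      simpa using hc
    · intro c hc
      simpa using hc
    · exact fun c _ => hcomp c
    · exact fun c _ => hcomp c
    · exact fun c _ => he c
  rw [hsplit, hgt]
  refine add_mem (sum_mem fun c hc => ?_) ?_
  · simp only [Finset.mem_filter, Finset.mem_univ, true_and] at hc
    -- When entries i and j have the same colour, replacing vertex j by vertex i does not change the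
    -- element, which exhibits it as degenerate.
    have h1 : 𝒜.map (Function.update id j i) (𝒞.e c a) = 𝒞.e c a := by
      conv_rhs => rw [← 𝒜.map_id (𝒞.e c a)]
      refine 𝒞.map_eq_map _ _ _ _ (funext fun k => ?_)
      by_cases hk : k = j
      · subst hk; simp [hc]
      · simp [hk]
    rw [← h1]
    refine map_mem_deg (fun hinj => hij (hinj ?_)) _
    simp [hij]
  · have h1 := map_perm_sub_mem_deg (𝒜 := 𝒜) (Equiv.swap i j)
      (∑ c : Fin (L + 1) → V with c i < c j, 𝒞.e c a)
    rw [Equiv.Perm.sign_swap hij] at h1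
    simpa [add_comm] using h1

end Colored

end SymAb

/-! ### The spaces `Σ_{L,M}` -/

namespace SmaleSpace

/-! ### Small connected sets and finite clopen partitions -/

section Connected

variable {X : Type u} [MetricSpace X] [CompactSpace X] [SmaleSpace X]

/-- If the stable sets are totally disconnected, then the points of a small connected set are
locally unstably equivalent. -/
theorem exists_br_eq_left_of_isPreconnected
    (h : ∀ x : X, @IsTotallyDisconnected X (stableTopology X) (stableSet x)) :
    ∃ δ > 0, ∀ C : Set X, IsPreconnected C → (∀ a ∈ C, ∀ b ∈ C, dist a b ≤ δ) →
      ∀ a ∈ C, ∀ b ∈ C, br a b = a := by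
  obtain ⟨δ, hδ, hδε, hδ2, hc⟩ := exists_br_close (X := X) (half_pos (ε_pos (X := X)))
  refine ⟨δ, hδ, fun C hC hd a ha b hb => ?_⟩
  have he := ε_pos (X := X)
  have : PreconnectedSpace C := Subtype.preconnectedSpace hC
  have hcont : Continuous fun q : C => br a q := by
    rw [← continuousOn_univ]
    refine ContinuousOn.comp (g := fun p : X × X => br p.1 p.2) (f := fun q : C => (a, (q : X)))
      br_cont (by fun_prop) fun q _ => (hd a ha q q.2).trans hδε
  -- The brackets [a,q] all lie in one local stable set, where closeness in the metric gives
  -- closeness in the stable topology. The image of C is thus connected in a totally disconnected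
  -- stable set, hence is the single point [a,a] = a.
  have hcont' : @Continuous C X _ (stableTopology X) fun q : C => br a q := by
    refine @Continuous.mk C X _ (stableTopology X) _ fun U hU => ?_
    rw [isOpen_iff_mem_nhds]
    intro q hq
    obtain ⟨r, hr, hrε, hU⟩ := isOpen_stable_iff.1 hU _ hq
    filter_upwards [hcont.continuousAt.preimage_mem_nhds (Metric.ball_mem_nhds _ hr)] with q' hq'
    rw [mem_preimage, Metric.mem_ball, dist_comm] at hq'
    refine hU ⟨hq', ?_⟩
    have h1 := (hc a q' (hd a ha q' q'.2)).1
    have h2 := (hc a q (hd a ha q q.2)).1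
    have h3 := dist_triangle_left (br a q') (br a q) a
    have h4 := dist_triangle_left (br a q') q a
    have h5 := hd a ha q q.2
    rw [br_br_right _ _ _ (by linarith) (by linarith) (by linarith),
      br_br_left _ _ _ ((hd a ha q' q'.2).trans hδε) (by linarith) (by linarith)]
  have hp := @isPreconnected_range C X _ (stableTopology X) _ _ hcont'
  have hs : range (fun q : C => br a q) ⊆ stableSet a := by
    rintro _ ⟨q, rfl⟩
    have h1 := (hc a q (hd a ha q q.2)).1
    exact br_mem_stableSet ((hd a ha q q.2).trans hδε) (by linarith)
  have h1 := h a _ hs hp (mem_range_self ⟨b, hb⟩) (mem_range_self ⟨a, ha⟩)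
  simpa [br_self] using h1

theorem exists_br_eq_right_of_isPreconnected
    (h : ∀ x : X, @IsTotallyDisconnected X (unstableTopology X) (unstableSet x)) :
    ∃ δ > 0, ∀ C : Set X, IsPreconnected C → (∀ a ∈ C, ∀ b ∈ C, dist a b ≤ δ) →
      ∀ a ∈ C, ∀ b ∈ C, br b a = a :=
  @exists_br_eq_left_of_isPreconnected X _ _ (dual X) h

end Connected

/-- A compact metric space whose small connected subsets are trivial has a finite partition into
small clopen sets. -/
theorem exists_small_clopen_coloring {X : Type u} [MetricSpace X] [CompactSpace X] {δ : ℝ}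
    (hδ : 0 < δ)
    (h : ∀ C : Set X, IsPreconnected C → (∀ a ∈ C, ∀ b ∈ C, dist a b ≤ δ) → C.Subsingleton)
    {η : ℝ} (hη : 0 < η) :
    ∃ (N : ℕ) (κ : X → Fin N), (∀ i, IsOpen (κ ⁻¹' {i})) ∧ ∀ a b, κ a = κ b → dist a b < η := by
  have key : ∀ x : X, ∃ W : Set X, IsClopen W ∧ x ∈ W ∧ W ⊆ Metric.ball x (η / 2) := by
    intro x
    let K := Metric.closedBall x (δ / 2)
    have hK : IsCompact K := Metric.isClosed_closedBall.isCompact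
    have : CompactSpace K := isCompact_iff_compactSpace.1 hK
    have : TotallyDisconnectedSpace K := by
      refine totallyDisconnectedSpace_subtype_iff.2 fun C hCK hC => h C hC fun a ha b hb => ?_
      have h1 := hCK ha
      have h2 := hCK hb
      rw [Metric.mem_closedBall] at h1 h2
      have := dist_triangle_right a b x
      linarith
    have hr : 0 < min (δ / 2) (η / 2) := by positivity
    -- The closed ball has diameter at most δ, so it is totally disconnected. A relatively clopen
    -- set inside the open ball is closed by compactness and also open in the whole space.
    obtain ⟨V, hV, hxV, hVU⟩ := compact_exists_isClopen_in_isOpen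
      (X := K) (x := ⟨x, Metric.mem_closedBall_self (by positivity)⟩)
      (U := Subtype.val ⁻¹' Metric.ball x (min (δ / 2) (η / 2)))
      (Metric.isOpen_ball.preimage continuous_subtype_val) (Metric.mem_ball_self hr)
    have hsub : Subtype.val '' V ⊆ Metric.ball x (min (δ / 2) (η / 2)) := by
      rintro _ ⟨y, hy, rfl⟩
      exact hVU hy
    refine ⟨Subtype.val '' V, ⟨?_, ?_⟩, ⟨_, hxV, rfl⟩,
      hsub.trans (Metric.ball_subset_ball (min_le_right _ _))⟩
    · exact hV.1.trans hK.isClosed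
    · obtain ⟨O, hO, rfl⟩ := isOpen_induced_iff.1 hV.2
      have : Subtype.val '' (Subtype.val ⁻¹' O : Set K) =
          O ∩ Metric.ball x (min (δ / 2) (η / 2)) := by
        refine Subset.antisymm (subset_inter ?_ hsub) fun y hy => ?_
        · rintro _ ⟨y, hy, rfl⟩
          exact hy
        · exact ⟨⟨y, Metric.ball_subset_closedBall
            (Metric.ball_subset_ball (min_le_left _ _) hy.2)⟩, hy.1, rfl⟩
      rw [this]
      exact hO.inter Metric.isOpen_ball
  choose W hW hxW hWη using key
  obtain ⟨t, ht⟩ := isCompact_univ.elim_finite_subcover W (fun x => (hW x).2)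
    fun x _ => mem_iUnion.2 ⟨x, hxW x⟩
  classical
  -- The clopen cover need not be disjoint, so the colour of a point records which members of the
  -- cover contain it.
  refine ⟨_, fun x => Fintype.equivFin (Finset t) (Finset.univ.filter fun i : t => x ∈ W i),
    fun i => ?_, fun a b hab => ?_⟩
  · obtain ⟨s, rfl⟩ := (Fintype.equivFin (Finset t)).surjective i
    have : (fun x => Fintype.equivFin (Finset t) (Finset.univ.filter fun i : t => x ∈ W i)) ⁻¹'
        {Fintype.equivFin (Finset t) s} =
        ⋂ i : t, {x | x ∈ W i ↔ i ∈ s} := by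
      ext x
      simp only [mem_preimage, mem_singleton_iff, EmbeddingLike.apply_eq_iff_eq, Finset.ext_iff,
        Finset.mem_filter, Finset.mem_univ, true_and, mem_iInter, mem_ofPred_eq]
    rw [this]
    refine isOpen_iInter_of_finite fun i => ?_
    by_cases hi : i ∈ s
    · simpa [hi] using (hW i).2
    · simp only [hi, iff_false]
      exact (hW i).1.isOpen_compl
  · have hab' := (Fintype.equivFin (Finset t)).injective hab
    obtain ⟨x, hx, hax⟩ := mem_iUnion₂.1 (ht (mem_univ a))
    have h1 : (⟨x, hx⟩ : t) ∈ Finset.univ.filter fun i : t => a ∈ W i := by simpa using hax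
    rw [hab'] at h1
    have hbx : b ∈ W x := by simpa using h1
    have h2 := hWη x hax
    have h3 := hWη x hbx
    rw [Metric.mem_ball] at h2 h3
    have := dist_triangle_right a b x
    linarith

end SmaleSpace

/-! ### Reindexing maps, coface maps and colourings of the fibre products -/

namespace SUBijectivePair

variable {X : Type u} {Y : Type v} {Z : Type w}
  [MetricSpace X] [CompactSpace X] [SmaleSpace X]
  [MetricSpace Y] [CompactSpace Y] [SmaleSpace Y]
  [MetricSpace Z] [CompactSpace Z] [SmaleSpace Z]
  {π : SUBijectivePair X Y Z}

namespace Sig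

variable {K L M : ℕ}

@[ext]
theorem ext {p q : π.Sig L M} (hy : ∀ l, p.1.1 l = q.1.1 l) (hz : ∀ m, p.1.2 m = q.1.2 m) :
    p = q :=
  Subtype.ext (Prod.ext (funext hy) (funext hz))

theorem continuous_fst (l : Fin (L + 1)) : Continuous fun p : π.Sig L M => p.1.1 l :=
  (continuous_apply l).comp (_root_.continuous_fst.comp continuous_subtype_val)

theorem continuous_snd (m : Fin (M + 1)) : Continuous fun p : π.Sig L M => p.1.2 m :=
  (continuous_apply m).comp (_root_.continuous_snd.comp continuous_subtype_val)

theorem br_fst {p q : π.Sig L M} (h : dist p q ≤ ε (π.Sig L M)) (l : Fin (L + 1)) :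
    (br p q).1.1 l = br (p.1.1 l) (q.1.1 l) :=
  congrFun (congrArg Prod.fst (bracket_val h)) l

theorem br_snd {p q : π.Sig L M} (h : dist p q ≤ ε (π.Sig L M)) (m : Fin (M + 1)) :
    (br p q).1.2 m = br (p.1.2 m) (q.1.2 m) :=
  congrFun (congrArg Prod.snd (bracket_val h)) m

theorem dist_fst_le (p q : π.Sig L M) (l : Fin (L + 1)) : dist (p.1.1 l) (q.1.1 l) ≤ dist p q :=
  ((dist_le_iff dist_nonneg).1 le_rfl).1 l

theorem dist_snd_le (p q : π.Sig L M) (m : Fin (M + 1)) : dist (p.1.2 m) (q.1.2 m) ≤ dist p q :=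
  ((dist_le_iff dist_nonneg).1 le_rfl).2 m

theorem fst_mem_stableSet {p q : π.Sig L M} (h : q ∈ stableSet p) (l : Fin (L + 1)) :
    q.1.1 l ∈ stableSet (p.1.1 l) :=
  map_mem_stableSet (continuous_fst l) (fun _ => rfl) h

theorem snd_mem_stableSet {p q : π.Sig L M} (h : q ∈ stableSet p) (m : Fin (M + 1)) :
    q.1.2 m ∈ stableSet (p.1.2 m) :=
  map_mem_stableSet (continuous_snd m) (fun _ => rfl) h

theorem fst_mem_unstableSet {p q : π.Sig L M} (h : q ∈ unstableSet p) (l : Fin (L + 1)) :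
    q.1.1 l ∈ unstableSet (p.1.1 l) :=
  map_mem_unstableSet (continuous_fst l) (fun _ => rfl) h

theorem snd_mem_unstableSet {p q : π.Sig L M} (h : q ∈ unstableSet p) (m : Fin (M + 1)) :
    q.1.2 m ∈ unstableSet (p.1.2 m) :=
  map_mem_unstableSet (continuous_snd m) (fun _ => rfl) h

theorem dist_le_sum (p q : π.Sig L M) :
    dist p q ≤ ∑ l, dist (p.1.1 l) (q.1.1 l) + ∑ m, dist (p.1.2 m) (q.1.2 m) := by
  have h1 : 0 ≤ ∑ l, dist (p.1.1 l) (q.1.1 l) := Finset.sum_nonneg fun _ _ => dist_nonneg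
  have h2 : 0 ≤ ∑ m, dist (p.1.2 m) (q.1.2 m) := Finset.sum_nonneg fun _ _ => dist_nonneg
  refine (dist_le_iff (add_nonneg h1 h2)).2 ⟨fun l => ?_, fun m => ?_⟩
  · exact (Finset.single_le_sum (f := fun l => dist (p.1.1 l) (q.1.1 l))
      (fun _ _ => dist_nonneg) (Finset.mem_univ l)).trans (le_add_of_nonneg_right h2)
  · exact (Finset.single_le_sum (f := fun m => dist (p.1.2 m) (q.1.2 m))
      (fun _ _ => dist_nonneg) (Finset.mem_univ m)).trans (le_add_of_nonneg_left h1)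

theorem mem_stableSet {p q : π.Sig L M} (hy : ∀ l, q.1.1 l ∈ stableSet (p.1.1 l))
    (hz : ∀ m, q.1.2 m ∈ stableSet (p.1.2 m)) : q ∈ stableSet p := by
  have h := (tendsto_finsetSum Finset.univ fun l _ => hy l).add
    (tendsto_finsetSum Finset.univ fun m _ => hz m)
  simp only [Finset.sum_const_zero, add_zero] at h
  refine squeeze_zero (fun _ => dist_nonneg) (fun n => ?_) h
  refine (dist_le_sum _ _).trans_eq ?_
  congr 1 <;> refine Finset.sum_congr rfl fun i _ => ?_
  · rw [map_iterate (f := fun p : π.Sig L M => p.1.1 i) (fun _ => rfl),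
      map_iterate (f := fun p : π.Sig L M => p.1.1 i) (fun _ => rfl)]
  · rw [map_iterate (f := fun p : π.Sig L M => p.1.2 i) (fun _ => rfl),
      map_iterate (f := fun p : π.Sig L M => p.1.2 i) (fun _ => rfl)]

theorem mem_unstableSet {p q : π.Sig L M} (hy : ∀ l, q.1.1 l ∈ unstableSet (p.1.1 l))
    (hz : ∀ m, q.1.2 m ∈ unstableSet (p.1.2 m)) : q ∈ unstableSet p := by
  have h := (tendsto_finsetSum Finset.univ fun l _ => hy l).add
    (tendsto_finsetSum Finset.univ fun m _ => hz m)
  simp only [Finset.sum_const_zero, add_zero] at h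
  refine squeeze_zero (fun _ => dist_nonneg) (fun n => ?_) h
  refine (dist_le_sum _ _).trans_eq ?_
  congr 1 <;> refine Finset.sum_congr rfl fun i _ => ?_
  · rw [map_symm_iterate (f := fun p : π.Sig L M => p.1.1 i) (fun _ => rfl),
      map_symm_iterate (f := fun p : π.Sig L M => p.1.1 i) (fun _ => rfl)]
  · rw [map_symm_iterate (f := fun p : π.Sig L M => p.1.2 i) (fun _ => rfl),
      map_symm_iterate (f := fun p : π.Sig L M => p.1.2 i) (fun _ => rfl)]

/-- Stably equivalent points with the same entries in `Z` coincide. -/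
theorem eq_of_mem_stableSet {p q : π.Sig L M} (h : q ∈ stableSet p)
    (hz : ∀ m, q.1.2 m = p.1.2 m) : q = p := by
  refine ext (fun l => (π.πs_bij (p.1.1 l)).injOn (fst_mem_stableSet h l)
    (mem_stableSet_self _) ?_) hz
  rw [p.2 l 0, q.2 l 0, hz]

/-- Unstably equivalent points with the same entries in `Y` coincide. -/
theorem eq_of_mem_unstableSet {p q : π.Sig L M} (h : q ∈ unstableSet p)
    (hy : ∀ l, q.1.1 l = p.1.1 l) : q = p := by
  refine ext hy (fun m => (π.πu_bij (p.1.2 m)).injOn (snd_mem_unstableSet h m)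
    (mem_unstableSet_self _) ?_)
  rw [← p.2 0 m, ← q.2 0 m, hy]

/-- Reindexing the entries in `Y`. -/
def comap (θ : Fin (K + 1) → Fin (L + 1)) (p : π.Sig L M) : π.Sig K M :=
  ⟨(fun k => p.1.1 (θ k), p.1.2), fun _ m => p.2 _ m⟩

theorem isScaleMap_comap (θ : Fin (K + 1) → Fin (L + 1)) :
    IsScaleMap (comap θ : π.Sig L M → π.Sig K M) := by
  have hd : ∀ a b : π.Sig L M, dist (comap θ a) (comap θ b) ≤ dist a b := fun a b =>
    (dist_le_iff dist_nonneg).2 ⟨fun l => dist_fst_le a b _, fun m => dist_snd_le a b m⟩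
  refine ⟨?_, fun _ => rfl, rfl, rfl, hd, fun a b h => ?_⟩
  · exact (LipschitzWith.of_dist_le' (K := 1) (by simpa using hd)).continuous
  · have h' : dist (comap θ a) (comap θ b) ≤ ε (π.Sig K M) := (hd a b).trans h
    refine ext (fun l => ?_) fun m => ?_
    · rw [br_fst h']; exact br_fst h _
    · rw [br_snd h']; exact br_snd h _

theorem isScaleMap_coface (m : Fin (M + 2)) :
    IsScaleMap (coface m : π.Sig L (M + 1) → π.Sig L M) := by
  have hd : ∀ a b : π.Sig L (M + 1), dist (coface m a) (coface m b) ≤ dist a b := fun a b =>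
    (dist_le_iff dist_nonneg).2 ⟨fun l => dist_fst_le a b _, fun m => dist_snd_le a b _⟩
  refine ⟨?_, fun _ => rfl, rfl, rfl, hd, fun a b h => ?_⟩
  · exact (LipschitzWith.of_dist_le' (K := 1) (by simpa using hd)).continuous
  · have h' : dist (coface m a) (coface m b) ≤ ε (π.Sig L M) := (hd a b).trans h
    refine ext (fun l => ?_) fun m => ?_
    · rw [br_fst h']; exact br_fst h _
    · rw [br_snd h']; exact br_snd h _

/-- A point in a stable set is determined by its entries in Z, which reindexing does not touch.
Conversely, prescribed entries in Z determine the common image in X, over which s-bijectivity of π_s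
provides every y_l. -/
theorem sBijective_comap (θ : Fin (K + 1) → Fin (L + 1)) :
    SBijective (comap θ : π.Sig L M → π.Sig K M) := by
  refine fun p => ⟨fun q hq => map_mem_stableSet (isScaleMap_comap θ).cont (fun _ => rfl) hq,
    fun q hq q' hq' h => ?_, fun r hr => ?_⟩
  · exact eq_of_mem_stableSet (mem_stableSet_trans (mem_stableSet_symm hq') hq)
      fun m => congrArg (fun s : π.Sig K M => s.1.2 m) h
  · have h1 : ∀ l, ∃ y ∈ stableSet (p.1.1 l), π.πs y = π.πu (r.1.2 0) := fun l => by
      refine (π.πs_bij (p.1.1 l)).surjOn ?_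
      rw [p.2 l 0]
      exact map_mem_stableSet π.πu_cont π.πu_equivariant (snd_mem_stableSet hr 0)
    choose y hy hy' using h1
    let q : π.Sig L M := ⟨(y, r.1.2), fun l m => by
      rw [← r.2 0 m, r.2 0 0]; exact hy' l⟩
    have hq : q ∈ stableSet p := mem_stableSet hy fun i => snd_mem_stableSet hr i
    exact ⟨q, hq, eq_of_mem_stableSet (mem_stableSet_trans (mem_stableSet_symm hr)
      (map_mem_stableSet (isScaleMap_comap θ).cont (fun _ => rfl) hq)) fun m => rfl⟩

theorem uBijective_coface (m : Fin (M + 2)) :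
    UBijective (coface m : π.Sig L (M + 1) → π.Sig L M) := by
  refine fun p => ⟨fun q hq => map_mem_unstableSet (isScaleMap_coface m).cont (fun _ => rfl) hq,
    fun q hq q' hq' h => ?_, fun r hr => ?_⟩
  · exact eq_of_mem_unstableSet (mem_unstableSet_trans (mem_unstableSet_symm hq') hq)
      fun l => congrArg (fun s : π.Sig L M => s.1.1 l) h
  · have h1 : ∀ i, ∃ z ∈ unstableSet (p.1.2 i), π.πu z = π.πs (r.1.1 0) := fun i => by
      refine (π.πu_bij (p.1.2 i)).surjOn ?_
      rw [← p.2 0 i]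
      exact map_mem_unstableSet π.πs_cont π.πs_equivariant (fst_mem_unstableSet hr 0)
    choose z hz hz' using h1
    let q : π.Sig L (M + 1) := ⟨(r.1.1, z), fun l i => by
      rw [hz' i, r.2 l 0, ← r.2 0 0]⟩
    have hq : q ∈ unstableSet p := mem_unstableSet (fun i => fst_mem_unstableSet hr i) hz
    exact ⟨q, hq, eq_of_mem_unstableSet (mem_unstableSet_trans (mem_unstableSet_symm hr)
      (map_mem_unstableSet (isScaleMap_coface m).cont (fun _ => rfl) hq)) fun l => rfl⟩

/-- Reindexing the y-entries and deleting a z-entry form a Cartesian square: a point of Σ_{K,M+1}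
over the image of e combines with the y-entries of e to a point of Σ_{L,M+1}. This base change makes
the two differentials compatible. -/
theorem preimage_coface_image_comap (θ : Fin (K + 1) → Fin (L + 1)) (m : Fin (M + 2))
    (E : Set (π.Sig L M)) :
    coface m ⁻¹' (comap θ '' E) = comap θ '' (coface m ⁻¹' E) := by
  ext p
  constructor
  · rintro ⟨e, he, hp⟩
    have h1 : ∀ l, p.1.1 l = e.1.1 (θ l) := fun l => congrArg (fun s => s.1.1 l) hp.symm
    have h2 : ∀ i, e.1.2 i = p.1.2 (m.succAbove i) := fun i => congrArg (fun s => s.1.2 i) hp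
    let q : π.Sig L (M + 1) := ⟨(e.1.1, p.1.2), fun l i => by
      rw [← p.2 0 i, e.2 l 0, h2, ← p.2 0]⟩
    have hq : coface m q = e := ext (fun l => rfl) fun i => (h2 i).symm
    exact ⟨q, show coface m q ∈ E from hq.symm ▸ he, ext (fun l => (h1 l).symm) fun i => rfl⟩
  · rintro ⟨q, hq, rfl⟩
    exact ⟨coface m q, hq, rfl⟩

theorem injOn_comap_preimage_coface (θ : Fin (K + 1) → Fin (L + 1)) (m : Fin (M + 2))
    (E : CO (π.Sig L M)) :
    InjOn (comap θ) (coface m ⁻¹' E.carrier : Set (π.Sig L (M + 1))) := by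
  intro q hq q' hq' h
  have h1 := (sBijective_comap θ).injOn_CO E hq hq' (congrArg (coface m) h)
  exact ext (fun l => congrArg (fun s : π.Sig L M => s.1.1 l) h1)
    fun i => congrArg (fun s : π.Sig K (M + 1) => s.1.2 i) h

/-- Small connected subsets of `Σ_{0,M}` are trivial. -/
theorem exists_subsingleton_of_isPreconnected :
    ∃ δ > 0, ∀ C : Set (π.Sig 0 M), IsPreconnected C →
      (∀ a ∈ C, ∀ b ∈ C, dist a b ≤ δ) → C.Subsingleton := by
  obtain ⟨δ₁, h₁, hZ⟩ := exists_br_eq_left_of_isPreconnected π.totallyDisconnected_stable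
  obtain ⟨δ₂, h₂, hY⟩ := exists_br_eq_right_of_isPreconnected π.totallyDisconnected_unstable
  obtain ⟨δ₃, h₃, h₃ε, -, hc⟩ := exists_br_close (X := π.Sig 0 M) (η := ε (π.Sig 0 M)) ε_pos
  refine ⟨min δ₃ (min δ₁ δ₂), by positivity, fun C hC hd a ha b hb => ?_⟩
  have hd₃ : ∀ a ∈ C, ∀ b ∈ C, dist a b ≤ δ₃ := fun a ha b hb =>
    (hd a ha b hb).trans (min_le_left _ _)
  have hd₁ : ∀ a ∈ C, ∀ b ∈ C, dist a b ≤ δ₁ := fun a ha b hb =>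
    (hd a ha b hb).trans ((min_le_right _ _).trans (min_le_left _ _))
  have hd₂ : ∀ a ∈ C, ∀ b ∈ C, dist a b ≤ δ₂ := fun a ha b hb =>
    (hd a ha b hb).trans ((min_le_right _ _).trans (min_le_right _ _))
  have hab := (hd₃ a ha b hb).trans h₃ε
  have hba := (hd₃ b hb a ha).trans h₃ε
  -- The projections of C to Z are small and connected, so [a,b] has the same entries in Z as a and
  -- is stably equivalent to it. The dual argument with the entries in Y gives [b,a] = a.
  have h1 : br a b = a := by
    refine eq_of_mem_stableSet (br_mem_stableSet hab (hc _ _ (hd₃ a ha b hb)).1) fun m => ?_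
    rw [br_snd hab]
    refine hZ _ (hC.image _ (continuous_snd m).continuousOn) ?_ _ (mem_image_of_mem _ ha) _
      (mem_image_of_mem _ hb)
    rintro _ ⟨p, hp, rfl⟩ _ ⟨q, hq, rfl⟩
    exact (dist_snd_le p q m).trans (hd₁ p hp q hq)
  have h2 : br b a = a := by
    refine eq_of_mem_unstableSet (br_mem_unstableSet hba (hc _ _ (hd₃ b hb a ha)).2) fun l => ?_
    rw [br_fst hba]
    refine hY _ (hC.image _ (continuous_fst l).continuousOn) ?_ _ (mem_image_of_mem _ ha) _
      (mem_image_of_mem _ hb)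
    rintro _ ⟨p, hp, rfl⟩ _ ⟨q, hq, rfl⟩
    exact (dist_fst_le p q l).trans (hd₂ p hp q hq)
  rw [← h2, br_eq_of_br_right hab h1]

variable (π M) in
theorem exists_coloring : ∃ N, Nonempty (Coloring (π.Sig 0 M) (Fin N)) := by
  obtain ⟨δ, hδ, h⟩ := exists_subsingleton_of_isPreconnected (π := π) (M := M)
  obtain ⟨δ', hδ', hδε, -, hc⟩ := exists_br_close (X := π.Sig 0 M) (η := ε (π.Sig 0 M)) ε_pos
  have h1 : 0 < (1 - lam (π.Sig 0 M)) * ε (π.Sig 0 M) :=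
    mul_pos (by linarith [lam_lt_one (X := π.Sig 0 M)]) ε_pos
  have h2 := half_pos (ε_pos (X := π.Sig 0 M))
  obtain ⟨N, κ, hκ, hd⟩ := exists_small_clopen_coloring hδ h (lt_min hδ' (lt_min h1 h2))
  refine ⟨N, ⟨κ, hκ, fun a b hab => ?_⟩⟩
  have := hd a b hab
  exact ⟨this.trans_le ((min_le_right _ _).trans (min_le_right _ _)),
    this.le.trans ((min_le_right _ _).trans (min_le_left _ _)),
    hc a b (this.le.trans (min_le_left _ _))⟩

theorem dist_le_of_forall {p q : π.Sig L M} {r : ℝ}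
    (h : ∀ l : Fin (L + 1), dist (comap (fun _ : Fin 1 => l) p) (comap (fun _ => l) q) ≤ r) :
    dist p q ≤ r := by
  have hr : 0 ≤ r := dist_nonneg.trans (h 0)
  exact (dist_le_iff hr).2 ⟨fun l => ((dist_le_iff hr).1 (h l)).1 0,
    ((dist_le_iff hr).1 (h 0)).2⟩

/-- The colouring of `Σ_{L,M}` induced by a colouring of `Σ_{0,M}`. -/
def coloring {V : Type*} (κ : Coloring (π.Sig 0 M) V) (L : ℕ) :
    Coloring (π.Sig L M) (Fin (L + 1) → V) where
  toFun p l := κ (comap (fun _ => l) p)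
  isOpen c := by
    have : (fun (p : π.Sig L M) l => κ (comap (fun _ => l) p)) ⁻¹' {c} =
        ⋂ l, comap (fun _ : Fin 1 => l) ⁻¹' (κ ⁻¹' {c l}) := by
      ext p
      simp [funext_iff]
    rw [this]
    exact isOpen_iInter_of_finite fun l => (κ.isOpen _).preimage (isScaleMap_comap _).cont
  close a b h := by
    have h' := fun l => κ.close _ _ (congrFun h l)
    have hd : dist a b ≤ ε (π.Sig L M) := dist_le_of_forall fun l => κ.dist_le (congrFun h l)
    have hb := fun l : Fin (L + 1) =>
      (isScaleMap_comap (π := π) (M := M) (fun _ : Fin 1 => l)).map_br a b hd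
    refine ⟨?_, dist_le_of_forall fun l => (h' l).2.1, dist_le_of_forall fun l => ?_,
      dist_le_of_forall fun l => ?_⟩
    · have hfin : (Finset.univ : Finset (Fin (L + 1))).Nonempty := Finset.univ_nonempty
      obtain ⟨l, -, hl⟩ := Finset.exists_max_image Finset.univ (fun l =>
        dist (comap (fun _ : Fin 1 => l) a) (comap (fun _ => l) b)) hfin
      exact (dist_le_of_forall fun k => hl k (Finset.mem_univ k)).trans_lt (h' l).1
    · rw [hb]; exact (h' l).2.2.1
    · rw [hb]; exact (h' l).2.2.2

theorem coloring_comap {V : Type*} (κ : Coloring (π.Sig 0 M) V) (θ : Fin (K + 1) → Fin (L + 1))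
    (p : π.Sig L M) : coloring κ K (comap θ p) = coloring κ L p ∘ θ := rfl

/-- Both sides are stably equivalent to the θ'-reindexing of e, and both have the Z-entries of a,
since those of the bracket are [e_z, a_z] = a_z. Such points coincide. This is where vertices of
equal colour become interchangeable. -/
theorem br_comap_eq {V : Type*} {κ : Coloring (π.Sig 0 M) V} {θ θ' : Fin (K + 1) → Fin (L + 1)}
    {e a : π.Sig L M} (ha : a ∈ (coloring κ L).slice e)
    (h : coloring κ L e ∘ θ = coloring κ L e ∘ θ') :
    br (comap θ' e) (comap θ a) = comap θ' a := by
  have h1 : coloring κ K (comap θ' e) = coloring κ K (comap θ a) := by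
    rw [coloring_comap, coloring_comap, ha.1, h]
  have h2 := (coloring κ K).dist_le h1
  have h3 := (coloring κ L).dist_le ha.1.symm
  refine eq_of_mem_stableSet (mem_stableSet_trans (mem_stableSet_symm
    (map_mem_stableSet (isScaleMap_comap θ').cont (fun _ => rfl)
      (Coloring.slice_subset_stableSet e ha)))
    (br_mem_stableSet h2 ((coloring κ K).close _ _ h1).2.2.1)) fun m => ?_
  rw [br_snd h2]
  refine (br_snd h3 m).symm.trans ?_
  rw [br_eq_of_br_left h3 ha.2]
  rfl

end Sig

end SUBijectivePair

/-! ### Colour projections and the passage back to the dimension group -/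

namespace SmaleSpace

variable {X : Type u} [MetricSpace X] [CompactSpace X] [SmaleSpace X]
variable {Y : Type v} [MetricSpace Y] [CompactSpace Y] [SmaleSpace Y]

theorem isPushforward_pushforward {f : X → Y} (h : ∃ p, IsPushforward f p) :
    IsPushforward f (pushforward f) := by
  rw [pushforward, dif_pos h]
  exact h.choose_spec

theorem isPullback_pullback {f : X → Y} (h : ∃ q, IsPullback f q) :
    IsPullback f (pullback f) := by
  rw [pullback, dif_pos h]
  exact h.choose_spec

theorem IsPullback.eq_sum {f : X → Y} {q : D Y →+ D X} (h : IsPullback f q) (F : CO Y)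
    {ι : Type*} {s : Finset ι} {G : ι → CO X} (hG : CO.IsPart s G (f ⁻¹' F.carrier)) :
    q (D.cls F) = ∑ i ∈ s, D.cls (G i) := by
  obtain ⟨t, ht⟩ := (h F).1
  rw [(h F).2 t ht]
  exact D.cls_additive.sum_eq_sum (CO.isPart_iff.2 ht) hG

namespace Coloring

section

variable {V : Type*} (κ : Coloring X V)

theorem isOpen_compl (v : V) : IsOpen (κ ⁻¹' {v})ᶜ := by
  have : (κ ⁻¹' {v})ᶜ = ⋃ (w) (_ : w ≠ v), κ ⁻¹' {w} := by
    ext x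
    simp
  rw [this]
  exact isOpen_iUnion fun w => isOpen_iUnion fun _ => κ.isOpen w

/-- The part of `E` of a given colour. -/
def part (v : V) (E : CO X) : CO X :=
  E.restrict (κ ⁻¹' {v}) (isOpen_stable_of_isOpen (κ.isOpen v))
    (isOpen_stable_of_isOpen (κ.isOpen_compl v))

theorem part_carrier (v : V) (E : CO X) : (κ.part v E).carrier = E.carrier ∩ κ ⁻¹' {v} := rfl

theorem part_eq_self {v : V} {E : CO X} (h : E.carrier ⊆ κ ⁻¹' {v}) : κ.part v E = E :=
  CO.ext (inter_eq_left.2 h)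

/-- The projection onto the subgroup generated by the sets of a given colour. -/
noncomputable def proj (v : V) : κ.Grp →+ κ.Grp :=
  κ.lift (fun E => κ.cls (κ.part v E))
    (fun E F G h h' => κ.cls_additive _ _ _
      (by rw [part_carrier, h, union_inter_distrib_right]; rfl)
      (h'.mono inter_subset_left inter_subset_left)) (by
    intro E F h
    obtain ⟨x, y, h1, h2, h3, -, -⟩ := id h
    have hE : ∀ a ∈ E.carrier, κ a = κ x := fun a ha => (h2 ha).1
    have hF : ∀ a ∈ F.carrier, κ a = κ x := fun a ha => (h3 ha).1.trans h1.symm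
    by_cases hv : κ x = v
    · rw [κ.part_eq_self fun a ha => (hE a ha).trans hv,
        κ.part_eq_self fun a ha => (hF a ha).trans hv]
      exact κ.cls_rel h
    · rw [κ.cls_additive.empty (E := κ.part v E), κ.cls_additive.empty (E := κ.part v F)]
      · exact eq_empty_of_forall_notMem fun a ha => hv ((hF a ha.1).symm.trans ha.2)
      · exact eq_empty_of_forall_notMem fun a ha => hv ((hE a ha.1).symm.trans ha.2))

theorem proj_cls (v : V) (E : CO X) : κ.proj v (κ.cls E) = κ.cls (κ.part v E) :=
  κ.lift_cls _ _ _ E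

theorem proj_cls_eq_ite [DecidableEq V] {E : CO X} {v w : V} (h : E.carrier ⊆ κ ⁻¹' {w}) :
    κ.proj v (κ.cls E) = if v = w then κ.cls E else 0 := by
  rw [proj_cls]
  split_ifs with hv
  · rw [κ.part_eq_self (hv ▸ h)]
  · exact κ.cls_additive.empty (eq_empty_of_forall_notMem fun a ha =>
      hv (Eq.trans (Eq.symm ha.2) (h ha.1)))

theorem sum_proj [Fintype V] (a : κ.Grp) : ∑ v, κ.proj v a = a := by
  suffices h : ∑ v, κ.proj v = AddMonoidHom.id _ by
    simpa using DFunLike.congr_fun h a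
  refine hom_ext fun E => ?_
  rw [AddMonoidHom.finsetSum_apply, AddMonoidHom.id_apply]
  simp only [proj_cls]
  refine κ.cls_additive.sum_eq ⟨fun v _ w _ hvw => ?_, ?_⟩
  · refine Set.disjoint_left.2 fun a ha ha' => hvw ?_
    exact Eq.trans (Eq.symm ha.2) ha'.2
  · ext a
    simp [part_carrier]

/-- The map `κ.toD` followed by a power of the homeomorphism. -/
noncomputable def realize (n : ℕ) : κ.Grp →+ D X where
  toFun x := (D.shift X)^[n] (κ.toD x)
  map_zero' := by simp only [map_zero, iterate_map_zero]
  map_add' x y := by rw [map_add, iterate_map_add]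

theorem realize_cls (n : ℕ) (E : CO X) : κ.realize n (κ.cls E) = D.cls (CO.shift^[n] E) := by
  change (D.shift X)^[n] (κ.toD _) = _
  rw [toD_cls, D.shift_iterate_cls]

theorem realize_approx (n : ℕ) (x : FreeAbelianGroup (CO X)) :
    κ.realize n (κ.approx n x) = freeToD X x :=
  κ.shift_toD_approx n x

end

variable {V W : Type*} {κ : Coloring X V} {κ' : Coloring Y W} {f : X → Y}

theorem map_mem_slice (hf : IsScaleMap f) (h : ∀ a b, κ a = κ b → κ' (f a) = κ' (f b)) {x a : X}
    (ha : a ∈ κ.slice x) : f a ∈ κ'.slice (f x) :=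
  ⟨h _ _ ha.1, by rw [← hf.map_br _ _ (κ.dist_le ha.1), ha.2]⟩

theorem Rel.map (hf : IsScaleMap f) (hs : SBijective f)
    (h : ∀ a b, κ a = κ b → κ' (f a) = κ' (f b)) {E F : CO X} (hr : κ.Rel E F) :
    κ'.Rel (E.map f hs hf.cont hf.equivariant) (F.map f hs hf.cont hf.equivariant) := by
  obtain ⟨x, y, h1, h2, h3, h4, h5⟩ := hr
  refine ⟨f x, f y, h _ _ h1, ?_, ?_, ?_, ?_⟩
  · rintro _ ⟨a, ha, rfl⟩
    exact map_mem_slice hf h (h2 ha)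
  · rintro _ ⟨a, ha, rfl⟩
    exact map_mem_slice hf h (h3 ha)
  · rintro _ ⟨a, ha, rfl⟩
    rw [← hf.map_br _ _ (κ.dist_le (h1.symm.trans (h2 ha).1.symm))]
    exact mem_image_of_mem _ (h4 a ha)
  · rintro _ ⟨a, ha, rfl⟩
    rw [← hf.map_br _ _ (κ.dist_le (h1.trans (h3 ha).1.symm))]
    exact mem_image_of_mem _ (h5 a ha)

end Coloring

end SmaleSpace

/-! ### The coloured simplicial groups attached to a pair -/

namespace SUBijectivePair

variable {X : Type u} {Y : Type v} {Z : Type w}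
  [MetricSpace X] [CompactSpace X] [SmaleSpace X]
  [MetricSpace Y] [CompactSpace Y] [SmaleSpace Y]
  [MetricSpace Z] [CompactSpace Z] [SmaleSpace Z]
  {π : SUBijectivePair X Y Z} {J K L M : ℕ}

/-- The image of a compact open set under a reindexing of the entries in `Y`. -/
noncomputable abbrev mapCO (θ : Fin (K + 1) → Fin (L + 1)) (E : CO (π.Sig L M)) : CO (π.Sig K M) :=
  E.map (Sig.comap θ) (Sig.sBijective_comap θ) (Sig.isScaleMap_comap θ).cont
    (Sig.isScaleMap_comap θ).equivariant

theorem mapCO_id (E : CO (π.Sig L M)) : mapCO id E = E :=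
  CO.ext (image_id _)

theorem mapCO_comp (θ : Fin (K + 1) → Fin (L + 1)) (η : Fin (J + 1) → Fin (K + 1))
    (E : CO (π.Sig L M)) : mapCO (θ ∘ η) E = mapCO η (mapCO θ E) :=
  CO.ext (image_comp (Sig.comap η) (Sig.comap θ) E.carrier)

theorem isPushforward_comap (θ : Fin (K + 1) → Fin (L + 1)) :
    IsPushforward (Sig.comap θ : π.Sig L M → π.Sig K M) (pushforward (Sig.comap θ)) := by
  obtain ⟨p, hp⟩ := D.exists_pushforward (Sig.isScaleMap_comap (π := π) (M := M) θ)
    (Sig.sBijective_comap θ)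
  exact isPushforward_pushforward ⟨p, fun E => ⟨_, rfl, hp E⟩⟩

theorem pushforward_comap_cls (θ : Fin (K + 1) → Fin (L + 1)) (E : CO (π.Sig L M)) :
    pushforward (Sig.comap θ) (D.cls E) = D.cls (mapCO θ E) := by
  obtain ⟨F, hF, h⟩ := isPushforward_comap θ E
  rw [h, show F = mapCO θ E from CO.ext hF]

variable (π M) in
/-- The symmetric simplicial group of the dimension groups of `Σ_{L,M}`, for fixed `M`. -/
noncomputable def dRow : SymAb fun L => D (π.Sig L M) where
  map θ := pushforward (Sig.comap θ)
  map_id a := DFunLike.congr_fun (g := AddMonoidHom.id _) (D.hom_ext fun E => by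
    rw [pushforward_comap_cls, mapCO_id]; rfl) a
  map_comp θ η a := DFunLike.congr_fun (g := (pushforward (Sig.comap η)).comp
    (pushforward (Sig.comap θ))) (D.hom_ext fun E => by
      rw [AddMonoidHom.comp_apply]
      simp only [pushforward_comap_cls, mapCO_comp]) a

variable (π M) in
/-- The symmetric simplicial group of formal sums of compact open sets. -/
noncomputable def freeRow : SymAb fun L => FreeAbelianGroup (CO (π.Sig L M)) where
  map θ := FreeAbelianGroup.map (mapCO θ)
  map_id a := DFunLike.congr_fun (g := AddMonoidHom.id _) (FreeAbelianGroup.lift_ext _ _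
    fun E => by rw [FreeAbelianGroup.map_of_apply, mapCO_id]; rfl) a
  map_comp θ η a := DFunLike.congr_fun (g := (FreeAbelianGroup.map (mapCO η)).comp
    (FreeAbelianGroup.map (mapCO θ))) (FreeAbelianGroup.lift_ext _ _ fun E => by
      simp only [AddMonoidHom.comp_apply, FreeAbelianGroup.map_of_apply, mapCO_comp]) a

section Grp

variable {V : Type*} (κ : Coloring (π.Sig 0 M) V)

/-- The map of approximating groups induced by a reindexing of the entries in `Y`. -/
noncomputable def grpMap (θ : Fin (K + 1) → Fin (L + 1)) :
    (Sig.coloring κ L).Grp →+ (Sig.coloring κ K).Grp :=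
  (Sig.coloring κ L).lift (fun E => (Sig.coloring κ K).cls (mapCO θ E))
    ((Sig.coloring κ K).cls_additive.map _ _ _)
    fun _ _ h => Coloring.cls_rel (h.map (Sig.isScaleMap_comap θ) (Sig.sBijective_comap θ)
      fun a b hab => by rw [Sig.coloring_comap, Sig.coloring_comap, hab])

theorem grpMap_cls (θ : Fin (K + 1) → Fin (L + 1)) (E : CO (π.Sig L M)) :
    grpMap κ θ ((Sig.coloring κ L).cls E) = (Sig.coloring κ K).cls (mapCO θ E) := by
  simp [grpMap]

/-- The symmetric simplicial group of the approximating groups. -/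
noncomputable def grpRow : SymAb fun L => (Sig.coloring κ L).Grp where
  map θ := grpMap κ θ
  map_id a := DFunLike.congr_fun (g := AddMonoidHom.id _) (Coloring.hom_ext fun E => by
    rw [grpMap_cls, mapCO_id]; rfl) a
  map_comp θ η a := DFunLike.congr_fun (g := (grpMap κ η).comp (grpMap κ θ))
    (Coloring.hom_ext fun E => by
      rw [AddMonoidHom.comp_apply]
      simp only [grpMap_cls, mapCO_comp]) a

/-- On one slice, `Sig.br_comap_eq` shows that the holonomy map carries the θ-image to the θ'-image
and back. Cutting E into finitely many slices and using additivity gives the general case. -/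
theorem cls_mapCO_part (θ θ' : Fin (K + 1) → Fin (L + 1)) {c : Fin (L + 1) → V}
    (h : c ∘ θ = c ∘ θ') (E : CO (π.Sig L M)) (hE : E.carrier ⊆ Sig.coloring κ L ⁻¹' {c}) :
    (Sig.coloring κ K).cls (mapCO θ E) = (Sig.coloring κ K).cls (mapCO θ' E) := by
  obtain ⟨t, htE, hdisj, hcov⟩ := (Sig.coloring κ L).exists_slice_reps E.cOpen
  let G : π.Sig L M → CO (π.Sig L M) := fun x => E.restrict ((Sig.coloring κ L).slice x)
    (Coloring.isOpen_slice x) (Coloring.isOpen_compl_slice x)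
  have hG : CO.IsPart t G E.carrier := by
    refine ⟨fun x hx y hy hxy => (hdisj hx hy hxy).mono inter_subset_right inter_subset_right, ?_⟩
    simp only [G, CO.restrict_carrier]
    rw [← inter_iUnion₂, inter_eq_left.2 hcov]
  have hp := fun θ : Fin (K + 1) → Fin (L + 1) =>
    hG.map (Sig.sBijective_comap θ) (Sig.isScaleMap_comap θ).cont
      (Sig.isScaleMap_comap θ).equivariant ((Sig.sBijective_comap θ).injOn_CO E)
  rw [← (Sig.coloring κ K).cls_additive.sum_eq (hp θ),
    ← (Sig.coloring κ K).cls_additive.sum_eq (hp θ')]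
  refine Finset.sum_congr rfl fun x hx => Coloring.cls_rel ?_
  have hx' : Sig.coloring κ L x = c := hE (htE x hx)
  have hsub : ∀ η : Fin (K + 1) → Fin (L + 1), (mapCO η (G x)).carrier ⊆
      (Sig.coloring κ K).slice (Sig.comap η x) := by
    rintro η _ ⟨a, ha, rfl⟩
    exact Coloring.map_mem_slice (Sig.isScaleMap_comap η)
      (fun a b hab => by rw [Sig.coloring_comap, Sig.coloring_comap, hab]) ha.2
  refine ⟨Sig.comap θ x, Sig.comap θ' x, ?_, hsub θ, hsub θ', ?_, ?_⟩
  · rw [Sig.coloring_comap, Sig.coloring_comap, hx', h]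
  · rintro _ ⟨a, ha, rfl⟩
    rw [Sig.br_comap_eq ha.2 (by rw [hx', h])]
    exact mem_image_of_mem _ ha
  · rintro _ ⟨a, ha, rfl⟩
    rw [Sig.br_comap_eq ha.2 (by rw [hx', h])]
    exact mem_image_of_mem _ ha

/-- The decomposition of the approximating groups by colours. -/
noncomputable def colored [Fintype V] [DecidableEq V] : (grpRow κ).Colored V where
  e c := (Sig.coloring κ _).proj c
  sum_e a := (Sig.coloring κ _).sum_proj a
  e_map {K L} θ c c' a := by
    have : ((Sig.coloring κ K).proj c').comp ((grpMap κ θ).comp ((Sig.coloring κ L).proj c)) =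
        if c' = c ∘ θ then (grpMap κ θ).comp ((Sig.coloring κ L).proj c) else 0 :=
      Coloring.hom_ext fun E => by
        simp only [AddMonoidHom.comp_apply, Coloring.proj_cls, grpMap_cls]
        rw [← Coloring.proj_cls, Coloring.proj_cls_eq_ite (w := c ∘ θ)]
        · split_ifs
          · simp only [AddMonoidHom.comp_apply, Coloring.proj_cls, grpMap_cls]
          · rfl
        · rintro _ ⟨a, ha, rfl⟩
          have hc : Sig.coloring κ L a = c := ha.2
          rw [mem_preimage, mem_singleton_iff, Sig.coloring_comap, hc]
    have h := DFunLike.congr_fun this a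
    split_ifs at h ⊢ <;> exact h
  map_eq_map {K L} θ θ' c a h := by
    have : (grpMap κ θ).comp ((Sig.coloring κ L).proj c) =
        (grpMap κ θ').comp ((Sig.coloring κ L).proj c) := Coloring.hom_ext fun E => by
      simp only [AddMonoidHom.comp_apply, Coloring.proj_cls, grpMap_cls]
      exact cls_mapCO_part κ θ θ' h _ inter_subset_right
    exact DFunLike.congr_fun this a

theorem isHom_freeToD : SymAb.IsHom (freeRow π M) (dRow π M) fun L => freeToD (π.Sig L M) := by
  intro K L θ a
  have : (freeToD (π.Sig K M)).comp (FreeAbelianGroup.map (mapCO θ)) =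
      (pushforward (Sig.comap θ)).comp (freeToD (π.Sig L M)) :=
    FreeAbelianGroup.lift_ext _ _ fun E => by
      simp only [AddMonoidHom.comp_apply, FreeAbelianGroup.map_of_apply, freeToD_of,
        pushforward_comap_cls]
  exact DFunLike.congr_fun this a

theorem isHom_approx (n : ℕ) :
    SymAb.IsHom (freeRow π M) (grpRow κ) fun L => (Sig.coloring κ L).approx n := by
  intro K L θ a
  have : ((Sig.coloring κ K).approx n).comp (FreeAbelianGroup.map (mapCO θ)) =
      (grpMap κ θ).comp ((Sig.coloring κ L).approx n) :=
    FreeAbelianGroup.lift_ext _ _ fun E => by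
      simp only [AddMonoidHom.comp_apply, FreeAbelianGroup.map_of_apply, Coloring.approx_of,
        grpMap_cls, CO.map_unshift_iterate]
  exact DFunLike.congr_fun this a

theorem isHom_realize (n : ℕ) :
    SymAb.IsHom (grpRow κ) (dRow π M) fun L => (Sig.coloring κ L).realize n := by
  intro K L θ a
  have : ((Sig.coloring κ K).realize n).comp (grpMap κ θ) =
      (pushforward (Sig.comap θ)).comp ((Sig.coloring κ L).realize n) :=
    Coloring.hom_ext fun E => by
      simp only [AddMonoidHom.comp_apply, grpMap_cls, Coloring.realize_cls, pushforward_comap_cls]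
      exact congrArg D.cls ((Function.Semiconj.iterate_right
        (f := fun E : CO (π.Sig L M) => mapCO θ E) (CO.map_shift _ _ _) n E).symm)
  exact DFunLike.congr_fun this a

end Grp

/-- Elements of the dimension groups which are invariant under a transposition are degenerate. -/
theorem mem_deg_of_swap {i j : Fin (L + 1)} (hij : i ≠ j) {a : D (π.Sig L M)}
    (h : (dRow π M).map (Equiv.swap i j) a = a) : a ∈ (dRow π M).deg L := by
  obtain ⟨N, ⟨κ⟩⟩ := Sig.exists_coloring π M
  obtain ⟨x, rfl⟩ := freeToD_surjective _ a
  have hx : freeToD _ ((freeRow π M).map (Equiv.swap i j) x - x) = 0 := by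
    rw [map_sub, sub_eq_zero, isHom_freeToD, h]
  -- Invariance holds only modulo the relations of the dimension group; after φ^{-n} it holds
  -- exactly in the coloured group.
  obtain ⟨n, hn⟩ := (Sig.coloring κ L).exists_approx_eq_zero hx
  have h1 := hn n le_rfl
  rw [map_sub, sub_eq_zero, isHom_approx κ n] at h1
  have h2 := (isHom_realize κ n).mem_deg ((colored κ).mem_deg_of_swap hij h1)
  rwa [Coloring.realize_approx] at h2

/-- Cycles of degenerate elements of the dimension groups are boundaries of degenerate
elements. -/
theorem exists_bdry_eq {a : D (π.Sig (L + 1) M)} (ha : a ∈ (dRow π M).deg (L + 1))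
    (h : (dRow π M).bdry L a = 0) :
    ∃ b ∈ (dRow π M).deg (L + 2), (dRow π M).bdry (L + 1) b = a := by
  obtain ⟨N, ⟨κ⟩⟩ := Sig.exists_coloring π M
  obtain ⟨x, hx, rfl⟩ := (isHom_freeToD (π := π) (M := M)).exists_mem_deg
    (fun L => freeToD_surjective _) ha
  have h0 : freeToD _ ((freeRow π M).bdry L x) = 0 := by
    rw [isHom_freeToD.bdry, h]
  -- The lift x is degenerate, but its boundary vanishes only in the dimension group; φ^{-n} turns
  -- it into a degenerate cycle of the coloured group, where it bounds.
  obtain ⟨n, hn⟩ := (Sig.coloring κ L).exists_approx_eq_zero h0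
  have h1 := hn n le_rfl
  rw [(isHom_approx κ n).bdry] at h1
  obtain ⟨b, hb, hb'⟩ := (colored κ).exists_bdry_eq ((isHom_approx κ n).mem_deg hx) h1
  refine ⟨_, (isHom_realize κ n).mem_deg hb, ?_⟩
  rw [← (isHom_realize κ n).bdry, hb', Coloring.realize_approx]

end SUBijectivePair

/-! ### Quotients by acyclic subcomplexes -/

open ZeroObject in
/-- In a short exact sequence of complexes with acyclic first term, the second map is a
quasi-isomorphism. -/
theorem HomologicalComplex.quasiIso_g_of_shortExact {C ι : Type*} [Category C] [Abelian C]
    {c : ComplexShape ι} {S : ShortComplex (HomologicalComplex C c)} (hS : S.ShortExact)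
    (h : S.X₁.Acyclic) : QuasiIso S.g := by
  -- The given sequence is compared with 0 → X₂ = X₂: the maps on the first two terms are
  -- quasi-isomorphisms, hence so is the one on the third, which is `S.g`.
  let T : ShortComplex (HomologicalComplex C c) :=
    ShortComplex.mk (0 : 0 ⟶ S.X₂) (𝟙 S.X₂) (by simp)
  have hT : T.ShortExact :=
    { exact := (T.exact_iff_mono rfl).2 (inferInstanceAs (Mono (𝟙 S.X₂)))
      mono_f := ⟨fun _ _ _ => (Limits.isZero_zero _).eq_of_tgt _ _⟩
      epi_g := inferInstanceAs (Epi (𝟙 S.X₂)) }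
  let f : T ⟶ S :=
    { τ₁ := 0
      τ₂ := 𝟙 S.X₂
      τ₃ := S.g
      comm₁₂ := by simp [T]
      comm₂₃ := by simp [T] }
  refine HomologicalComplex.HomologySequence.quasiIso_τ₃ f hT hS ?_
    (inferInstanceAs (QuasiIso (𝟙 S.X₂)))
  rw [quasiIso_iff]
  intro i
  rw [quasiIsoAt_iff_exactAt]
  · exact h i
  · exact HomologicalComplex.acyclic_of_isZero _ (Limits.isZero_zero _) i

namespace DoubleComplex

variable {C : DoubleComplex.{u}} {S : ∀ L M, AddSubgroup (C.obj L M)} (hS : C.IsSubcomplex S)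

/-- The chain complex `(S_{•,M}, dh)`. -/
noncomputable def subRow (M : ℕ) : ChainComplex AddCommGrpCat.{u} ℕ :=
  ChainComplex.of (fun L => AddCommGrpCat.of (S L M))
    (fun L => AddCommGrpCat.ofHom (((C.dh L M).comp (S (L + 1) M).subtype).codRestrict (S L M)
      fun a => hS.dh_mem L M a.2))
    (fun L => by
      ext a
      exact C.dh_dh L M a)

theorem subRow_d (L M : ℕ) : (subRow hS M).d (L + 1) L =
    AddCommGrpCat.ofHom (((C.dh L M).comp (S (L + 1) M).subtype).codRestrict (S L M)
      fun a => hS.dh_mem L M a.2) := by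
  simp only [subRow, ChainComplex.of_d]

/-- The inclusion `S_{•,M} → C_{•,M}`. -/
noncomputable def subRowIncl (M : ℕ) : subRow hS M ⟶ C.row M :=
  ChainComplex.ofHom (X := subRow hS M) (Y := C.row M)
    (fun L => AddCommGrpCat.ofHom (S L M).subtype)
    (fun L => by
      simp only [row, subRow, ChainComplex.of_d]
      ext a
      rfl)

theorem subRowIncl_rowProj (M : ℕ) : subRowIncl hS M ≫ rowProj hS M = 0 := by
  ext L a
  exact (QuotientAddGroup.eq_zero_iff _).2 a.2

theorem shortExact_row (M : ℕ) :
    (ShortComplex.mk _ _ (subRowIncl_rowProj hS M)).ShortExact := by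
  refine HomologicalComplex.shortExact_of_degreewise_shortExact _ fun L =>
    { exact := ?_, mono_f := ?_, epi_g := ?_ }
  · rw [ShortComplex.ab_exact_iff]
    intro a ha
    exact ⟨⟨a, (QuotientAddGroup.eq_zero_iff _).1 ha⟩, rfl⟩
  · exact (AddCommGrpCat.mono_iff_injective _).2 Subtype.val_injective
  · exact (AddCommGrpCat.epi_iff_surjective _).2 (QuotientAddGroup.mk'_surjective (S L M))

/-- The hypotheses say exactly that the row of the subcomplex is acyclic: degree 0 is zero, and in
each positive degree every cycle bounds. -/
theorem quasiIso_rowProj {M : ℕ} (h0 : S 0 M = ⊥)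
    (h : ∀ L, ∀ a ∈ S (L + 1) M, C.dh L M a = 0 → ∃ b ∈ S (L + 2) M, C.dh (L + 1) M b = a) :
    QuasiIso (rowProj hS M) := by
  refine HomologicalComplex.quasiIso_g_of_shortExact (shortExact_row hS M) ?_
  rintro (_ | L)
  · refine HomologicalComplex.ExactAt.of_isZero ?_
    have : Subsingleton (AddCommGrpCat.of (S 0 M)) := by
      change Subsingleton (S 0 M)
      rw [h0]
      infer_instance
    exact AddCommGrpCat.isZero_of_subsingleton (AddCommGrpCat.of (S 0 M))
  · rw [HomologicalComplex.exactAt_iff' _ (L + 2) (L + 1) L (ChainComplex.prev ℕ (L + 1))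
      (ChainComplex.next_nat_succ L), ShortComplex.ab_exact_iff]
    rintro ⟨a, ha⟩ h1
    change (subRow hS M).d (L + 1) L ⟨a, ha⟩ = 0 at h1
    rw [subRow_d] at h1
    obtain ⟨b, hb, hb'⟩ := h L a ha (congrArg Subtype.val h1)
    refine ⟨⟨b, hb⟩, ?_⟩
    change (subRow hS M).d (L + 2) (L + 1) ⟨b, hb⟩ = ⟨a, ha⟩
    rw [subRow_d]
    exact Subtype.ext hb'

end DoubleComplex

/-! ### The double complex of an s/u-bijective pair -/

namespace SmaleSpace

variable {X : Type u} [MetricSpace X] [CompactSpace X] [SmaleSpace X]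
variable {Y : Type v} [MetricSpace Y] [CompactSpace Y] [SmaleSpace Y]
variable {Z : Type w} [MetricSpace Z] [CompactSpace Z] [SmaleSpace Z]

theorem IsPullback.exists_isPart_comp {f : Y → Z} {g : X → Y} {p : D Z →+ D Y} {q : D Y →+ D X}
    (hp : IsPullback f p) (hq : IsPullback g q) (F : CO Z) :
    ∃ s : Finset (Σ _ : CO Y, CO X), CO.IsPart s (fun i => i.2) (f ∘ g ⁻¹' F.carrier) ∧
      q (p (D.cls F)) = ∑ i ∈ s, D.cls i.2 := by
  obtain ⟨s, hs⟩ := (hp F).1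
  choose t ht using fun E => (hq E).1
  refine ⟨s.sigma t, CO.IsPart.sigma (T := fun E => g ⁻¹' E.carrier) (H := fun _ => id) ?_ ?_
    fun E _ => CO.isPart_iff.2 (ht E), ?_⟩
  · exact fun E hE F hF h => (hs.1 hE hF h).preimage g
  · rw [preimage_comp, ← hs.2, preimage_iUnion₂]
  · rw [(hp F).2 s hs, map_sum, Finset.sum_sigma]
    exact Finset.sum_congr rfl fun E _ => (hq E).2 _ (ht E)

variable {Y' : Type v} [MetricSpace Y'] [CompactSpace Y'] [SmaleSpace Y']

/-- Pullbacks are functorial. -/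
theorem IsPullback.comp_eq_comp {f : Y → Z} {g : X → Y} {f' : Y' → Z} {g' : X → Y'}
    {p : D Z →+ D Y} {q : D Y →+ D X} {p' : D Z →+ D Y'} {q' : D Y' →+ D X}
    (hp : IsPullback f p) (hq : IsPullback g q) (hp' : IsPullback f' p') (hq' : IsPullback g' q')
    (h : f ∘ g = f' ∘ g') (a : D Z) : q (p a) = q' (p' a) := by
  refine DFunLike.congr_fun (f := q.comp p) (g := q'.comp p') (D.hom_ext fun F => ?_) a
  obtain ⟨s, hs, e⟩ := hp.exists_isPart_comp hq F
  obtain ⟨s', hs', e'⟩ := hp'.exists_isPart_comp hq' F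
  rw [AddMonoidHom.comp_apply, AddMonoidHom.comp_apply, e, e']
  rw [h] at hs
  exact D.cls_additive.sum_eq_sum hs hs'

end SmaleSpace

/-! ### The differentials and the two descriptions of degenerate chains -/

namespace SUBijectivePair

variable {X : Type u} {Y : Type v} {Z : Type w}
  [MetricSpace X] [CompactSpace X] [SmaleSpace X]
  [MetricSpace Y] [CompactSpace Y] [SmaleSpace Y]
  [MetricSpace Z] [CompactSpace Z] [SmaleSpace Z]
  {π : SUBijectivePair X Y Z} {K L M : ℕ}

theorem Sig.degen_eq_comap (l : Fin (L + 1)) (k : Fin (L + 2)) :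
    (Sig.degen l k : π.Sig L M → π.Sig (L + 1) M) =
      Sig.comap (k.insertNth (α := fun _ => Fin (L + 1)) l id) := by
  funext p
  refine Sig.ext (fun i => ?_) fun m => rfl
  refine Fin.succAboveCases k ?_ (fun j => ?_) i
  · simp [Sig.degen, Sig.comap]
  · simp [Sig.degen, Sig.comap]

theorem isPullback_coface (m : Fin (M + 2)) :
    IsPullback (Sig.coface m) (pullback (Sig.coface m : π.Sig L (M + 1) → π.Sig L M)) := by
  obtain ⟨N, ⟨κ⟩⟩ := Sig.exists_coloring π (M + 1)
  exact isPullback_pullback ((Sig.coloring κ L).exists_pullback (Sig.isScaleMap_coface m)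
    (Sig.uBijective_coface m))

variable (π) in
theorem hasInducedMaps : π.HasInducedMaps where
  face _ _ l := isPushforward_comap l.succAbove
  coface _ _ m := isPullback_coface m
  degen L M l k _ := by
    rw [Sig.degen_eq_comap]
    exact isPushforward_comap _
  perm _ _ α := isPushforward_comap α.symm

/-- The base change identity, with injectivity of reindexing on the whole preimage, turns a
partition of the preimage of E into one of the preimage of its image. Commutation with all
reindexings covers faces, degeneracies and permutations at once. -/
theorem isHom_pullback (m : Fin (M + 2)) : SymAb.IsHom (dRow π M) (dRow π (M + 1))
    fun L => pullback (Sig.coface m : π.Sig L (M + 1) → π.Sig L M) := by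
  intro K L θ a
  refine DFunLike.congr_fun
    (f := (pullback (Sig.coface m : π.Sig K (M + 1) → π.Sig K M)).comp (pushforward (Sig.comap θ)))
    (g := (pushforward (Sig.comap θ)).comp
      (pullback (Sig.coface m : π.Sig L (M + 1) → π.Sig L M))) (D.hom_ext fun E => ?_) a
  obtain ⟨s, hs⟩ := (isPullback_coface (L := L) m E).1
  have h := (CO.isPart_iff.2 hs).map (Sig.sBijective_comap θ) (Sig.isScaleMap_comap θ).cont
    (Sig.isScaleMap_comap θ).equivariant (Sig.injOn_comap_preimage_coface θ m E)
  rw [← Sig.preimage_coface_image_comap] at h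
  rw [AddMonoidHom.comp_apply, AddMonoidHom.comp_apply, (isPullback_coface m E).2 s hs, map_sum,
    pushforward_comap_cls, (isPullback_coface m).eq_sum (mapCO θ E) h]
  exact Finset.sum_congr rfl fun F _ => (pushforward_comap_cls θ F).symm

theorem bdry_eq (a : D (π.Sig (L + 1) M)) : π.bdry L M a = (dRow π M).bdry L a := rfl

theorem cobdry_apply (a : D (π.Sig L M)) : π.cobdry L M a =
    ∑ m : Fin (M + 2), ((-1 : ℤ) ^ (L + (m : ℕ))) • pullback (Sig.coface m) a := by
  simp [cobdry]

variable (π) in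
theorem isDoubleComplex : π.IsDoubleComplex where
  bdry_bdry L M a := (dRow π M).bdry_bdry L a
  cobdry_cobdry L M a := by
    have h := sum_sum_alternating_eq_zero (n := M)
      (fun i j => pullback (Sig.coface j : π.Sig L (M + 2) → π.Sig L (M + 1))
        (pullback (Sig.coface i : π.Sig L (M + 1) → π.Sig L M) a)) fun i j hij => by
      refine (isPullback_coface i).comp_eq_comp (isPullback_coface j.succ) (isPullback_coface j)
        (isPullback_coface i.castSucc) (funext fun p => ?_) a
      exact Sig.ext (fun l => rfl) fun k =>
        congrArg p.1.2 (Fin.succ_succAbove_succAbove_of_le hij k)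
    rw [cobdry_apply, ← h, Finset.sum_comm]
    refine Finset.sum_congr rfl fun j _ => ?_
    rw [cobdry_apply, map_sum, Finset.smul_sum]
    refine Finset.sum_congr rfl fun i _ => ?_
    rw [map_zsmul, smul_smul]
    congr 1
    -- The index L enters both signs, so its total contribution (−1)^(2L) is 1 and only the
    -- alternating sum over m remains.
    rw [← pow_add, show L + (j : ℕ) + (L + i) = (i + j) + (L + L) by ring, pow_add _ _ (L + L),
      Even.neg_one_pow (n := L + L) ⟨L, rfl⟩, mul_one]
  anticomm L M a := by
    rw [cobdry_apply, cobdry_apply, map_sum, ← Finset.sum_add_distrib]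
    refine Finset.sum_eq_zero fun m _ => ?_
    -- The pullbacks commute with the boundary; anticommutation comes solely from the sign (−1)^L,
    -- as L drops by one along the boundary.
    rw [map_zsmul, bdry_eq, bdry_eq, (isHom_pullback m).bdry, ← add_smul,
      show L + 1 + (m : ℕ) = L + m + 1 by ring, pow_succ]
    simp

theorem perm_mem_deg (a : D (π.Sig L M)) (α : Equiv.Perm (Fin (L + 1))) :
    pushforward (Sig.perm α) a - (Equiv.Perm.sign α : ℤ) • a ∈ (dRow π M).deg L := by
  have h := SymAb.map_perm_sub_mem_deg (𝒜 := dRow π M) α.symm a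
  rwa [Equiv.Perm.sign_symm] at h

variable (π L M) in
-- A degeneracy repeats an entry, hence comes from a non-injective map. Conversely, if θ i = θ j
-- with i < j, then θ factors through deleting position j and inserting there a copy of entry i,
-- which is the degeneracy σ_{j−i} s_i.
theorem DC_eq_deg : π.DC L M = (dRow π M).deg L := by
  refine le_antisymm (sup_le ?_ ?_) ?_
  · cases L with
    | zero => exact bot_le
    | succ L =>
      refine iSup_le fun l => iSup_le fun k => iSup_le fun _ => ?_
      rintro _ ⟨b, rfl⟩
      rw [Sig.degen_eq_comap]
      refine SymAb.map_mem_deg (𝒜 := dRow π M) (fun h => ?_) b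
      have := Fintype.card_le_of_injective _ h
      simp at this
  · rw [AddSubgroup.closure_le]
    rintro _ ⟨a, α, rfl⟩
    exact perm_mem_deg a α
  · rw [SymAb.deg, AddSubgroup.closure_le]
    rintro _ (⟨K, θ, b, hθ, rfl⟩ | ⟨α, a, rfl⟩)
    · obtain _ | L := L
      · exact (hθ (Function.injective_of_subsingleton (α := Fin 1) θ)).elim
      obtain ⟨i, j, hij, hθ'⟩ : ∃ i j : Fin (L + 2), i < j ∧ θ i = θ j := by
        obtain ⟨i, j, h, hne⟩ := Function.not_injective_iff.1 hθ
        rcases lt_or_gt_of_ne hne with h' | h'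
        · exact ⟨i, j, h', h⟩
        · exact ⟨j, i, h', h.symm⟩
      have hiL : (i : ℕ) < L + 1 := by
        have := j.2
        rw [Fin.lt_def] at hij
        omega
      have hi : (⟨i, hiL⟩ : Fin (L + 1)).castSucc = i := rfl
      have hsucc : j.succAbove ⟨i, hiL⟩ = i := by
        rw [Fin.succAbove_of_castSucc_lt _ _ (by rw [hi]; exact hij), hi]
      have h1 : θ = (θ ∘ j.succAbove) ∘
          j.insertNth (α := fun _ => Fin (L + 1)) ⟨i, hiL⟩ id := by
        funext k
        refine Fin.succAboveCases j ?_ (fun k => ?_) k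
        · simp [hsucc, hθ']
        · simp
      refine AddSubgroup.mem_sup_left (AddSubgroup.mem_iSup_of_mem ⟨i, hiL⟩
        (AddSubgroup.mem_iSup_of_mem j (AddSubgroup.mem_iSup_of_mem (by rw [hi]; exact hij)
          ⟨(dRow π M).map (θ ∘ j.succAbove) b, ?_⟩)))
      rw [Sig.degen_eq_comap]
      conv_rhs => rw [h1]
      exact ((dRow π M).map_comp _ _ b).symm
    · refine AddSubgroup.mem_sup_right (AddSubgroup.subset_closure ⟨a, α.symm, ?_⟩)
      rw [Equiv.Perm.sign_symm]
      rfl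

variable (π L M) in
-- An element induced by θ with θ i = θ j is fixed by the transposition of i and j. The converse
-- inclusion for fixed elements is the substantial one and rests on `mem_deg_of_swap`. The
-- antisymmetry generators of the two groups differ by the factor −sgn(α).
theorem DB_eq_deg : π.DB L M = (dRow π M).deg L := by
  refine le_antisymm ?_ ?_
  · rw [DB, AddSubgroup.closure_le]
    rintro _ (⟨i, j, hij, h⟩ | ⟨a, α, rfl⟩)
    · refine mem_deg_of_swap hij ?_
      rw [← Equiv.symm_swap]
      exact h
    · have h := AddSubgroup.zsmul_mem _ (perm_mem_deg a α) (-(Equiv.Perm.sign α : ℤ))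
      rw [smul_sub, smul_smul, neg_mul, Int.units_coe_mul_self] at h
      convert h using 1
      simp [sub_eq_add_neg, add_comm]
  · rw [SymAb.deg, AddSubgroup.closure_le]
    rintro _ (⟨K, θ, b, hθ, rfl⟩ | ⟨α, a, rfl⟩)
    · obtain ⟨i, j, h, hij⟩ := Function.not_injective_iff.1 hθ
      refine AddSubgroup.subset_closure (Or.inl ⟨i, j, hij, ?_⟩)
      refine ((dRow π M).map_comp θ (Equiv.swap i j).symm b).symm.trans ?_
      congr 2
      funext k
      rw [Equiv.symm_swap, Function.comp_apply]
      rcases eq_or_ne k i with rfl | hi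
      · rw [Equiv.swap_apply_left, h]
      · rcases eq_or_ne k j with rfl | hj
        · rw [Equiv.swap_apply_right, h]
        · rw [Equiv.swap_apply_of_ne_of_ne hi hj]
    · have h : a - (Equiv.Perm.sign α.symm : ℤ) • pushforward (Sig.perm α.symm) a ∈ π.DB L M :=
        AddSubgroup.subset_closure (Or.inr ⟨a, α.symm, rfl⟩)
      have h := AddSubgroup.zsmul_mem _ h (-(Equiv.Perm.sign α : ℤ))
      rw [Equiv.Perm.sign_symm, smul_sub, smul_smul, neg_mul, Int.units_coe_mul_self] at h
      convert h using 1
      simp [sub_eq_add_neg, add_comm]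
      rfl

variable (π) in
theorem bdry_le_comap (L M : ℕ) :
    (dRow π M).deg (L + 1) ≤ ((dRow π M).deg L).comap (π.bdry L M) :=
  fun _ ha => SymAb.bdry_mem_deg (𝒜 := dRow π M) ha

variable (π) in
theorem cobdry_le_comap (L M : ℕ) :
    (dRow π M).deg L ≤ ((dRow π (M + 1)).deg L).comap (π.cobdry L M) := by
  intro a ha
  rw [AddSubgroup.mem_comap, cobdry_apply]
  exact sum_mem fun m _ => AddSubgroup.zsmul_mem _ ((isHom_pullback m).mem_deg ha) _

variable (π) in
theorem isSubcomplex_deg :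
    (complex π.isDoubleComplex).IsSubcomplex fun L M => (dRow π M).deg L where
  dh_mem L M := bdry_le_comap π L M
  dv_mem L M := cobdry_le_comap π L M

end SUBijectivePair

/-- Once the two families of subgroups are equal, the identity is the required isomorphism. Treating
the families as variables lets the equality be substituted in the types. -/
theorem DoubleComplex.exists_quotient_iso {C : DoubleComplex.{u}}
    {S T : ∀ L M, AddSubgroup (C.obj L M)} (hS : C.IsSubcomplex S) (hT : C.IsSubcomplex T)
    (h : S = T) :
    ∃ e : (quotient hS).Iso (quotient hT), ∀ L M (a : C.obj L M),
      e.equiv L M (QuotientAddGroup.mk a : C.obj L M ⧸ S L M) =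
        (QuotientAddGroup.mk a : C.obj L M ⧸ T L M) := by
  subst h
  exact ⟨⟨fun L M => AddEquiv.refl _, fun _ _ _ => rfl, fun _ _ _ => rfl⟩, fun _ _ _ => rfl⟩

theorem mainTheorem4 {X : Type u} {Y : Type v} {Z : Type w}
    [MetricSpace X] [CompactSpace X] [SmaleSpace X]
    [MetricSpace Y] [CompactSpace Y] [SmaleSpace Y]
    [MetricSpace Z] [CompactSpace Z] [SmaleSpace Z]
    (π : SUBijectivePair X Y Z) :
    π.HasInducedMaps ∧
    (∀ L M, π.DB L M = π.DC L M) ∧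
    ∃ (h : π.IsDoubleComplex)
      (hDC : (SUBijectivePair.complex h).IsSubcomplex π.DC)
      (hDB : (SUBijectivePair.complex h).IsSubcomplex π.DB),
      (∃ e : (DoubleComplex.quotient hDC).Iso (DoubleComplex.quotient hDB),
        ∀ L M (a : D (π.Sig L M)),
          e.equiv L M (QuotientAddGroup.mk a : D (π.Sig L M) ⧸ π.DC L M) =
            (QuotientAddGroup.mk a : D (π.Sig L M) ⧸ π.DB L M)) ∧
      ∀ M, QuasiIso (DoubleComplex.rowProj hDB M) := by
  have hC : π.DC = fun L M => (SUBijectivePair.dRow π M).deg L :=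
    funext fun L => funext fun M => π.DC_eq_deg L M
  have hB : π.DB = fun L M => (SUBijectivePair.dRow π M).deg L :=
    funext fun L => funext fun M => π.DB_eq_deg L M
  have hDC : (SUBijectivePair.complex π.isDoubleComplex).IsSubcomplex π.DC := by
    rw [hC]; exact π.isSubcomplex_deg
  have hDB : (SUBijectivePair.complex π.isDoubleComplex).IsSubcomplex π.DB := by
    rw [hB]; exact π.isSubcomplex_deg
  refine ⟨π.hasInducedMaps, fun L M => by rw [hB, hC], π.isDoubleComplex, hDC, hDB,
    DoubleComplex.exists_quotient_iso hDC hDB (hC.trans hB.symm), fun M => ?_⟩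
  refine DoubleComplex.quasiIso_rowProj hDB ?_ fun L a ha h => ?_
  · rw [hB]
    exact (SUBijectivePair.dRow π M).deg_zero
  · rw [hB] at ha ⊢
    exact SUBijectivePair.exists_bdry_eq ha h
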